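/- \textbf{Setting.} On $\mathbb R^2$ use $\hat f(\xi)=\int f(x)e^{-ix\cdot\xi}\,dx$. For $\alpha\in[1,2]$, $t>0$ let $P_{\alpha/2}(t,x)=(2\pi)^{-2}\int_{\mathbb R^2}e^{ix\cdot\xi}e^{-t|\xi|^\alpha}\,d\xi$. Let $R_j$ be the Riesz transform with symbol $i\xi_j/|\xi|$, and let $|\nabla|^\beta$ have symbol $|\xi|^\beta$. Let $\theta_0\in W^{1,1}(\mathbb R^2)\cap W^{1,\infty}(\mathbb R^2)$ be real-valued. A real-valued function $\theta$ on $[0,\infty)\times\mathbb R^2$ is a \emph{mild solution} of $\partial_t\theta+(-\Delta)^{\alpha/2}\theta+(u\cdot\nabla)\theta=0$, $u=(-R_2\theta,R_1\theta)$, $\theta|_{t=0}=\theta_0$, if $$\theta(t)=P_{\alpha/2}(t)*\theta_0-\int_0^tP_{\alpha/2}(t-s)*(u(s)\cdot\nabla)\theta(s)\,ds\quad\text{for all }t>0,$$ $\theta(t)\to\theta_0$ in $L^p$ as $t\to0^+$ and $\theta\in C([0,\infty);L^p)$ for all $p\in[1,\infty)$, and $\theta\in C((0,\infty);W^{2,p})\cap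 C^1((0,\infty);L^p)$ for all $p\in[1,\infty]$. \textbf{Lemma.} Let $p\in[1,\infty]$ and $\alpha\in[1,2]$. Let $\theta$ be a mild solution with the following decay properties. (i) For every $q\in[1,\infty]$ there is $C>0$ such that $\|\theta(t)\|_{L^q}\le C(t+1)^{-\frac2\alpha(1-\frac1q)}$ for all $t>0$. (ii) If $\alpha=1$, then for every $q\in[1,\infty]$ and $\beta>0$ there is $C>0$ such that $\||\nabla|^\beta\theta(t)\|_{L^q}\le C\,t^{-2(1-\frac1q)-\beta}$ for all $t\ge1$. Then there exists $C>0$ such that for all $t\ge1$ the integral $\int_0^tP_{\alpha/2}(t-s)*(u(s)\cdot\nabla)\theta(s)\,ds$ converges absolutely at almost every $x\in\mathbb R^2$, defines an element of $L^p(\mathbb R^2)$, and satisfies $$\Big\|\int_0^tP_{\alpha/2}(t-s)*(u(s)\cdot\nabla)\theta(s)\,ds\Big\|_{L^p}\le\frac{C}{b_{\alpha,p}(t)},$$ where, for $t\ge1$, $$b_{\alpha,p}(t)=\begin{cases}t^{\frac2\alpha(1-\frac1p)+\frac3\alpha-1}&\text{if }\alpha\in(1,2],\\[2pt] t^{2(1-\frac1p)+2}\,(1+\ln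 t)^{-1}&\text{if }\alpha=1.\end{cases}$$ -/

import Mathlib

open MeasureTheory Filter Topology
open scoped ENNReal ContDiff FourierTransform Convolution

noncomputable section

namespace SQG

/-- The plane `ℝ²` with its Euclidean norm. -/
abbrev Plane : Type := EuclideanSpace ℝ (Fin 2)

/-! ### Sobolev spaces through weak derivatives -/

/-- `g` is the weak `i`-th partial derivative of `f`. -/
def HasWeakDeriv (i : Fin 2) (f g : Plane → ℝ) : Prop :=
  LocallyIntegrable f ∧ LocallyIntegrable g ∧
    ∀ φ : Plane → ℝ, ContDiff ℝ ∞ φ → HasCompactSupport φ →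
      ∫ x, f x * fderiv ℝ φ x (EuclideanSpace.single i 1) = - ∫ x, g x * φ x

open Classical in
/-- The weak `i`-th partial derivative of `f` (unique up to null sets where it exists). -/
def weakDeriv (i : Fin 2) (f : Plane → ℝ) : Plane → ℝ :=
  if h : ∃ g, HasWeakDeriv i f g then h.choose else 0

/-- Membership of `f` in the Sobolev space `W^{k,p}(ℝ²)`. -/
def MemSobolev : ℕ → (Plane → ℝ) → ℝ≥0∞ → Prop
  | 0, f, p => MemLp f p
  | k + 1, f, p => MemLp f p ∧ ∀ i, HasWeakDeriv i f (weakDeriv i f) ∧ MemSobolev k (weakDeriv i f) p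

/-- The norm of `W^{k,p}(ℝ²)` (the sum of the `L^p` norms of the iterated partial derivatives of
order at most `k`), on members of that space. -/
def sobolevNorm : ℕ → (Plane → ℝ) → ℝ≥0∞ → ℝ≥0∞
  | 0, f, p => eLpNorm f p
  | k + 1, f, p => eLpNorm f p + ∑ i, sobolevNorm k (weakDeriv i f) p

/-- `θ ∈ C(I; W^{k,p}(ℝ²))`; the case `k = 0` is `θ ∈ C(I; L^p(ℝ²))`. -/
def ContinuousInSobolev (I : Set ℝ) (k : ℕ) (p : ℝ≥0∞) (θ : ℝ → Plane → ℝ) : Prop :=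
  ∀ t ∈ I, MemSobolev k (θ t) p ∧
    Tendsto (fun s => sobolevNorm k (θ s - θ t) p) (𝓝[I] t) (𝓝 0)

/-- `θ ∈ C¹((0,∞); L^p(ℝ²))`. -/
def ContDiffInLp (p : ℝ≥0∞) (θ : ℝ → Plane → ℝ) : Prop :=
  ContinuousInSobolev (Set.Ioi 0) 0 p θ ∧
    ∃ θ' : ℝ → Plane → ℝ, ContinuousInSobolev (Set.Ioi 0) 0 p θ' ∧
      ∀ t, 0 < t →
        Tendsto (fun h : ℝ => eLpNorm (h⁻¹ • (θ (t + h) - θ t) - θ' t) p) (𝓝[≠] 0) (𝓝 0)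

/-! ### Fourier multipliers

With Mathlib's normalisation `𝓕 f ξ = ∫ f(x) e^{-2πi⟨x,ξ⟩} dx`, the operator with symbol `m(ξ)` in
the angular convention `∫ f(x) e^{-i⟨x,ξ⟩} dx` is multiplication of `𝓕 f` by `m(2πξ)`. -/

/-- The fractional heat kernel, the function whose Fourier transform is `e^{-t|ξ|^α}`
(in the angular convention), that is `(2π)⁻² ∫ e^{i⟨x,ξ⟩} e^{-t|ξ|^α} dξ`. -/
def heatKernel (α t : ℝ) (x : Plane) : ℝ :=
  (𝓕⁻ (fun ξ : Plane => (Real.exp (-t * (2 * Real.pi * ‖ξ‖) ^ α) : ℂ)) x).re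

/-- The symbol `i ξ_j / |ξ|` of the `j`-th Riesz transform. -/
def rieszSymbol (j : Fin 2) (ξ : Plane) : ℂ := Complex.I * ((ξ j / ‖ξ‖ : ℝ) : ℂ)

theorem memLp_top_rieszSymbol (j : Fin 2) : MemLp (rieszSymbol j) ∞ (volume : Measure Plane) := by
  refine memLp_top_of_bound ?_ 1 (Eventually.of_forall fun ξ => ?_)
  · have : Measurable (rieszSymbol j) := by
      unfold rieszSymbol
      fun_prop
    exact this.aestronglyMeasurable
  · have h : |ξ j| ≤ ‖ξ‖ := by simpa using PiLp.norm_apply_le ξ j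
    simp only [rieszSymbol, norm_mul, Complex.norm_I, one_mul, Complex.norm_real, Real.norm_eq_abs,
      abs_div, abs_norm]
    exact div_le_one_of_le₀ h (norm_nonneg ξ)

/-- The `j`-th Riesz transform on `L²(ℝ²; ℂ)`, with the `L²` Fourier transform of Mathlib. -/
def rieszL2 (j : Fin 2) (f : Lp ℂ 2 (volume : Measure Plane)) : Lp ℂ 2 (volume : Measure Plane) :=
  let g : Lp ℂ 2 (volume : Measure Plane) :=
    (memLp_top_rieszSymbol j).toLp (rieszSymbol j) • 𝓕 f
  𝓕⁻ g

open Classical in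
/-- The `j`-th Riesz transform `R_j f = ∂_j (-Δ)^{-1/2} f` of a real function `f ∈ L²(ℝ²)`;
it is real-valued because the symbol `m` satisfies `m(-ξ) = conj m(ξ)`. -/
def riesz (j : Fin 2) (f : Plane → ℝ) : Plane → ℝ :=
  if hf : MemLp (fun x => (f x : ℂ)) 2 (volume : Measure Plane) then
    fun x => (rieszL2 j (hf.toLp _) x).re
  else 0

/-- `g = |∇|^β f` for `f ∈ L¹(ℝ²)`, in the sense of tempered distributions: the Fourier transform
of `g` is the function `|ξ|^β f̂(ξ)` (in the angular convention). -/
def IsFracDeriv (β : ℝ) (f g : Plane → ℝ) : Prop :=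
  ∀ φ : SchwartzMap Plane ℂ,
    ∫ x, (g x : ℂ) * 𝓕 (φ : Plane → ℂ) x =
      ∫ ξ, (((2 * Real.pi * ‖ξ‖) ^ β : ℝ) : ℂ) * 𝓕 (fun x => (f x : ℂ)) ξ * φ ξ

/-! ### The surface quasi-geostrophic equation -/

/-- `(u · ∇) f` with the velocity `u = (-R₂ f, R₁ f)`. -/
def advection (f : Plane → ℝ) (x : Plane) : ℝ :=
  - riesz 1 f x * weakDeriv 0 f x + riesz 0 f x * weakDeriv 1 f x

/-- `P_{α/2}(t - s) ∗ (u(s) · ∇) θ(s)`, evaluated at `x`. -/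
def duhamelIntegrand (α : ℝ) (θ : ℝ → Plane → ℝ) (t s : ℝ) (x : Plane) : ℝ :=
  (heatKernel α (t - s) ⋆[ContinuousLinearMap.mul ℝ ℝ, volume] advection (θ s)) x

/-- The nonlinear part `∫₀ᵗ P_{α/2}(t - s) ∗ (u(s) · ∇) θ(s) ds`. -/
def duhamel (α : ℝ) (θ : ℝ → Plane → ℝ) (t : ℝ) (x : Plane) : ℝ :=
  ∫ s in (0 : ℝ)..t, duhamelIntegrand α θ t s x

/-- `θ` is a mild solution of the surface quasi-geostrophic equation with initial datum `θ₀`. -/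
structure IsMildSolution (α : ℝ) (θ₀ : Plane → ℝ) (θ : ℝ → Plane → ℝ) : Prop where
  integral_eq : ∀ t, 0 < t → ∀ᵐ x : Plane,
    θ t x = (heatKernel α t ⋆[ContinuousLinearMap.mul ℝ ℝ, volume] θ₀) x - duhamel α θ t x
  initial : ∀ p : ℝ≥0∞, 1 ≤ p → p ≠ ⊤ →
    Tendsto (fun t => eLpNorm (θ t - θ₀) p) (𝓝[>] 0) (𝓝 0)
  continuous_Lp : ∀ p : ℝ≥0∞, 1 ≤ p → p ≠ ⊤ → ContinuousInSobolev (Set.Ici 0) 0 p θ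
  continuous_W2p : ∀ p : ℝ≥0∞, 1 ≤ p → ContinuousInSobolev (Set.Ioi 0) 2 p θ
  contDiff_Lp : ∀ p : ℝ≥0∞, 1 ≤ p → ContDiffInLp p θ

/-- The decay of the solution in every `L^p`, together with, for `α = 1`, the decay of all its
fractional derivatives. -/
structure HasDecay (α : ℝ) (θ : ℝ → Plane → ℝ) : Prop where
  solution : ∀ p : ℝ≥0∞, 1 ≤ p → ∃ C : ℝ, 0 < C ∧ ∀ t : ℝ, 0 < t →
    eLpNorm (θ t) p ≤ ENNReal.ofReal (C * (t + 1) ^ (-(2 / α) * (1 - (1 / p).toReal)))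
  derivative : α = 1 → ∀ p : ℝ≥0∞, 1 ≤ p → ∀ β : ℝ, 0 < β → ∃ C : ℝ, 0 < C ∧ ∀ t : ℝ, 1 ≤ t →
    ∃ g : Plane → ℝ, IsFracDeriv β (θ t) g ∧ MemLp g p ∧
      eLpNorm g p ≤ ENNReal.ofReal (C * t ^ (-2 * (1 - (1 / p).toReal) - β))

/-- The rate `b_{α,p}(t)`, for `t ≥ 1`. -/
def rate (α : ℝ) (p : ℝ≥0∞) (t : ℝ) : ℝ :=
  if α = 1 then t ^ (2 * (1 - (1 / p).toReal) + 2) / (1 + Real.log t)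
  else t ^ (2 / α * (1 - (1 / p).toReal) + 3 / α - 1)

end SQG

end

noncomputable section

namespace SQG

/-! ### The Fourier transform on `L¹ ∩ L²` -/

/-! It suffices to bound the Duhamel term in `L¹` by `t^{1-3/α}` and in `L^∞` by `t^{1-5/α}`, with
an extra factor `1 + ln t` when `α = 1`; interpolation (`eLpNorm_le_of_one_of_top`) then gives every
`p`.

Writing the nonlinearity as `div(uθ)` puts one derivative on the heat kernel, which is not enough
for the early times `s < t/2`. A second one is gained from antisymmetry. Let `K` be the vector
kernel of the Riesz transforms: it is odd, of size `|z|⁻²`, and a gradient. Test `(u·∇)f` against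
`φ` and integrate by parts. The terms with a derivative of `K` cancel, because `∂_i K_j = ∂_j K_i`
(that is, `div u = 0`), and exchanging `x` and `y` in what remains replaces `∇φ(x)` by half of
`∇φ(x) - ∇φ(y)`. Hence `|∫ φ (u·∇)f| ≤ ∬ |f(x)| |f(y)| |∇φ(x) - ∇φ(y)| |x-y|⁻² dx dy`
(`IsRegular.enorm_integral_mul_advection_le`). To avoid principal values, `K` is written as a
superposition of derivatives of Gaussians (`integral_mul_riesz`).

Now take `φ = P(t-s, x₀ - ·)`. The `L¹` modulus of continuity of `∇P(τ)` is at most `C τ^{-(1+ε)/α}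
|z|^ε` for `0 < ε ≤ 1`, and its Lipschitz constant is at most `C τ^{-4/α}`. The remaining potentials
`|x-y|^{ε-2}` are estimated from the `L¹` and `L^∞` norms of `θ(s)` by splitting at distance
`(1+s)^{1/α}`.

Early times `s ≤ t/2`: with `ε = 1` the integrand is at most `t^{-2/α} (1+s)^{-1/α}` in `L¹` and
`t^{-4/α} (1+s)^{-1/α}` in `L^∞`, up to constants; the integral of `(1+s)^{-1/α}` produces the
logarithm when `α = 1`.

Late times `s > t/2`: if `α > 1`, a small `ε` makes `(t-s)^{-(1+ε)/α}` integrable. If `α = 1` no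
such `ε` exists; instead the decay of the derivatives bounds `(u·∇)θ(s)` by `s⁻³` in `L¹` and `s⁻⁵`
in `L^∞` (`exists_eLpNorm_advection_le`), and `P` is bounded in `L¹`. -/

theorem continuous_fourier_of_integrable {f : Plane → ℂ} (hf : Integrable f) :
    Continuous (𝓕 f) :=
  VectorFourier.fourierIntegral_continuous Real.continuous_fourierChar
    continuous_inner hf

theorem continuous_fourierInv_of_integrable {f : Plane → ℂ} (hf : Integrable f) :
    Continuous (𝓕⁻ f) := by
  rw [funext (Real.fourierInv_eq_fourier_neg f)]
  exact (continuous_fourier_of_integrable hf).comp continuous_neg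

theorem norm_fourier_le (f : Plane → ℂ) (ξ : Plane) : ‖𝓕 f ξ‖ ≤ ∫ x, ‖f x‖ :=
  VectorFourier.norm_fourierIntegral_le_integral_norm _ _ _ _ _

theorem norm_fourierInv_le (f : Plane → ℂ) (ξ : Plane) : ‖𝓕⁻ f ξ‖ ≤ ∫ x, ‖f x‖ := by
  rw [Real.fourierInv_eq_fourier_neg]
  exact norm_fourier_le f _

theorem integral_fourier_mul_eq {f g : Plane → ℂ} (hf : Integrable f) (hg : Integrable g) :
    ∫ ξ, 𝓕 f ξ * g ξ = ∫ x, f x * 𝓕 g x := by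
  have := VectorFourier.integral_fourierIntegral_smul_eq_flip (μ := (volume : Measure Plane))
    (ν := volume) (L := innerₗ Plane) Real.continuous_fourierChar continuous_inner hf hg
  rw [flip_innerₗ] at this
  exact this

theorem integral_fourierInv_mul_eq {f g : Plane → ℂ} (hf : Integrable f) (hg : Integrable g) :
    ∫ ξ, 𝓕⁻ f ξ * g ξ = ∫ x, f x * 𝓕⁻ g x := by
  have h := integral_fourier_mul_eq hf.comp_neg hg
  have e1 : 𝓕⁻ f = 𝓕 (fun x => f (-x)) := by rw [Real.fourierInv_eq_fourier_comp_neg]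
  rw [e1, h, ← integral_neg_eq_self]
  simp [Real.fourierInv_eq_fourier_neg]

/-- A function which tests like the Fourier transform of `g ∈ L²` is that Fourier transform. -/
theorem fourier_toLp_ae_eq_of_forall {g F : Plane → ℂ} (hg : MemLp g 2)
    (hF : LocallyIntegrable F)
    (h : ∀ φ : SchwartzMap Plane ℂ, ∫ x, g x * 𝓕 (φ : Plane → ℂ) x = ∫ ξ, F ξ * φ ξ) :
    (𝓕 (hg.toLp g) : Lp ℂ 2 (volume : Measure Plane)) =ᵐ[volume] F := by
  refine ae_eq_of_integral_contDiff_smul_eq ((Lp.memLp _).locallyIntegrable one_le_two) hF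
    fun ρ hρ hc => ?_
  have h1 : HasCompactSupport (Complex.ofRealCLM ∘ ρ) := hc.comp_left rfl
  have h2 : ContDiff ℝ ∞ (Complex.ofRealCLM ∘ ρ) := by fun_prop
  set φ := h1.toSchwartzMap h2 with hφ
  have e1 := congrArg (fun T : TemperedDistribution Plane ℂ => T φ)
    (Lp.fourier_toTemperedDistribution_eq (hg.toLp g))
  simp only [TemperedDistribution.fourier_apply, Lp.toTemperedDistribution_apply] at e1
  calc ∫ x, ρ x • (𝓕 (hg.toLp g) : Lp ℂ 2 (volume : Measure Plane)) x
      = ∫ x, φ x • (𝓕 (hg.toLp g) : Lp ℂ 2 (volume : Measure Plane)) x := by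
        simp [hφ]
    _ = ∫ x, (𝓕 φ) x • (hg.toLp g) x := e1.symm
    _ = ∫ x, g x * 𝓕 (φ : Plane → ℂ) x := by
        apply integral_congr_ae
        filter_upwards [hg.coeFn_toLp] with x hx
        rw [hx, smul_eq_mul, mul_comm, SchwartzMap.fourier_coe]
    _ = ∫ ξ, F ξ * φ ξ := h φ
    _ = _ := by
        simp [hφ, mul_comm]

theorem fourier_toLp_ae_eq {f : Plane → ℂ} (hf : Integrable f) (hf2 : MemLp f 2) :
    (𝓕 (hf2.toLp f) : Lp ℂ 2 (volume : Measure Plane)) =ᵐ[volume] 𝓕 f :=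
  fourier_toLp_ae_eq_of_forall hf2 (continuous_fourier_of_integrable hf).locallyIntegrable
    fun φ => (integral_fourier_mul_eq hf φ.integrable).symm

theorem fourierInv_toLp_ae_eq {f : Plane → ℂ} (hf : Integrable f) (hf2 : MemLp f 2) :
    (𝓕⁻ (hf2.toLp f) : Lp ℂ 2 (volume : Measure Plane)) =ᵐ[volume] 𝓕⁻ f := by
  refine ae_eq_of_integral_contDiff_smul_eq ((Lp.memLp _).locallyIntegrable one_le_two)
    (continuous_fourierInv_of_integrable hf).locallyIntegrable fun ρ hρ hc => ?_
  have h1 : HasCompactSupport (Complex.ofRealCLM ∘ ρ) := hc.comp_left rfl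
  have h2 : ContDiff ℝ ∞ (Complex.ofRealCLM ∘ ρ) := by fun_prop
  set φ := h1.toSchwartzMap h2 with hφ
  have e1 := congrArg (fun T : TemperedDistribution Plane ℂ => T φ)
    (Lp.fourierInv_toTemperedDistribution_eq (hf2.toLp f))
  simp only [TemperedDistribution.fourierInv_apply, Lp.toTemperedDistribution_apply] at e1
  calc ∫ x, ρ x • (𝓕⁻ (hf2.toLp f) : Lp ℂ 2 (volume : Measure Plane)) x
      = ∫ x, φ x • (𝓕⁻ (hf2.toLp f) : Lp ℂ 2 (volume : Measure Plane)) x := by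
        simp [hφ]
    _ = ∫ x, (𝓕⁻ φ) x • (hf2.toLp f) x := e1.symm
    _ = ∫ x, f x * 𝓕⁻ (φ : Plane → ℂ) x := by
        apply integral_congr_ae
        filter_upwards [hf2.coeFn_toLp] with x hx
        rw [hx, smul_eq_mul, mul_comm, SchwartzMap.fourierInv_coe]
    _ = ∫ ξ, 𝓕⁻ f ξ * φ ξ := (integral_fourierInv_mul_eq hf φ.integrable).symm
    _ = _ := by
        simp [hφ, mul_comm]

theorem eLpNorm_fourier_toLp {f : Plane → ℂ} (hf : MemLp f 2) :
    eLpNorm (𝓕 (hf.toLp f) : Lp ℂ 2 (volume : Measure Plane)) 2 = eLpNorm f 2 := by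
  have h := Lp.norm_fourier_eq (hf.toLp f)
  rw [Lp.norm_def, Lp.norm_def,
    ENNReal.toReal_eq_toReal_iff' (Lp.eLpNorm_ne_top _) (Lp.eLpNorm_ne_top _)] at h
  rw [h, eLpNorm_congr_ae hf.coeFn_toLp]

/-- Plancherel. -/
theorem eLpNorm_fourier_eq {f : Plane → ℂ} (hf : Integrable f) (hf2 : MemLp f 2) :
    eLpNorm (𝓕 f) 2 = eLpNorm f 2 := by
  rw [← eLpNorm_congr_ae (fourier_toLp_ae_eq hf hf2), eLpNorm_fourier_toLp hf2]

theorem memLp_fourier {f : Plane → ℂ} (hf : Integrable f) (hf2 : MemLp f 2) :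
    MemLp (𝓕 f) 2 :=
  ⟨(continuous_fourier_of_integrable hf).aestronglyMeasurable,
    by rw [eLpNorm_fourier_eq hf hf2]; exact hf2.2⟩

theorem eLpNorm_fourierInv_eq {f : Plane → ℂ} (hf : Integrable f) (hf2 : MemLp f 2) :
    eLpNorm (𝓕⁻ f) 2 = eLpNorm f 2 := by
  rw [Real.fourierInv_eq_fourier_comp_neg]
  have hmp := Measure.measurePreserving_neg (volume : Measure Plane)
  rw [eLpNorm_fourier_eq hf.comp_neg (hf2.comp_measurePreserving hmp)]
  exact eLpNorm_comp_measurePreserving hf2.1 hmp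

/-- Inversion is carried out in `L²`, so no continuity of `f` is needed; integrability of `𝓕 f`
identifies the `L²` inverse with the inverse given by the integral. The bound therefore holds almost
everywhere only. -/
theorem ae_norm_le_integral_norm_fourier {f : Plane → ℂ} (hf : Integrable f) (hf2 : MemLp f 2)
    (hF : Integrable (𝓕 f)) : ∀ᵐ x, ‖f x‖ ≤ ∫ ξ, ‖𝓕 f ξ‖ := by
  have h1 : (𝓕 (hf2.toLp f) : Lp ℂ 2 (volume : Measure Plane)) =
      (memLp_fourier hf hf2).toLp (𝓕 f) := by
    apply Lp.ext
    exact (fourier_toLp_ae_eq hf hf2).trans (memLp_fourier hf hf2).coeFn_toLp.symm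
  have h2 : hf2.toLp f = 𝓕⁻ ((memLp_fourier hf hf2).toLp (𝓕 f)) := by
    rw [← h1, FourierTransform.fourierInv_fourier_eq]
  filter_upwards [hf2.coeFn_toLp, fourierInv_toLp_ae_eq hF (memLp_fourier hf hf2)] with x hx h3
  rw [← hx, h2, h3]
  exact norm_fourierInv_le _ _

/-! ### Weak derivatives -/

/-- The `i`-th vector of the standard basis of the plane. -/
abbrev basisVec (i : Fin 2) : Plane := EuclideanSpace.single i 1

/-- A weak derivative may be tested against smooth functions which are bounded with their
derivative. -/
theorem HasWeakDeriv.integral_mul_fderiv_eq {i : Fin 2} {f g : Plane → ℝ} (h : HasWeakDeriv i f g)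
    (hf : Integrable f) (hg : Integrable g) {ψ : Plane → ℝ} (hψ : ContDiff ℝ ∞ ψ) {A B : ℝ}
    (hA : ∀ x, |ψ x| ≤ A) (hB : ∀ x, |fderiv ℝ ψ x (basisVec i)| ≤ B) :
    ∫ x, f x * fderiv ℝ ψ x (basisVec i) = - ∫ x, g x * ψ x := by
  -- The cutoffs `χ(cₙ x)` with `cₙ = 1/(n+1)` tend to 1, and their derivative carries a factor
  -- `cₙ`, so the commutator term disappears in the limit; integrability of `f` and `g` supplies the
  -- domination.
  let χ : ContDiffBump (0 : Plane) := ⟨1, 2, one_pos, one_lt_two⟩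
  have hχ : ContDiff ℝ ∞ (χ : Plane → ℝ) := χ.contDiff
  have hχd : Differentiable ℝ (χ : Plane → ℝ) := hχ.differentiable (by simp)
  have hψd : Differentiable ℝ ψ := hψ.differentiable (by simp)
  obtain ⟨D, hD⟩ := (χ.hasCompactSupport.fderiv (𝕜 := ℝ)).exists_bound_of_continuous
    (hχ.continuous_fderiv (by simp))
  have hA0 : 0 ≤ A := (abs_nonneg _).trans (hA 0)
  have hB0 : 0 ≤ B := (abs_nonneg _).trans (hB 0)
  have hD0 : 0 ≤ D := (norm_nonneg _).trans (hD 0)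
  let c : ℕ → ℝ := fun n => ((n : ℝ) + 1)⁻¹
  have hc0 : ∀ n, 0 < c n := fun n => by positivity
  have hc1 : ∀ n, c n ≤ 1 := fun n => inv_le_one_of_one_le₀ (by simp)
  have hc : Tendsto c atTop (𝓝 0) := by
    simpa [c, one_div] using tendsto_one_div_add_atTop_nhds_zero_nat (𝕜 := ℝ)
  have hsm : ∀ x : Plane, Tendsto (fun n => c n • x) atTop (𝓝 0) := fun x => by
    simpa using hc.smul_const x
  have hχ1 : ∀ x : Plane, Tendsto (fun n => χ (c n • x)) atTop (𝓝 1) := fun x => by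
    have : Tendsto (fun n => χ (c n • x)) atTop (𝓝 (χ 0)) :=
      (hχ.continuous.tendsto 0).comp (hsm x)
    rwa [χ.one_of_mem_closedBall (by simp [χ])] at this
  have hfd : ∀ n x, fderiv ℝ (fun y => χ (c n • y) * ψ y) x (basisVec i) =
      χ (c n • x) * fderiv ℝ ψ x (basisVec i) +
        ψ x * (c n * fderiv ℝ χ (c n • x) (basisVec i)) := by
    intro n x
    have h1 : HasFDerivAt (fun y : Plane => χ (c n • y))
        ((fderiv ℝ χ (c n • x)).comp (c n • ContinuousLinearMap.id ℝ Plane)) x :=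
      (hχd (c n • x)).hasFDerivAt.comp x ((hasFDerivAt_id x).const_smul (c n))
    have h2 : HasFDerivAt (fun y => χ (c n • y) * ψ y) _ x := h1.mul (hψd x).hasFDerivAt
    rw [h2.fderiv]
    simp
  have hχle : ∀ x, |χ x| ≤ 1 := fun x => by
    rw [abs_of_nonneg χ.nonneg]; exact χ.le_one
  have key : ∀ n, ∫ x, f x * fderiv ℝ (fun y => χ (c n • y) * ψ y) x (basisVec i) =
      - ∫ x, g x * (χ (c n • x) * ψ x) := by
    intro n
    refine h.2.2 _ ((hχ.comp (contDiff_const_smul (c n))).mul hψ) (HasCompactSupport.mul_right ?_)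
    exact χ.hasCompactSupport.comp_smul (hc0 n).ne'
  have L1 : Tendsto (fun n => ∫ x, f x * fderiv ℝ (fun y => χ (c n • y) * ψ y) x (basisVec i))
      atTop (𝓝 (∫ x, f x * fderiv ℝ ψ x (basisVec i))) := by
    refine tendsto_integral_of_dominated_convergence (fun x => ‖f x‖ * (B + A * D)) ?_
      (hf.norm.mul_const _) ?_ ?_
    · intro n
      refine hf.1.mul (Continuous.aestronglyMeasurable ?_)
      have : ContDiff ℝ ∞ (fun y => χ (c n • y) * ψ y) :=
        (hχ.comp (contDiff_const_smul (c n))).mul hψ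
      exact (this.continuous_fderiv (by simp)).clm_apply continuous_const
    · intro n
      refine Eventually.of_forall fun x => ?_
      rw [norm_mul, hfd]
      refine mul_le_mul_of_nonneg_left ?_ (norm_nonneg _)
      refine (norm_add_le _ _).trans (add_le_add ?_ ?_)
      · rw [norm_mul]
        exact (mul_le_mul (hχle _) (hB x) (abs_nonneg _) zero_le_one).trans_eq (one_mul _)
      · rw [norm_mul, norm_mul]
        refine mul_le_mul (hA x) ?_ (by positivity) hA0
        have h2 : ‖fderiv ℝ χ (c n • x) (basisVec i)‖ ≤ D := by
          have := (fderiv ℝ χ (c n • x)).le_opNorm (basisVec i)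
          simp at this
          exact this.trans (hD _)
        calc ‖c n‖ * _ ≤ 1 * D := mul_le_mul (by
              rw [Real.norm_of_nonneg (hc0 n).le]; exact hc1 n) h2 (norm_nonneg _) zero_le_one
          _ = D := one_mul D
    · refine Eventually.of_forall fun x => ?_
      have h3 : Tendsto (fun n => fderiv ℝ χ (c n • x) (basisVec i)) atTop
          (𝓝 (fderiv ℝ χ 0 (basisVec i))) :=
        (((hχ.continuous_fderiv (by simp)).clm_apply continuous_const).tendsto 0).comp (hsm x)
      have h4 := (((hχ1 x).mul_const (fderiv ℝ ψ x (basisVec i))).add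
        ((hc.mul h3).const_mul (ψ x))).const_mul (f x)
      simpa only [hfd, one_mul, zero_mul, mul_zero, add_zero] using h4
  have L2 : Tendsto (fun n => - ∫ x, g x * (χ (c n • x) * ψ x)) atTop
      (𝓝 (- ∫ x, g x * ψ x)) := by
    refine (tendsto_integral_of_dominated_convergence (fun x => ‖g x‖ * A) ?_
      (hg.norm.mul_const _) ?_ ?_).neg
    · intro n
      exact hg.1.mul (((hχ.continuous.comp (continuous_const_smul _)).mul
        hψ.continuous).aestronglyMeasurable)
    · intro n
      refine Eventually.of_forall fun x => ?_
      rw [norm_mul, norm_mul]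
      refine mul_le_mul_of_nonneg_left ?_ (norm_nonneg _)
      exact (mul_le_mul (hχle _) (hA x) (abs_nonneg _) zero_le_one).trans_eq (one_mul _)
    · refine Eventually.of_forall fun x => ?_
      simpa using ((hχ1 x).mul_const (ψ x)).const_mul (g x)
  refine tendsto_nhds_unique L1 ?_
  simpa only [key] using L2

theorem HasWeakDeriv.ae_unique {i : Fin 2} {f g g' : Plane → ℝ} (h : HasWeakDeriv i f g)
    (h' : HasWeakDeriv i f g') : g =ᵐ[volume] g' := by
  refine ae_eq_of_integral_contDiff_smul_eq h.2.1 h'.2.1 fun ρ hρ hc => ?_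
  have := (h.2.2 ρ hρ hc).symm.trans (h'.2.2 ρ hρ hc)
  simpa [mul_comm] using this

theorem HasWeakDeriv.sub {i : Fin 2} {f₁ g₁ f₂ g₂ : Plane → ℝ} (h₁ : HasWeakDeriv i f₁ g₁)
    (h₂ : HasWeakDeriv i f₂ g₂) : HasWeakDeriv i (f₁ - f₂) (g₁ - g₂) := by
  refine ⟨h₁.1.sub h₂.1, h₁.2.1.sub h₂.2.1, fun φ hφ hc => ?_⟩
  have hc' : HasCompactSupport (fun x => fderiv ℝ φ x (basisVec i)) :=
    hc.fderiv_apply (𝕜 := ℝ) _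
  have hcont : Continuous (fun x => fderiv ℝ φ x (basisVec i)) :=
    (hφ.continuous_fderiv (by simp)).clm_apply continuous_const
  have a1 := h₁.1.integrable_smul_right_of_hasCompactSupport hcont hc'
  have a2 := h₂.1.integrable_smul_right_of_hasCompactSupport hcont hc'
  have b1 := h₁.2.1.integrable_smul_right_of_hasCompactSupport hφ.continuous hc
  have b2 := h₂.2.1.integrable_smul_right_of_hasCompactSupport hφ.continuous hc
  simp only [smul_eq_mul] at a1 a2 b1 b2
  simp only [Pi.sub_apply, sub_mul]
  rw [integral_sub a1 a2, integral_sub b1 b2, h₁.2.2 φ hφ hc, h₂.2.2 φ hφ hc]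
  ring

theorem HasWeakDeriv.congr {i : Fin 2} {f f' g g' : Plane → ℝ} (h : HasWeakDeriv i f g)
    (hf : f =ᵐ[volume] f') (hg : g =ᵐ[volume] g') : HasWeakDeriv i f' g' := by
  refine ⟨h.1.congr hf, h.2.1.congr hg, fun φ hφ hc => ?_⟩
  refine (integral_congr_ae ?_).trans ((h.2.2 φ hφ hc).trans (congrArg _ (integral_congr_ae ?_)))
  · filter_upwards [hf] with x hx
    rw [hx]
  · filter_upwards [hg] with x hx
    rw [hx]

theorem HasWeakDeriv.weakDeriv {i : Fin 2} {f g : Plane → ℝ} (h : HasWeakDeriv i f g) :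
    HasWeakDeriv i f (weakDeriv i f) := by
  have h' : ∃ g, HasWeakDeriv i f g := ⟨g, h⟩
  rw [SQG.weakDeriv, dif_pos h']
  exact h'.choose_spec

theorem HasWeakDeriv.weakDeriv_ae_eq {i : Fin 2} {f g : Plane → ℝ} (h : HasWeakDeriv i f g) :
    SQG.weakDeriv i f =ᵐ[volume] g :=
  h.weakDeriv.ae_unique h

/-- The Fourier transform of a weak derivative. -/
theorem HasWeakDeriv.fourier_eq {i : Fin 2} {f g : Plane → ℝ} (h : HasWeakDeriv i f g)
    (hf : Integrable f) (hg : Integrable g) (ξ : Plane) :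
    𝓕 (fun x => (g x : ℂ)) ξ = (2 * Real.pi * ξ i : ℝ) * Complex.I * 𝓕 (fun x => (f x : ℂ)) ξ := by
  -- Weak derivatives are tested against real functions, so the character is split into `cos L` and
  -- `sin L`. These lack compact support but are bounded with their derivatives, which is the case
  -- that `integral_mul_fderiv_eq` covers.
  set L : Plane →L[ℝ] ℝ := (-2 * Real.pi) • innerSL ℝ ξ with hL
  have hLx : ∀ x, L x = -2 * Real.pi * inner ℝ x ξ := fun x => by
    simp [hL, real_inner_comm]
  have hLi : L (basisVec i) = -2 * Real.pi * ξ i := by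
    simp [hLx, basisVec, EuclideanSpace.inner_single_left]
  have hdc : ∀ x, fderiv ℝ (fun y => Real.cos (L y)) x (basisVec i) =
      2 * Real.pi * ξ i * Real.sin (L x) := fun x => by
    rw [((L.hasFDerivAt (x := x)).cos).fderiv]
    simp [hLi]
    ring
  have hds : ∀ x, fderiv ℝ (fun y => Real.sin (L y)) x (basisVec i) =
      - (2 * Real.pi * ξ i) * Real.cos (L x) := fun x => by
    rw [((L.hasFDerivAt (x := x)).sin).fderiv]
    simp [hLi]
    ring
  have ec := h.integral_mul_fderiv_eq hf hg (ψ := fun y => Real.cos (L y)) (A := 1)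
    (B := |2 * Real.pi * ξ i|) (Real.contDiff_cos.comp L.contDiff) (fun x => Real.abs_cos_le_one _)
    (fun x => by
      rw [hdc, abs_mul]
      exact mul_le_of_le_one_right (abs_nonneg _) (Real.abs_sin_le_one _))
  have es := h.integral_mul_fderiv_eq hf hg (ψ := fun y => Real.sin (L y)) (A := 1)
    (B := |2 * Real.pi * ξ i|) (Real.contDiff_sin.comp L.contDiff) (fun x => Real.abs_sin_le_one _)
    (fun x => by
      rw [hds, abs_mul, abs_neg]
      exact mul_le_of_le_one_right (abs_nonneg _) (Real.abs_cos_le_one _))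
  simp only [hdc, hds] at ec es
  have F : ∀ k : Plane → ℝ, Integrable k → 𝓕 (fun x => (k x : ℂ)) ξ =
      ((∫ x, k x * Real.cos (L x) : ℝ) : ℂ) + ((∫ x, k x * Real.sin (L x) : ℝ) : ℂ) * Complex.I := by
    intro k hk
    have i1 : Integrable fun x => k x * Real.cos (L x) :=
      hk.mul_bdd (c := 1) (by fun_prop) (Eventually.of_forall fun x => Real.abs_cos_le_one _)
    have i2 : Integrable fun x => k x * Real.sin (L x) :=
      hk.mul_bdd (c := 1) (by fun_prop) (Eventually.of_forall fun x => Real.abs_sin_le_one _)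
    rw [Real.fourier_eq', ← integral_complex_ofReal, ← integral_complex_ofReal,
      ← integral_mul_const, ← integral_add i1.ofReal (i2.ofReal.mul_const _)]
    congr 1 with x
    rw [← hLx, Complex.exp_mul_I]
    push_cast
    rw [smul_eq_mul]
    ring
  rw [F g hg, F f hf]
  have ec' : ∫ x, g x * Real.cos (L x) = -(2 * Real.pi * ξ i) * ∫ x, f x * Real.sin (L x) := by
    rw [← integral_const_mul]
    have : ∀ x, -(2 * Real.pi * ξ i) * (f x * Real.sin (L x)) =
      -(f x * (2 * Real.pi * ξ i * Real.sin (L x))) := fun x => by ring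
    simp only [this, integral_neg, ec, neg_neg]
  have es' : ∫ x, g x * Real.sin (L x) = (2 * Real.pi * ξ i) * ∫ x, f x * Real.cos (L x) := by
    rw [← integral_const_mul]
    have : ∀ x, (2 * Real.pi * ξ i) * (f x * Real.cos (L x)) =
      -(f x * (-(2 * Real.pi * ξ i) * Real.cos (L x))) := fun x => by ring
    simp only [this, integral_neg, es, neg_neg]
  rw [ec', es']
  push_cast
  linear_combination (2 * Real.pi * ξ i : ℂ) * (∫ x, f x * Real.sin (L x) : ℝ) *
    (-Complex.I_sq)

/-! ### Gaussians and their first derivatives -/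

/-- The Gaussian `e^{-πr|z|²}`. -/
def gaussian (r : ℝ) (z : Plane) : ℝ := Real.exp (-(Real.pi * r * ‖z‖ ^ 2))

/-- The `j`-th partial derivative of the Gaussian `e^{-πr|z|²}`. -/
def gaussDeriv (j : Fin 2) (r : ℝ) (z : Plane) : ℝ :=
  -(2 * (Real.pi * r) * z j) * gaussian r z

theorem abs_apply_le_norm (z : Plane) (j : Fin 2) : |z j| ≤ ‖z‖ := by
  simpa using PiLp.norm_apply_le z j

theorem contDiff_apply_plane (j : Fin 2) : ContDiff ℝ ∞ (fun z : Plane => z j) :=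
  (EuclideanSpace.proj (𝕜 := ℝ) j : Plane →L[ℝ] ℝ).contDiff

theorem hasFDerivAt_apply_plane (j : Fin 2) (z : Plane) :
    HasFDerivAt (fun z : Plane => z j) (EuclideanSpace.proj (𝕜 := ℝ) j : Plane →L[ℝ] ℝ) z :=
  (EuclideanSpace.proj (𝕜 := ℝ) j : Plane →L[ℝ] ℝ).hasFDerivAt

theorem contDiff_gaussian (r : ℝ) : ContDiff ℝ ∞ (gaussian r) :=
  Real.contDiff_exp.comp ((contDiff_const.mul (contDiff_norm_sq ℝ)).neg)

theorem continuous_gaussian (r : ℝ) : Continuous (gaussian r) := (contDiff_gaussian r).continuous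

theorem contDiff_gaussDeriv (j : Fin 2) (r : ℝ) : ContDiff ℝ ∞ (gaussDeriv j r) :=
  (contDiff_const.mul (contDiff_apply_plane j)).neg.mul (contDiff_gaussian r)

theorem continuous_gaussDeriv (j : Fin 2) (r : ℝ) : Continuous (gaussDeriv j r) :=
  (contDiff_gaussDeriv j r).continuous

theorem gaussDeriv_neg (j : Fin 2) (r : ℝ) (z : Plane) :
    gaussDeriv j r (-z) = - gaussDeriv j r z := by
  simp [gaussDeriv, gaussian]

theorem fderiv_gaussian_apply (j : Fin 2) (r : ℝ) (z : Plane) :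
    fderiv ℝ (gaussian r) z (basisVec j) = gaussDeriv j r z := by
  have h : HasFDerivAt (gaussian r) _ z :=
    (((hasStrictFDerivAt_norm_sq z).hasFDerivAt.const_mul (Real.pi * r)).neg).exp
  rw [h.fderiv]
  simp [gaussDeriv, gaussian, EuclideanSpace.inner_single_right]
  ring

theorem fderiv_gaussDeriv_apply (i j : Fin 2) (r : ℝ) (z : Plane) :
    fderiv ℝ (gaussDeriv j r) z (basisVec i) =
      (4 * (Real.pi * r) ^ 2 * z i * z j - 2 * (Real.pi * r) * (if i = j then 1 else 0)) *
        gaussian r z := by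
  have h0 : HasFDerivAt (gaussian r) (fderiv ℝ (gaussian r) z) z :=
    ((contDiff_gaussian r).differentiable (by simp) z).hasFDerivAt
  have h : HasFDerivAt (gaussDeriv j r) _ z :=
    (((hasFDerivAt_apply_plane j z).const_mul (2 * (Real.pi * r))).neg).mul h0
  rw [h.fderiv]
  simp only [add_apply, smul_apply,
    fderiv_gaussian_apply, gaussDeriv, smul_eq_mul, neg_apply]
  by_cases hij : i = j
  · simp [basisVec, hij]
    ring
  · simp [basisVec, hij, Ne.symm hij]
    ring

/-- The kernel is a gradient, so its derivative is symmetric. This is the form in which the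
incompressibility of `u` enters the argument. -/
theorem fderiv_gaussDeriv_symm (i j : Fin 2) (r : ℝ) (z : Plane) :
    fderiv ℝ (gaussDeriv j r) z (basisVec i) = fderiv ℝ (gaussDeriv i r) z (basisVec j) := by
  rw [fderiv_gaussDeriv_apply, fderiv_gaussDeriv_apply]
  by_cases h : i = j
  · simp [h]
  · simp [h, Ne.symm h]
    left
    ring

theorem gaussian_pos (r : ℝ) (z : Plane) : 0 < gaussian r z := Real.exp_pos _

theorem gaussian_le_one {r : ℝ} (hr : 0 < r) (z : Plane) : gaussian r z ≤ 1 :=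
  Real.exp_le_one_iff.2 (neg_nonpos.2 (by positivity))

theorem mul_exp_neg_le_one {u : ℝ} : u * Real.exp (-u) ≤ 1 := by
  rw [Real.exp_neg, mul_inv_le_iff₀ (Real.exp_pos u), one_mul]
  linarith [Real.add_one_le_exp u]

theorem abs_gaussDeriv (j : Fin 2) {r : ℝ} (hr : 0 < r) (z : Plane) :
    |gaussDeriv j r z| = 2 * (Real.pi * r) * |z j| * gaussian r z := by
  rw [gaussDeriv, abs_mul, abs_neg, abs_mul, abs_of_pos (gaussian_pos r z),
    abs_of_pos (a := 2 * (Real.pi * r)) (by positivity)]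

/-- Half of the Gaussian absorbs the linear factor, through `2|z_j| ≤ 1 + |z|²` and `u e^{-u} ≤ 1`.
-/
theorem abs_gaussDeriv_le (j : Fin 2) {r : ℝ} (hr : 0 < r) (z : Plane) :
    |gaussDeriv j r z| ≤ (Real.pi * r + 2) * gaussian (r / 2) z := by
  have ha : 0 < Real.pi * r := by positivity
  have hg : gaussian r z = gaussian (r / 2) z * gaussian (r / 2) z := by
    simp only [gaussian, ← Real.exp_add]
    ring_nf
  have h1 : 2 * |z j| ≤ 1 + ‖z‖ ^ 2 := by
    nlinarith [abs_apply_le_norm z j, norm_nonneg z, sq_nonneg (‖z‖ - 1)]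
  have h2 : (Real.pi * r * ‖z‖ ^ 2 / 2) * gaussian (r / 2) z ≤ 1 := by
    have := mul_exp_neg_le_one (u := Real.pi * r * ‖z‖ ^ 2 / 2)
    rw [gaussian]
    convert this using 3
    ring
  have h3 := gaussian_le_one (half_pos hr) z
  have h4 := gaussian_pos (r / 2) z
  rw [abs_gaussDeriv j hr, hg]
  have : 2 * (Real.pi * r) * |z j| * gaussian (r / 2) z ≤ Real.pi * r + 2 := by
    calc 2 * (Real.pi * r) * |z j| * gaussian (r / 2) z
        ≤ (Real.pi * r * (1 + ‖z‖ ^ 2)) * gaussian (r / 2) z := by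
          refine mul_le_mul_of_nonneg_right ?_ h4.le
          nlinarith
      _ = Real.pi * r * gaussian (r / 2) z +
          2 * ((Real.pi * r * ‖z‖ ^ 2 / 2) * gaussian (r / 2) z) := by ring
      _ ≤ _ := by nlinarith
  nlinarith

theorem integrable_gaussian {r : ℝ} (hr : 0 < r) : Integrable (gaussian r) := by
  have h := (GaussianFourier.integrable_cexp_neg_mul_sq_norm_add (V := Plane)
    (b := ((Real.pi * r : ℝ) : ℂ)) (by simp; positivity) 0 0).norm
  refine h.congr (Eventually.of_forall fun z => ?_)
  simp only [Complex.norm_exp, gaussian]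
  congr 1
  simp [← Complex.ofReal_pow]

theorem integrable_gaussDeriv (j : Fin 2) {r : ℝ} (hr : 0 < r) : Integrable (gaussDeriv j r) :=
  ((integrable_gaussian (half_pos hr)).const_mul (Real.pi * r + 2)).mono'
    (continuous_gaussDeriv j r).aestronglyMeasurable
    (Eventually.of_forall fun z => abs_gaussDeriv_le j hr z)

theorem abs_gaussDeriv_le_const (j : Fin 2) {r : ℝ} (hr : 0 < r) (z : Plane) :
    |gaussDeriv j r z| ≤ Real.pi * r + 2 :=
  (abs_gaussDeriv_le j hr z).trans
    (mul_le_of_le_one_right (by positivity) (gaussian_le_one (half_pos hr) z))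

/-- Only finiteness for each fixed `r` matters: the bound justifies Fubini and integrations by
parts, and does not enter the final estimates. -/
theorem abs_fderiv_gaussDeriv_le (i j : Fin 2) {r : ℝ} (hr : 0 < r) (z : Plane) :
    |fderiv ℝ (gaussDeriv j r) z (basisVec i)| ≤ 6 * (Real.pi * r) := by
  have ha : 0 < Real.pi * r := by positivity
  have h2 : (Real.pi * r * ‖z‖ ^ 2) * gaussian r z ≤ 1 := mul_exp_neg_le_one
  have h3 := gaussian_le_one hr z
  have h4 := gaussian_pos r z
  have h5 : |z i * z j| ≤ ‖z‖ ^ 2 := by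
    rw [abs_mul, sq]
    exact mul_le_mul (abs_apply_le_norm z i) (abs_apply_le_norm z j) (abs_nonneg _) (norm_nonneg _)
  have h6 : |4 * (Real.pi * r) ^ 2 * z i * z j - 2 * (Real.pi * r) * (if i = j then 1 else 0)| ≤
      4 * (Real.pi * r) ^ 2 * ‖z‖ ^ 2 + 2 * (Real.pi * r) := by
    refine (abs_sub _ _).trans (add_le_add ?_ ?_)
    · rw [mul_assoc, abs_mul, abs_of_pos (a := 4 * (Real.pi * r) ^ 2) (by positivity)]
      exact mul_le_mul_of_nonneg_left h5 (by positivity)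
    · split_ifs
      · rw [mul_one, abs_of_pos (by positivity)]
      · simp; positivity
  rw [fderiv_gaussDeriv_apply, abs_mul, abs_of_pos h4]
  calc _ ≤ (4 * (Real.pi * r) ^ 2 * ‖z‖ ^ 2 + 2 * (Real.pi * r)) * gaussian r z :=
        mul_le_mul_of_nonneg_right h6 h4.le
    _ = 4 * (Real.pi * r) * ((Real.pi * r * ‖z‖ ^ 2) * gaussian r z) +
        2 * (Real.pi * r) * gaussian r z := by ring
    _ ≤ 4 * (Real.pi * r) * 1 + 2 * (Real.pi * r) * 1 := by gcongr
    _ = _ := by ring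

theorem hasWeakDeriv_gaussian (j : Fin 2) (r : ℝ) :
    HasWeakDeriv j (gaussian r) (gaussDeriv j r) := by
  refine ⟨(continuous_gaussian r).locallyIntegrable, (continuous_gaussDeriv j r).locallyIntegrable,
    fun φ hφ hc => ?_⟩
  have hc' : HasCompactSupport (fun x => fderiv ℝ φ x (basisVec j)) := hc.fderiv_apply (𝕜 := ℝ) _
  have hcont : Continuous (fun x => fderiv ℝ φ x (basisVec j)) :=
    (hφ.continuous_fderiv (by simp)).clm_apply continuous_const
  have := integral_mul_fderiv_eq_neg_fderiv_mul_of_integrable (μ := (volume : Measure Plane))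
    (𝕜 := ℝ) (f := gaussian r) (g := φ) (v := basisVec j) ?_ ?_ ?_
    (fun x _ => (contDiff_gaussian r).differentiable (by simp) x)
    (fun x _ => hφ.differentiable (by simp) x)
  · simpa only [fderiv_gaussian_apply] using this
  · simp only [fderiv_gaussian_apply]
    exact ((continuous_gaussDeriv j r).mul hφ.continuous).integrable_of_hasCompactSupport
      hc.mul_left
  · exact ((continuous_gaussian r).mul hcont).integrable_of_hasCompactSupport hc'.mul_left
  · exact ((continuous_gaussian r).mul hφ.continuous).integrable_of_hasCompactSupport hc.mul_left

theorem fourier_gaussian_plane {r : ℝ} (hr : 0 < r) (ξ : Plane) :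
    𝓕 (fun z => (gaussian r z : ℂ)) ξ = ((r⁻¹ * Real.exp (-(Real.pi * ‖ξ‖ ^ 2) / r) : ℝ) : ℂ) := by
  have h := fourier_gaussian_innerProductSpace (V := Plane) (b := ((Real.pi * r : ℝ) : ℂ))
    (by simp; positivity) ξ
  have e : (fun z : Plane => (gaussian r z : ℂ)) =
      fun v => Complex.exp (-((Real.pi * r : ℝ) : ℂ) * ‖v‖ ^ 2) := by
    funext z
    simp [gaussian]
  have hr' : (r : ℂ) ≠ 0 := by exact_mod_cast hr.ne'
  have hp : (Real.pi : ℂ) ≠ 0 := by exact_mod_cast Real.pi_ne_zero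
  rw [e, h]
  simp
  congr 1
  · field_simp
  · congr 1
    field_simp

theorem fourier_gaussDeriv (j : Fin 2) {r : ℝ} (hr : 0 < r) (ξ : Plane) :
    𝓕 (fun z => (gaussDeriv j r z : ℂ)) ξ =
      (2 * Real.pi * ξ j : ℝ) * Complex.I *
        ((r⁻¹ * Real.exp (-(Real.pi * ‖ξ‖ ^ 2) / r) : ℝ) : ℂ) := by
  rw [(hasWeakDeriv_gaussian j r).fourier_eq (integrable_gaussian hr)
    (integrable_gaussDeriv j hr), fourier_gaussian_plane hr]

/-! ### Superposition of Gaussians -/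

theorem integrableOn_rpow_mul_exp_neg_div {b : ℝ} (hb : 0 < b) :
    IntegrableOn (fun r : ℝ => r ^ (-(3 / 2) : ℝ) * Real.exp (-b / r)) (Set.Ioi 0) := by
  have h := (integrableOn_Ioi_comp_rpow_iff (fun w : ℝ => w ^ (-(1 / 2) : ℝ) *
    Real.exp (-b * w ^ (1 : ℝ))) (p := -1) (by norm_num)).2
    (integrableOn_rpow_mul_exp_neg_mul_rpow (by norm_num) one_pos hb)
  refine h.congr_fun (fun r hr => ?_) measurableSet_Ioi
  have hr : 0 < r := hr
  simp only [abs_neg, abs_one, one_mul, smul_eq_mul, Real.rpow_one]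
  rw [← Real.rpow_mul hr.le, ← mul_assoc, ← Real.rpow_add hr, Real.rpow_neg_one]
  norm_num
  left
  ring

/-- The substitution `w = 1/r` turns this into `Γ(1/2)`. With `b = π|ξ|²` the value is `1/|ξ|`, the
singular factor of the Riesz symbol. -/
theorem integral_rpow_mul_exp_neg_div {b : ℝ} (hb : 0 < b) :
    ∫ r in Set.Ioi (0 : ℝ), r ^ (-(3 / 2) : ℝ) * Real.exp (-b / r) = √(Real.pi / b) := by
  have h := integral_comp_rpow_Ioi (fun w : ℝ => w ^ ((1 / 2) - 1 : ℝ) * Real.exp (-(b * w)))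
    (p := -1) (by norm_num)
  rw [Real.integral_rpow_mul_exp_neg_mul_Ioi (by norm_num) hb, Real.Gamma_one_half_eq] at h
  have e : √(Real.pi / b) = (1 / b) ^ (1 / 2 : ℝ) * √Real.pi := by
    rw [← Real.sqrt_eq_rpow, ← Real.sqrt_mul (by positivity)]
    congr 1
    ring
  rw [e, ← h]
  refine setIntegral_congr_fun measurableSet_Ioi fun r hr => ?_
  have hr : 0 < r := hr
  simp only [abs_neg, abs_one, one_mul, smul_eq_mul]
  rw [← Real.rpow_mul hr.le, ← mul_assoc, ← Real.rpow_add hr, Real.rpow_neg_one]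
  norm_num
  left
  ring

/-! ### The Riesz transform as a superposition of Gaussian convolutions -/

/-- Up to a constant the family is stable under the Fourier transform, with `r` replaced by `1/r`;
integrability of the transform comes for free. -/
theorem fourier_gaussDeriv_eq_gaussDeriv_inv (j : Fin 2) {r : ℝ} (hr : 0 < r) (ξ : Plane) :
    𝓕 (fun z => (gaussDeriv j r z : ℂ)) ξ = -(Complex.I * (gaussDeriv j r⁻¹ ξ : ℂ)) := by
  rw [fourier_gaussDeriv j hr, gaussDeriv, gaussian]
  push_cast
  rw [show -((Real.pi : ℂ) * ‖ξ‖ ^ 2) / r = -(Real.pi * (r : ℂ)⁻¹ * ‖ξ‖ ^ 2) by ring]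
  ring

theorem integrable_fourier_gaussDeriv (j : Fin 2) {r : ℝ} (hr : 0 < r) :
    Integrable (𝓕 (fun z => (gaussDeriv j r z : ℂ))) := by
  rw [funext (fourier_gaussDeriv_eq_gaussDeriv_inv j hr)]
  exact ((integrable_gaussDeriv j (inv_pos.2 hr)).ofReal.const_mul _).neg

theorem ofReal_convolution (k f : Plane → ℝ) (x : Plane) :
    (((k ⋆[ContinuousLinearMap.mul ℝ ℝ, volume] f) x : ℝ) : ℂ) =
      ((fun z => (k z : ℂ)) ⋆[ContinuousLinearMap.mul ℂ ℂ, volume] (fun z => (f z : ℂ))) x := by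
  simp only [convolution_def, ContinuousLinearMap.mul_apply', ← Complex.ofReal_mul]
  exact integral_complex_ofReal.symm

theorem integral_mul_gaussDeriv_convolution (j : Fin 2) {r : ℝ} (hr : 0 < r) {f h : Plane → ℝ}
    (hf : Integrable f) (hh : Integrable h) :
    ((∫ x, h x * (gaussDeriv j r ⋆[ContinuousLinearMap.mul ℝ ℝ, volume] f) x : ℝ) : ℂ) =
      ∫ ξ, 𝓕⁻ (fun x => (h x : ℂ)) ξ *
        (𝓕 (fun z => (gaussDeriv j r z : ℂ)) ξ * 𝓕 (fun x => (f x : ℂ)) ξ) := by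
  have hK : Integrable (fun z => (gaussDeriv j r z : ℂ)) := (integrable_gaussDeriv j hr).ofReal
  have hF : Integrable (fun z => (f z : ℂ)) := hf.ofReal
  set G := (fun z => (gaussDeriv j r z : ℂ)) ⋆[ContinuousLinearMap.mul ℂ ℂ, volume]
    (fun z => (f z : ℂ)) with hG
  have e : ∀ ξ, 𝓕 G ξ = 𝓕 (fun z => (gaussDeriv j r z : ℂ)) ξ * 𝓕 (fun x => (f x : ℂ)) ξ :=
    Real.fourier_mul_convolution_eq hK hF
  have hi : Integrable (𝓕 G) := by
    rw [funext e]
    exact (integrable_fourier_gaussDeriv j hr).mul_bdd (c := ∫ x, ‖(f x : ℂ)‖)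
      (continuous_fourier_of_integrable hF).aestronglyMeasurable
      (Eventually.of_forall fun ξ => norm_fourier_le _ ξ)
  have hGi : Integrable G := hK.integrable_convolution (ContinuousLinearMap.mul ℂ ℂ) hF
  have hGc : Continuous G := by
    refine BddAbove.continuous_convolution_left_of_integrable (ContinuousLinearMap.mul ℂ ℂ) ?_
      (Complex.continuous_ofReal.comp (continuous_gaussDeriv j r)) hF
    refine ⟨Real.pi * r + 2, ?_⟩
    rintro _ ⟨z, rfl⟩
    simpa using abs_gaussDeriv_le_const j hr z
  have h1 := integral_fourierInv_mul_eq (f := fun x => (h x : ℂ)) hh.ofReal hi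
  rw [hGc.fourierInv_fourier_eq hGi hi] at h1
  simp only [e] at h1
  rw [h1, ← integral_complex_ofReal]
  congr 1 with x
  rw [Complex.ofReal_mul, ofReal_convolution]

theorem conj_fourier_ofReal (h : Plane → ℝ) (ξ : Plane) :
    (starRingEnd ℂ) (𝓕 (fun x => (h x : ℂ)) ξ) = 𝓕⁻ (fun x => (h x : ℂ)) ξ := by
  rw [Real.fourier_eq', Real.fourierInv_eq', ← integral_conj]
  congr 1 with x
  rw [smul_eq_mul, smul_eq_mul, map_mul, Complex.conj_ofReal, ← Complex.exp_conj]
  simp [Complex.conj_ofNat]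

theorem fourier_rieszL2 (j : Fin 2) (f : Lp ℂ 2 (volume : Measure Plane)) :
    𝓕 (rieszL2 j f) = (memLp_top_rieszSymbol j).toLp (rieszSymbol j) • 𝓕 f := by
  rw [rieszL2]
  exact FourierTransform.fourier_fourierInv_eq _

theorem riesz_apply (j : Fin 2) {f : Plane → ℝ} (hf2 : MemLp (fun x => (f x : ℂ)) 2) (x : Plane) :
    riesz j f x = (rieszL2 j (hf2.toLp _) x).re := by
  rw [riesz, dif_pos hf2]

/-- Parseval in `L²`; as `h` is real, the conjugate of its Fourier transform is its inverse Fourier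
transform. -/
theorem integral_mul_riesz_eq_fourier (j : Fin 2) {f h : Plane → ℝ} (hf : Integrable f)
    (hf2 : MemLp f 2) (hh : Integrable h) (hh2 : MemLp h 2) :
    ∫ x, h x * riesz j f x =
      (∫ ξ, 𝓕⁻ (fun x => (h x : ℂ)) ξ * (rieszSymbol j ξ * 𝓕 (fun x => (f x : ℂ)) ξ)).re := by
  have hF2 : MemLp (fun x => (f x : ℂ)) 2 := hf2.ofReal
  have hH2 : MemLp (fun x => (h x : ℂ)) 2 := hh2.ofReal
  have hF : Integrable (fun x => (f x : ℂ)) := hf.ofReal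
  have hH : Integrable (fun x => (h x : ℂ)) := hh.ofReal
  set R := rieszL2 j (hF2.toLp _) with hR
  have h1 : inner ℂ (hH2.toLp _) R = ∫ x, (h x : ℂ) * R x := by
    rw [L2.inner_def]
    refine integral_congr_ae ?_
    filter_upwards [hH2.coeFn_toLp] with x hx
    rw [hx]
    simp [mul_comm]
  have h2 : inner ℂ (hH2.toLp _) R =
      ∫ ξ, 𝓕⁻ (fun x => (h x : ℂ)) ξ * (rieszSymbol j ξ * 𝓕 (fun x => (f x : ℂ)) ξ) := by
    rw [← Lp.inner_fourier_eq, hR, fourier_rieszL2, L2.inner_def]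
    refine integral_congr_ae ?_
    filter_upwards [fourier_toLp_ae_eq hH hH2, fourier_toLp_ae_eq hF hF2,
      Lp.coeFn_lpSMul (r := 2) ((memLp_top_rieszSymbol j).toLp (rieszSymbol j)) (𝓕 (hF2.toLp _)),
      (memLp_top_rieszSymbol j).coeFn_toLp] with ξ e1 e2 e3 e4
    rw [e1, e3, Pi.smul_apply', e4, e2, ← conj_fourier_ofReal]
    simp [mul_comm]
  have hint : Integrable (fun x => (h x : ℂ) * R x) := hH2.integrable_mul (Lp.memLp R)
  rw [← h2, h1]
  calc ∫ x, h x * riesz j f x = ∫ x, ((h x : ℂ) * R x).re := by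
        congr 1 with x
        rw [riesz_apply j hF2, Complex.re_ofReal_mul]
    _ = _ := integral_re hint

/-- On the Fourier side, `iξ_j/|ξ| = (2π)⁻¹ ∫₀^∞ r^{-1/2} m_r(ξ) dr`, where `m_r = 2πiξ_j r⁻¹
e^{-π|ξ|²/r}` is the transform of `gaussDeriv j r`. Fubini is legitimate because the `r`-integral of
the absolute value is at most `2π|N|`, where `N` is a product of two `L²` functions. The singular
kernel is thus replaced by smooth bounded ones, for which integration by parts is elementary. -/
theorem integral_mul_riesz (j : Fin 2) {f h : Plane → ℝ} (hf : Integrable f)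
    (hf2 : MemLp f 2) (hh : Integrable h) (hh2 : MemLp h 2) :
    IntegrableOn (fun r : ℝ => r ^ (-(1 / 2) : ℝ) *
      ∫ x, h x * (gaussDeriv j r ⋆[ContinuousLinearMap.mul ℝ ℝ, volume] f) x) (Set.Ioi 0) ∧
    ∫ x, h x * riesz j f x = (2 * Real.pi)⁻¹ * ∫ r in Set.Ioi (0 : ℝ), r ^ (-(1 / 2) : ℝ) *
        ∫ x, h x * (gaussDeriv j r ⋆[ContinuousLinearMap.mul ℝ ℝ, volume] f) x := by
  have hF2 : MemLp (fun x => (f x : ℂ)) 2 := hf2.ofReal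
  have hH2 : MemLp (fun x => (h x : ℂ)) 2 := hh2.ofReal
  have hF : Integrable (fun x => (f x : ℂ)) := hf.ofReal
  have hH : Integrable (fun x => (h x : ℂ)) := hh.ofReal
  set N : Plane → ℂ := fun ξ => 𝓕⁻ (fun x => (h x : ℂ)) ξ * 𝓕 (fun x => (f x : ℂ)) ξ with hN
  have hinv2 : MemLp (𝓕⁻ (fun x => (h x : ℂ))) 2 :=
    ⟨(continuous_fourierInv_of_integrable hH).aestronglyMeasurable,
      by rw [eLpNorm_fourierInv_eq hH hH2]; exact hH2.2⟩
  have hNi : Integrable N := hinv2.integrable_mul (memLp_fourier hF hF2)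
  have hNc : Continuous N :=
    (continuous_fourierInv_of_integrable hH).mul (continuous_fourier_of_integrable hF)
  let w : Plane → ℝ → ℝ := fun ξ r => r ^ (-(3 / 2) : ℝ) * Real.exp (-(Real.pi * ‖ξ‖ ^ 2) / r)
  let J : Plane → ℝ → ℂ := fun ξ r => (2 * Real.pi * ξ j : ℝ) * Complex.I * N ξ * (w ξ r : ℂ)
  have hw0 : ∀ ξ : Plane, ∀ r ∈ Set.Ioi (0 : ℝ), 0 ≤ w ξ r := fun ξ r hr =>
    mul_nonneg (Real.rpow_nonneg (le_of_lt hr) _) (Real.exp_pos _).le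
  have hwi : ∀ ξ : Plane, ξ ≠ 0 → IntegrableOn (w ξ) (Set.Ioi 0) := fun ξ hξ =>
    integrableOn_rpow_mul_exp_neg_div (mul_pos Real.pi_pos (pow_pos (norm_pos_iff.2 hξ) 2))
  have hwint : ∀ ξ : Plane, ξ ≠ 0 → ∫ r in Set.Ioi (0 : ℝ), w ξ r = ‖ξ‖⁻¹ := fun ξ hξ => by
    rw [integral_rpow_mul_exp_neg_div (mul_pos Real.pi_pos (pow_pos (norm_pos_iff.2 hξ) 2)),
      ← div_div, div_self Real.pi_ne_zero, one_div, Real.sqrt_inv, Real.sqrt_sq (norm_nonneg _)]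
  have hJ1 : ∀ ξ, IntegrableOn (J ξ) (Set.Ioi 0) := by
    intro ξ
    by_cases hξ : ξ = 0
    · simp [J, hξ]
    · exact (hwi ξ hξ).ofReal.const_mul _
  have hJ2 : ∀ ξ, ∫ r in Set.Ioi (0 : ℝ), J ξ r = 2 * Real.pi *
      (𝓕⁻ (fun x => (h x : ℂ)) ξ * (rieszSymbol j ξ * 𝓕 (fun x => (f x : ℂ)) ξ)) := by
    intro ξ
    by_cases hξ : ξ = 0
    -- At the origin both sides vanish: the factor `ξ_j` kills the left one, and division by zero
    -- makes the symbol 0.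
    · simp [J, hξ, rieszSymbol]
    · simp only [J]
      rw [integral_const_mul, integral_complex_ofReal, hwint ξ hξ, rieszSymbol]
      simp only [N]
      push_cast
      ring
  have hJ3 : ∀ ξ, ∫ r in Set.Ioi (0 : ℝ), ‖J ξ r‖ ≤ 2 * Real.pi * ‖N ξ‖ := by
    intro ξ
    by_cases hξ : ξ = 0
    · simp [J, hξ]; positivity
    · have : ∀ r ∈ Set.Ioi (0 : ℝ), ‖J ξ r‖ = (2 * Real.pi * |ξ j| * ‖N ξ‖) * w ξ r := by
        intro r hr
        simp only [J, norm_mul, Complex.norm_real, Complex.norm_I, mul_one, Real.norm_eq_abs,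
          abs_of_nonneg (hw0 ξ r hr), abs_of_pos Real.pi_pos]
        simp
      rw [setIntegral_congr_fun measurableSet_Ioi this, integral_const_mul, hwint ξ hξ]
      have h0 : |ξ j| * ‖ξ‖⁻¹ ≤ 1 := by
        rw [← div_eq_mul_inv]
        exact div_le_one_of_le₀ (abs_apply_le_norm ξ j) (norm_nonneg _)
      calc 2 * Real.pi * |ξ j| * ‖N ξ‖ * ‖ξ‖⁻¹ = (2 * Real.pi * ‖N ξ‖) * (|ξ j| * ‖ξ‖⁻¹) := by ring
        _ ≤ _ := mul_le_of_le_one_right (by positivity) h0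
  have hJm : Measurable (Function.uncurry J) := by
    simp only [J, w]
    have := hNc.measurable
    unfold Function.uncurry
    fun_prop
  have hJ : Integrable (Function.uncurry J)
      ((volume : Measure Plane).prod (volume.restrict (Set.Ioi (0 : ℝ)))) := by
    rw [integrable_prod_iff hJm.aestronglyMeasurable]
    refine ⟨Eventually.of_forall hJ1, (hNi.norm.const_mul (2 * Real.pi)).mono' ?_
      (Eventually.of_forall fun ξ => ?_)⟩
    · exact hJm.norm.stronglyMeasurable.aestronglyMeasurable.integral_prod_right'
    · rw [Real.norm_of_nonneg (integral_nonneg fun _ => norm_nonneg _)]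
      exact hJ3 ξ
  have hswap := integral_integral_swap hJ
  simp only [hJ2] at hswap
  rw [integral_const_mul] at hswap
  have hr : ∀ r ∈ Set.Ioi (0 : ℝ), ∫ ξ, J ξ r = ((r ^ (-(1 / 2) : ℝ) *
      ∫ x, h x * (gaussDeriv j r ⋆[ContinuousLinearMap.mul ℝ ℝ, volume] f) x : ℝ) : ℂ) := by
    intro r hr
    rw [Complex.ofReal_mul, integral_mul_gaussDeriv_convolution j hr hf hh, ← integral_const_mul]
    congr 1 with ξ
    simp only [J, w, N, fourier_gaussDeriv j hr]
    rw [show (-(3 / 2) : ℝ) = -(1 / 2) + -1 by norm_num, Real.rpow_add hr, Real.rpow_neg_one]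
    push_cast
    ring
  refine ⟨?_, ?_⟩
  · have := (hJ.integral_prod_right).re
    refine IntegrableOn.congr_fun (f := fun r => (∫ ξ, J ξ r).re) this (fun r hr' => ?_)
      measurableSet_Ioi
    simp only [hr r hr', Complex.ofReal_re]
  rw [setIntegral_congr_fun measurableSet_Ioi hr, integral_complex_ofReal] at hswap
  rw [integral_mul_riesz_eq_fourier j hf hf2 hh hh2]
  have hp : (2 * Real.pi : ℂ) ≠ 0 := by simp [Real.pi_ne_zero]
  rw [(eq_inv_mul_iff_mul_eq₀ hp).2 hswap]
  rw [show (2 * Real.pi : ℂ)⁻¹ = (((2 * Real.pi)⁻¹ : ℝ) : ℂ) by push_cast; ring,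
    ← Complex.ofReal_mul, Complex.ofReal_re]

/-! ### The Riesz transform on `L²` -/

theorem memLp_riesz (j : Fin 2) {f : Plane → ℝ} (hf : MemLp f 2) : MemLp (riesz j f) 2 := by
  have hf2 : MemLp (fun x => (f x : ℂ)) 2 := hf.ofReal
  rw [funext (riesz_apply j hf2)]
  exact (Lp.memLp (rieszL2 j (hf2.toLp _))).re

theorem norm_toLp_rieszSymbol_le (j : Fin 2) :
    ‖(memLp_top_rieszSymbol j).toLp (rieszSymbol j)‖ ≤ 1 := by
  rw [Lp.norm_toLp]
  refine ENNReal.toReal_le_of_le_ofReal zero_le_one ?_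
  rw [eLpNorm_exponent_top]
  refine eLpNormEssSup_le_of_ae_bound (Eventually.of_forall fun ξ => ?_)
  simp only [rieszSymbol, norm_mul, Complex.norm_I, one_mul, Complex.norm_real, Real.norm_eq_abs,
    abs_div, abs_norm]
  exact div_le_one_of_le₀ (abs_apply_le_norm ξ j) (norm_nonneg ξ)

theorem norm_rieszL2_le (j : Fin 2) (f : Lp ℂ 2 (volume : Measure Plane)) :
    ‖rieszL2 j f‖ ≤ ‖f‖ := by
  rw [← Lp.norm_fourier_eq, fourier_rieszL2]
  refine (Lp.norm_smul_le _ _).trans ?_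
  rw [Lp.norm_fourier_eq]
  exact mul_le_of_le_one_left (norm_nonneg _) (norm_toLp_rieszSymbol_le j)

theorem eLpNorm_le_of_norm_le {f g : Lp ℂ 2 (volume : Measure Plane)} (h : ‖f‖ ≤ ‖g‖) :
    eLpNorm f 2 ≤ eLpNorm g 2 := by
  rw [Lp.norm_def, Lp.norm_def] at h
  exact (ENNReal.toReal_le_toReal (Lp.eLpNorm_ne_top f) (Lp.eLpNorm_ne_top g)).1 h

theorem eLpNorm_riesz_le (j : Fin 2) {f : Plane → ℝ} (hf : MemLp f 2) :
    eLpNorm (riesz j f) 2 ≤ eLpNorm f 2 := by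
  have hf2 : MemLp (fun x => (f x : ℂ)) 2 := hf.ofReal
  have h0 : ‖rieszL2 j (hf2.toLp _)‖ ≤ ‖hf2.toLp _‖ := norm_rieszL2_le j _
  have h1 : riesz j f = fun x => (rieszL2 j (hf2.toLp _) x).re := funext (riesz_apply j hf2)
  have h3 : eLpNorm (hf2.toLp _) 2 = eLpNorm f 2 :=
    (eLpNorm_congr_ae hf2.coeFn_toLp).trans
      (eLpNorm_congr_norm_ae (Eventually.of_forall fun x => Complex.norm_real _))
  generalize rieszL2 j (hf2.toLp _) = R at h0 h1
  rw [h1, ← h3]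
  exact (eLpNorm_mono fun x => Complex.abs_re_le_norm _).trans (eLpNorm_le_of_norm_le h0)

theorem rieszL2_sub (j : Fin 2) (f g : Lp ℂ 2 (volume : Measure Plane)) :
    rieszL2 j (f - g) = rieszL2 j f - rieszL2 j g := by
  apply (Lp.fourierTransformₗᵢ Plane ℂ).injective
  rw [map_sub]
  change 𝓕 (rieszL2 j (f - g)) = 𝓕 (rieszL2 j f) - 𝓕 (rieszL2 j g)
  have h : 𝓕 (f - g) = 𝓕 f - 𝓕 g := (Lp.fourierTransformₗᵢ Plane ℂ).map_sub f g
  rw [fourier_rieszL2, fourier_rieszL2, fourier_rieszL2, h, sub_eq_add_neg, sub_eq_add_neg,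
    Lp.add_smul, Lp.smul_neg]

theorem riesz_sub_ae_eq (j : Fin 2) {f g : Plane → ℝ} (hf : MemLp f 2) (hg : MemLp g 2) :
    riesz j (f - g) =ᵐ[volume] riesz j f - riesz j g := by
  have hf2 : MemLp (fun x => (f x : ℂ)) 2 := hf.ofReal
  have hg2 : MemLp (fun x => (g x : ℂ)) 2 := hg.ofReal
  have hfg2 : MemLp (fun x => ((f - g) x : ℂ)) 2 := (hf.sub hg).ofReal
  have e : hfg2.toLp _ = hf2.toLp _ - hg2.toLp _ := by
    rw [← MemLp.toLp_sub]
    congr 1 with x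
    simp
  have h := Lp.coeFn_sub (rieszL2 j (hf2.toLp _)) (rieszL2 j (hg2.toLp _))
  filter_upwards [h] with x hx
  rw [Pi.sub_apply, riesz_apply j hf2, riesz_apply j hg2, riesz_apply j hfg2, e, rieszL2_sub, hx]
  simp

/-- The Riesz transform is bounded by the `L¹` norm of the Fourier transform. -/
theorem ae_abs_riesz_le (j : Fin 2) {f : Plane → ℝ} (hf : Integrable f) (hf2 : MemLp f 2)
    (hF : Integrable (𝓕 (fun x => (f x : ℂ)))) :
    ∀ᵐ x, |riesz j f x| ≤ ∫ ξ, ‖𝓕 (fun x => (f x : ℂ)) ξ‖ := by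
  have hF2 : MemLp (fun x => (f x : ℂ)) 2 := hf2.ofReal
  have hF1 : Integrable (fun x => (f x : ℂ)) := hf.ofReal
  set m : Plane → ℂ := fun ξ => rieszSymbol j ξ * 𝓕 (fun x => (f x : ℂ)) ξ with hm
  have hs : ∀ ξ, ‖rieszSymbol j ξ‖ ≤ 1 := fun ξ => by
    simp only [rieszSymbol, norm_mul, Complex.norm_I, one_mul, Complex.norm_real,
      Real.norm_eq_abs, abs_div, abs_norm]
    exact div_le_one_of_le₀ (abs_apply_le_norm ξ j) (norm_nonneg ξ)
  have hm1 : Integrable m := hF.bdd_mul (c := 1) (memLp_top_rieszSymbol j).1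
    (Eventually.of_forall hs)
  have hle : ∀ ξ, ‖m ξ‖ ≤ ‖𝓕 (fun x => (f x : ℂ)) ξ‖ := fun ξ => by
    rw [hm, norm_mul]
    exact mul_le_of_le_one_left (norm_nonneg _) (hs ξ)
  have hm2 : MemLp m 2 := (memLp_fourier hF1 hF2).mono hm1.1 (Eventually.of_forall hle)
  have e : rieszL2 j (hF2.toLp _) = 𝓕⁻ (hm2.toLp m) := by
    rw [← FourierTransform.fourierInv_fourier_eq (F := Lp ℂ 2 (volume : Measure Plane))
      (rieszL2 j (hF2.toLp _)), fourier_rieszL2]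
    congr 1
    apply Lp.ext
    filter_upwards [hm2.coeFn_toLp, fourier_toLp_ae_eq hF1 hF2,
      Lp.coeFn_lpSMul (r := 2) ((memLp_top_rieszSymbol j).toLp (rieszSymbol j)) (𝓕 (hF2.toLp _)),
      (memLp_top_rieszSymbol j).coeFn_toLp] with ξ e1 e2 e3 e4
    rw [e1, e3, Pi.smul_apply', e4, e2, smul_eq_mul]
  filter_upwards [fourierInv_toLp_ae_eq hm1 hm2] with x hx
  rw [riesz_apply j hF2, e]
  refine (Complex.abs_re_le_norm _).trans ?_
  rw [hx]
  exact (norm_fourierInv_le m x).trans (integral_mono hm1.norm hF.norm hle)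

/-! ### Testing the advection term against a smooth function -/

/-- The integrability of a function and of its weak derivatives which the pairing estimates need. -/
structure IsRegular (f : Plane → ℝ) : Prop where
  integrable : Integrable f
  memLp_two : MemLp f 2
  memLp_top : MemLp f ∞
  hasWeakDeriv : ∀ i, HasWeakDeriv i f (weakDeriv i f)
  deriv_integrable : ∀ i, Integrable (weakDeriv i f)
  deriv_memLp_two : ∀ i, MemLp (weakDeriv i f) 2

theorem integrable_prod_mul_bdd {f g : Plane → ℝ} (hf : Integrable f) (hg : Integrable g)
    {k : Plane × Plane → ℝ} (hk : Continuous k) {A : ℝ} (hA : ∀ p, |k p| ≤ A) :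
    Integrable (fun p : Plane × Plane => f p.1 * g p.2 * k p)
      ((volume : Measure Plane).prod volume) :=
  (hf.mul_prod hg).mul_bdd (c := A) hk.aestronglyMeasurable (Eventually.of_forall hA)

/-- For fixed `y`, the function `x ↦ φ(x) K(x-y)` is an admissible test function, so the weak
derivative moves off `f`. Of the two Leibniz terms, the one that differentiates the kernel cancels
once the two components of the advection are combined. -/
theorem integral_mul_gaussDeriv_convolution_eq (i j : Fin 2) {r : ℝ} (hr : 0 < r) {f g : Plane → ℝ}
    (hfg : HasWeakDeriv i f g) (hf : Integrable f) (hg : Integrable g) {φ : Plane → ℝ}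
    (hφ : ContDiff ℝ ∞ φ) {A B : ℝ} (hA : ∀ x, |φ x| ≤ A)
    (hB : ∀ x, |fderiv ℝ φ x (basisVec i)| ≤ B) :
    ∫ x, φ x * g x * (gaussDeriv j r ⋆[ContinuousLinearMap.mul ℝ ℝ, volume] f) x =
      - ∫ p : Plane × Plane, f p.1 * f p.2 * (fderiv ℝ φ p.1 (basisVec i) *
        gaussDeriv j r (p.1 - p.2) + φ p.1 * fderiv ℝ (gaussDeriv j r) (p.1 - p.2) (basisVec i)) := by
  have hk := continuous_gaussDeriv j r
  have hdk : Continuous fun x => fderiv ℝ (gaussDeriv j r) x (basisVec i) :=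
    ((contDiff_gaussDeriv j r).continuous_fderiv (by simp)).clm_apply continuous_const
  have hdφ : Continuous fun x => fderiv ℝ φ x (basisVec i) :=
    (hφ.continuous_fderiv (by simp)).clm_apply continuous_const
  have hA0 : 0 ≤ A := (abs_nonneg _).trans (hA 0)
  have hB0 : 0 ≤ B := (abs_nonneg _).trans (hB 0)
  have e1 : ∫ x, φ x * g x * (gaussDeriv j r ⋆[ContinuousLinearMap.mul ℝ ℝ, volume] f) x =
      ∫ x, ∫ y, g x * f y * (φ x * gaussDeriv j r (x - y)) := by
    congr 1 with x
    rw [convolution_eq_swap, ← integral_const_mul]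
    congr 1 with y
    simp only [ContinuousLinearMap.mul_apply']
    ring
  have b1 : ∀ x y : Plane, |φ x * gaussDeriv j r (x - y)| ≤ A * (Real.pi * r + 2) := fun x y => by
    rw [abs_mul]
    exact mul_le_mul (hA x) (abs_gaussDeriv_le_const j hr _) (abs_nonneg _) hA0
  have b2 : ∀ x y : Plane, |fderiv ℝ φ x (basisVec i) * gaussDeriv j r (x - y) +
      φ x * fderiv ℝ (gaussDeriv j r) (x - y) (basisVec i)| ≤
      B * (Real.pi * r + 2) + A * (6 * (Real.pi * r)) := fun x y => by
    refine (abs_add_le _ _).trans (add_le_add ?_ ?_)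
    · rw [abs_mul]
      exact mul_le_mul (hB x) (abs_gaussDeriv_le_const j hr _) (abs_nonneg _) hB0
    · rw [abs_mul]
      exact mul_le_mul (hA x) (abs_fderiv_gaussDeriv_le i j hr _) (abs_nonneg _) hA0
  have i1 := integrable_prod_mul_bdd hg hf (k := fun p => φ p.1 * gaussDeriv j r (p.1 - p.2))
    ((hφ.continuous.comp continuous_fst).mul (hk.comp (by fun_prop))) (fun p => b1 p.1 p.2)
  have i2 := integrable_prod_mul_bdd hf hf (k := fun p => fderiv ℝ φ p.1 (basisVec i) *
        gaussDeriv j r (p.1 - p.2) + φ p.1 * fderiv ℝ (gaussDeriv j r) (p.1 - p.2) (basisVec i))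
    (((hdφ.comp continuous_fst).mul (hk.comp (by fun_prop))).add
      ((hφ.continuous.comp continuous_fst).mul
        (hdk.comp (continuous_fst.sub continuous_snd)))) (fun p => b2 p.1 p.2)
  rw [e1, integral_integral_swap i1, Measure.volume_eq_prod, integral_prod_symm _ i2,
    ← integral_neg]
  congr 1 with y
  have hψd : ∀ x, fderiv ℝ (fun x => φ x * gaussDeriv j r (x - y)) x (basisVec i) =
      fderiv ℝ φ x (basisVec i) * gaussDeriv j r (x - y) +
        φ x * fderiv ℝ (gaussDeriv j r) (x - y) (basisVec i) := fun x => by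
    have h1 : HasFDerivAt (fun x => gaussDeriv j r (x - y)) (fderiv ℝ (gaussDeriv j r) (x - y)) x := by
      have := ((contDiff_gaussDeriv j r).differentiable (by simp) (x - y)).hasFDerivAt.comp x
        ((hasFDerivAt_id x).sub_const y)
      rwa [ContinuousLinearMap.comp_id] at this
    have h2 : HasFDerivAt (fun x => φ x * gaussDeriv j r (x - y)) _ x :=
      (hφ.differentiable (by simp) x).hasFDerivAt.mul h1
    rw [h2.fderiv]
    simp
    ring
  have h := hfg.integral_mul_fderiv_eq hf hg (ψ := fun x => φ x * gaussDeriv j r (x - y))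
    (hφ.mul ((contDiff_gaussDeriv j r).comp (contDiff_id.sub contDiff_const)))
    (fun x => b1 x y) (fun x => by rw [hψd]; exact b2 x y)
  simp only [hψd] at h
  calc ∫ x, g x * f y * (φ x * gaussDeriv j r (x - y))
      = f y * ∫ x, g x * (φ x * gaussDeriv j r (x - y)) := by
        rw [← integral_const_mul]
        congr 1 with x
        ring
    _ = f y * -∫ x, f x * (fderiv ℝ φ x (basisVec i) * gaussDeriv j r (x - y) +
        φ x * fderiv ℝ (gaussDeriv j r) (x - y) (basisVec i)) := by rw [h, neg_neg]
    _ = _ := by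
        rw [mul_neg, ← integral_const_mul]
        congr 2 with x
        ring

/-- Averaging the integral with its image under `(x,y) ↦ (y,x)` and using that the kernel is odd
turns `∂φ(x)` into a difference `∂φ(x) - ∂φ(y)`; the factor 1/2 is dropped. The bound on the kernel
keeps its exact dependence on `r`, for the later integration over scales. -/
theorem norm_integral_antisymm_le (i j : Fin 2) {r : ℝ} (hr : 0 < r) {f : Plane → ℝ}
    (hf : Integrable f) {φ : Plane → ℝ} (hφ : ContDiff ℝ ∞ φ) {B : ℝ}
    (hB : ∀ k x, |fderiv ℝ φ x (basisVec k)| ≤ B) :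
    ‖∫ p : Plane × Plane, f p.1 * f p.2 * (fderiv ℝ φ p.1 (basisVec i) *
        gaussDeriv j r (p.1 - p.2) - fderiv ℝ φ p.1 (basisVec j) *
        gaussDeriv i r (p.1 - p.2))‖ₑ ≤
      ∫⁻ p : Plane × Plane, ‖f p.1‖ₑ * ‖f p.2‖ₑ *
        (‖fderiv ℝ φ p.1 (basisVec i) - fderiv ℝ φ p.2 (basisVec i)‖ₑ +
          ‖fderiv ℝ φ p.1 (basisVec j) - fderiv ℝ φ p.2 (basisVec j)‖ₑ) *
        ENNReal.ofReal (2 * (Real.pi * r) * ‖p.1 - p.2‖ * gaussian r (p.1 - p.2)) := by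
  have hdφ : ∀ k, Continuous fun x => fderiv ℝ φ x (basisVec k) := fun k =>
    (hφ.continuous_fderiv (by simp)).clm_apply continuous_const
  have hB0 : 0 ≤ B := (abs_nonneg _).trans (hB 0 0)
  let G : Plane × Plane → ℝ := fun p => fderiv ℝ φ p.1 (basisVec i) *
        gaussDeriv j r (p.1 - p.2) - fderiv ℝ φ p.1 (basisVec j) * gaussDeriv i r (p.1 - p.2)
  have hGc : Continuous G :=
    (((hdφ i).comp continuous_fst).mul
      ((continuous_gaussDeriv j r).comp (continuous_fst.sub continuous_snd))).sub
    (((hdφ j).comp continuous_fst).mul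
      ((continuous_gaussDeriv i r).comp (continuous_fst.sub continuous_snd)))
  have hGb : ∀ p, |G p| ≤ B * (Real.pi * r + 2) + B * (Real.pi * r + 2) := fun p => by
    refine (abs_sub _ _).trans (add_le_add ?_ ?_)
    · rw [abs_mul]
      exact mul_le_mul (hB _ _) (abs_gaussDeriv_le_const _ hr _) (abs_nonneg _) hB0
    · rw [abs_mul]
      exact mul_le_mul (hB _ _) (abs_gaussDeriv_le_const _ hr _) (abs_nonneg _) hB0
  have i1 := integrable_prod_mul_bdd hf hf hGc hGb
  have i2 : Integrable (fun p : Plane × Plane => f p.1 * f p.2 * G p.swap)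
      ((volume : Measure Plane).prod volume) :=
    integrable_prod_mul_bdd hf hf (hGc.comp continuous_swap) (fun p => hGb p.swap)
  have e1 : ∫ p : Plane × Plane, f p.1 * f p.2 * G p ∂((volume : Measure Plane).prod volume) =
      ∫ p : Plane × Plane, f p.1 * f p.2 * G p.swap ∂((volume : Measure Plane).prod volume) := by
    rw [← integral_prod_swap]
    congr 1 with p
    simp [mul_comm]
  have e2 : ∫ p : Plane × Plane, f p.1 * f p.2 * G p ∂((volume : Measure Plane).prod volume) =
      2⁻¹ * ∫ p : Plane × Plane, f p.1 * f p.2 * (G p + G p.swap)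
        ∂((volume : Measure Plane).prod volume) := by
    simp only [mul_add]
    rw [integral_add i1 i2, ← e1]
    ring
  change ‖∫ p : Plane × Plane, f p.1 * f p.2 * G p‖ₑ ≤ _
  rw [Measure.volume_eq_prod, e2, enorm_mul]
  have h2 : ‖(2⁻¹ : ℝ)‖ₑ ≤ 1 := by
    rw [Real.enorm_eq_ofReal (by norm_num)]
    exact ENNReal.ofReal_le_one.2 (by norm_num)
  refine (mul_le_of_le_one_left zero_le h2).trans ((enorm_integral_le_lintegral_enorm _).trans
    (lintegral_mono fun p => ?_))
  obtain ⟨x, y⟩ := p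
  rw [enorm_mul, enorm_mul, mul_assoc (_ * _)]
  gcongr
  have hk : ∀ k, ‖gaussDeriv k r (x - y)‖ₑ ≤
      ENNReal.ofReal (2 * (Real.pi * r) * ‖x - y‖ * gaussian r (x - y)) := fun k => by
    rw [← ofReal_norm, Real.norm_eq_abs, abs_gaussDeriv k hr]
    refine ENNReal.ofReal_le_ofReal (mul_le_mul_of_nonneg_right ?_ (gaussian_pos _ _).le)
    exact mul_le_mul_of_nonneg_left (abs_apply_le_norm _ _) (by positivity)
  have e3 : G (x, y) + G (y, x) =
      (fderiv ℝ φ x (basisVec i) - fderiv ℝ φ y (basisVec i)) * gaussDeriv j r (x - y) -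
      (fderiv ℝ φ x (basisVec j) - fderiv ℝ φ y (basisVec j)) * gaussDeriv i r (x - y) := by
    simp only [G]
    rw [← neg_sub x y, gaussDeriv_neg, gaussDeriv_neg]
    ring
  simp only [Prod.swap_prod_mk]
  rw [e3, add_mul]
  refine enorm_sub_le.trans (add_le_add ?_ ?_)
  · rw [enorm_mul]
    gcongr
    exact hk j
  · rw [enorm_mul]
    gcongr
    exact hk i

/-- Adding up the kernel bounds over all scales gives back the size of the Riesz kernel in the
plane; the integral is `Γ(3/2)`. At `z = 0` both sides are 0, since `0 ^ (-2 : ℝ)` is 0 by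
convention. -/
theorem lintegral_rpow_mul_gaussian (z : Plane) :
    ∫⁻ r in Set.Ioi (0 : ℝ), ENNReal.ofReal (r ^ (-(1 / 2) : ℝ)) *
      ENNReal.ofReal (2 * (Real.pi * r) * ‖z‖ * gaussian r z) = ENNReal.ofReal (‖z‖ ^ (-2 : ℝ)) := by
  by_cases hz : z = 0
  · simp [hz]
  have hz : 0 < ‖z‖ := norm_pos_iff.2 hz
  set b := Real.pi * ‖z‖ ^ 2 with hb
  have hb0 : 0 < b := by positivity
  have e : ∀ r ∈ Set.Ioi (0 : ℝ), ENNReal.ofReal (r ^ (-(1 / 2) : ℝ)) *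
      ENNReal.ofReal (2 * (Real.pi * r) * ‖z‖ * gaussian r z) =
      ENNReal.ofReal (2 * Real.pi * ‖z‖ * (r ^ ((3 / 2) - 1 : ℝ) * Real.exp (-(b * r)))) := by
    intro r hr
    have hr : 0 < r := hr
    rw [← ENNReal.ofReal_mul (by positivity)]
    congr 1
    rw [gaussian, show (3 / 2 - 1 : ℝ) = -(1 / 2) + 1 by norm_num, Real.rpow_add_one hr.ne', hb]
    ring_nf
  have hint : IntegrableOn (fun r : ℝ => r ^ ((3 / 2) - 1 : ℝ) * Real.exp (-(b * r)))
      (Set.Ioi 0) := by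
    have := integrableOn_rpow_mul_exp_neg_mul_rpow (s := (3 / 2) - 1) (p := 1) (by norm_num)
      one_pos hb0
    simpa using this
  rw [setLIntegral_congr_fun measurableSet_Ioi e, ← ofReal_integral_eq_lintegral_ofReal
    (hint.const_mul _), integral_const_mul, Real.integral_rpow_mul_exp_neg_mul_Ioi (by norm_num) hb0]
  · congr 1
    have hG : Real.Gamma (3 / 2) = √Real.pi / 2 := by
      rw [show (3 / 2 : ℝ) = 1 / 2 + 1 by norm_num, Real.Gamma_add_one (by norm_num),
        Real.Gamma_one_half_eq]
      ring
    have h1 : (1 / b) ^ (3 / 2 : ℝ) = 1 / (b * (√Real.pi * ‖z‖)) := by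
      rw [Real.div_rpow zero_le_one hb0.le, Real.one_rpow, show (3 / 2 : ℝ) = 1 + 1 / 2 by norm_num,
        Real.rpow_add hb0, Real.rpow_one, ← Real.sqrt_eq_rpow, hb,
        Real.sqrt_mul Real.pi_pos.le, Real.sqrt_sq hz.le]
    rw [hG, h1, Real.rpow_neg hz.le, Real.rpow_two, hb]
    have : √Real.pi ≠ 0 := by positivity
    field_simp
  · refine (ae_restrict_iff' measurableSet_Ioi).2 (Eventually.of_forall fun r hr => ?_)
    have hr : 0 < r := hr
    positivity

/-- The advection term tested against a smooth function, after antisymmetrisation of the kernel of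
the Riesz transforms. -/
theorem IsRegular.enorm_integral_mul_advection_le {f : Plane → ℝ} (hf : IsRegular f)
    {φ : Plane → ℝ} (hφ : ContDiff ℝ ∞ φ) {A B : ℝ} (hA : ∀ x, |φ x| ≤ A)
    (hB : ∀ k x, |fderiv ℝ φ x (basisVec k)| ≤ B) :
    ‖∫ x, φ x * advection f x‖ₑ ≤
      ∫⁻ p : Plane × Plane, ‖f p.1‖ₑ * ‖f p.2‖ₑ *
        (‖fderiv ℝ φ p.1 (basisVec 0) - fderiv ℝ φ p.2 (basisVec 0)‖ₑ +
          ‖fderiv ℝ φ p.1 (basisVec 1) - fderiv ℝ φ p.2 (basisVec 1)‖ₑ) *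
        ENNReal.ofReal (‖p.1 - p.2‖ ^ (-2 : ℝ)) := by
  set g := fun i => weakDeriv i f with hg
  have hA' : ∀ᵐ x, ‖φ x‖ ≤ A := Eventually.of_forall hA
  have hh1 : ∀ i, Integrable (fun x => φ x * g i x) := fun i =>
    (hf.deriv_integrable i).bdd_mul hφ.continuous.aestronglyMeasurable hA'
  have hφt : MemLp φ ∞ := memLp_top_of_bound hφ.continuous.aestronglyMeasurable A hA'
  have hh2 : ∀ i, MemLp (fun x => φ x * g i x) 2 := fun i =>
    (hf.deriv_memLp_two i).mul hφt
  have hmul : ∀ i j, Integrable (fun x => φ x * g i x * riesz j f x) := fun i j =>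
    (hh2 i).integrable_mul (memLp_riesz j hf.memLp_two)
  have hR := fun i j => integral_mul_riesz j hf.integrable hf.memLp_two (hh1 i) (hh2 i)
  let c : Fin 2 → Fin 2 → ℝ → ℝ := fun i j r =>
    ∫ x, φ x * g i x * (gaussDeriv j r ⋆[ContinuousLinearMap.mul ℝ ℝ, volume] f) x
  have e1 : ∫ x, φ x * advection f x = (2 * Real.pi)⁻¹ *
      ∫ r in Set.Ioi (0 : ℝ), r ^ (-(1 / 2) : ℝ) * (c 1 0 r - c 0 1 r) := by
    have : ∀ x, φ x * advection f x = φ x * g 1 x * riesz 0 f x - φ x * g 0 x * riesz 1 f x :=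
      fun x => by simp only [advection, hg]; ring
    simp only [this, mul_sub]
    rw [integral_sub (hmul 1 0) (hmul 0 1), (hR 1 0).2, (hR 0 1).2,
      integral_sub (hR 1 0).1 (hR 0 1).1]
    ring
  have hdφ : ∀ k, Continuous fun x => fderiv ℝ φ x (basisVec k) := fun k =>
    (hφ.continuous_fderiv (by simp)).clm_apply continuous_const
  let S : Plane × Plane → ℝ≥0∞ := fun p => ‖f p.1‖ₑ * ‖f p.2‖ₑ *
        (‖fderiv ℝ φ p.1 (basisVec 0) - fderiv ℝ φ p.2 (basisVec 0)‖ₑ +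
          ‖fderiv ℝ φ p.1 (basisVec 1) - fderiv ℝ φ p.2 (basisVec 1)‖ₑ)
  have hS : AEMeasurable S := by
    have h1 : AEMeasurable (fun p : Plane × Plane => ‖f p.1‖ₑ) (volume.prod volume) :=
      hf.integrable.1.comp_fst.enorm
    have h2 : AEMeasurable (fun p : Plane × Plane => ‖f p.2‖ₑ) (volume.prod volume) :=
      hf.integrable.1.comp_snd.enorm
    refine (h1.mul h2).mul (Continuous.aemeasurable ?_)
    have h3 := fun k => (hdφ k).comp (continuous_fst (X := Plane) (Y := Plane))
    have h4 := fun k => (hdφ k).comp (continuous_snd (X := Plane) (Y := Plane))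
    exact ((h3 0).sub (h4 0)).enorm.add ((h3 1).sub (h4 1)).enorm
  have e2 : ∀ r ∈ Set.Ioi (0 : ℝ), ‖r ^ (-(1 / 2) : ℝ) * (c 1 0 r - c 0 1 r)‖ₑ ≤
      ∫⁻ p, S p * (ENNReal.ofReal (r ^ (-(1 / 2) : ℝ)) *
        ENNReal.ofReal (2 * (Real.pi * r) * ‖p.1 - p.2‖ * gaussian r (p.1 - p.2))) := by
    intro r hr
    have hr : 0 < r := hr
    -- The two terms with `φ` times a derivative of the kernel cancel here by
    -- `fderiv_gaussDeriv_symm`; only derivatives of `φ` survive.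
    have hc : c 1 0 r - c 0 1 r = ∫ p : Plane × Plane, f p.1 * f p.2 * (fderiv ℝ φ p.1 (basisVec 0) *
        gaussDeriv 1 r (p.1 - p.2) - fderiv ℝ φ p.1 (basisVec 1) *
        gaussDeriv 0 r (p.1 - p.2)) := by
      simp only [c]
      rw [integral_mul_gaussDeriv_convolution_eq 1 0 hr (hf.hasWeakDeriv 1) hf.integrable
        (hf.deriv_integrable 1) hφ hA (hB 1), integral_mul_gaussDeriv_convolution_eq 0 1 hr
        (hf.hasWeakDeriv 0) hf.integrable (hf.deriv_integrable 0) hφ hA (hB 0),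
        neg_sub_neg, ← integral_sub]
      · congr 1 with p
        rw [fderiv_gaussDeriv_symm 1 0]
        ring
      all_goals
        refine integrable_prod_mul_bdd hf.integrable hf.integrable
          (A := B * (Real.pi * r + 2) + A * (6 * (Real.pi * r))) ?_ ?_
        · refine Continuous.add (((hdφ _).comp continuous_fst).mul
            ((continuous_gaussDeriv _ r).comp (continuous_fst.sub continuous_snd)))
            ((hφ.continuous.comp continuous_fst).mul ?_)
          exact (((contDiff_gaussDeriv _ r).continuous_fderiv (by simp)).clm_apply
            continuous_const).comp (continuous_fst.sub continuous_snd)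
        · intro p
          refine (abs_add_le _ _).trans (add_le_add ?_ ?_)
          · rw [abs_mul]
            exact mul_le_mul (hB _ _) (abs_gaussDeriv_le_const _ hr _) (abs_nonneg _)
              ((abs_nonneg _).trans (hB 0 0))
          · rw [abs_mul]
            exact mul_le_mul (hA _) (abs_fderiv_gaussDeriv_le _ _ hr _) (abs_nonneg _)
              ((abs_nonneg _).trans (hA 0))
    rw [hc, enorm_mul, Real.enorm_eq_ofReal (by positivity)]
    refine (mul_le_mul_right (norm_integral_antisymm_le 0 1 hr hf.integrable hφ hB) _).trans_eq ?_
    rw [← lintegral_const_mul' _ _ ENNReal.ofReal_ne_top]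
    congr 1 with p
    simp only [S]
    ring
  have hpi : ‖(2 * Real.pi)⁻¹‖ₑ ≤ 1 := by
    rw [Real.enorm_eq_ofReal (by positivity)]
    refine ENNReal.ofReal_le_one.2 (inv_le_one_of_one_le₀ ?_)
    linarith [Real.pi_gt_three]
  rw [e1, enorm_mul]
  refine (mul_le_of_le_one_left zero_le hpi).trans ((enorm_integral_le_lintegral_enorm _).trans ?_)
  refine (setLIntegral_mono' measurableSet_Ioi e2).trans ?_
  rw [lintegral_lintegral_swap]
  · refine lintegral_mono fun p => ?_
    rw [lintegral_const_mul _ (by unfold gaussian; fun_prop), lintegral_rpow_mul_gaussian]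
  · refine (hS.comp_snd).mul (Measurable.aemeasurable ?_)
    unfold gaussian
    fun_prop

/-! ### Potentials of the kernels `|z|^{ε-2}` -/

/-- The integral of `|z|^{ε-2}` over the unit disc. -/
def discIntegral (ε : ℝ) : ℝ := 2 * ((volume : Measure Plane).real (Metric.ball 0 1) * ε⁻¹)

theorem discIntegral_nonneg {ε : ℝ} (hε : 0 < ε) : 0 ≤ discIntegral ε := by
  unfold discIntegral; positivity

theorem lintegral_norm_rpow_lt {ε ρ : ℝ} (hε : 0 < ε) (hρ : 0 < ρ) :
    ∫⁻ z : Plane in {z | ‖z‖ < ρ}, ENNReal.ofReal (‖z‖ ^ (ε - 2)) =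
      ENNReal.ofReal (discIntegral ε * ρ ^ ε) := by
  let u : ℝ → ℝ := (Set.Iio ρ).indicator fun y => y ^ (ε - 2)
  have hu0 : ∀ z : Plane, 0 ≤ u ‖z‖ := fun z => by
    simp only [u, Set.indicator]
    split_ifs <;> positivity
  have hcongr : ∀ y ∈ Set.Ioi (0 : ℝ), y ^ (Module.finrank ℝ Plane - 1) • u y =
      (Set.Iio ρ).indicator (fun y => y ^ (ε - 1)) y := fun y hy => by
    have hy : 0 < y := hy
    simp only [u, Set.indicator]
    split_ifs
    · simp only [finrank_euclideanSpace, Fintype.card_fin]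
      rw [show (ε - 1) = 1 + (ε - 2) by ring, Real.rpow_add hy]
      simp
    · simp
  have hi0 : IntegrableOn (fun y : ℝ => y ^ (ε - 1)) (Set.Ioo 0 ρ) := by
    have := (intervalIntegral.intervalIntegrable_rpow' (a := 0) (b := ρ) (r := ε - 1) (by linarith))
    rw [intervalIntegrable_iff_integrableOn_Ioo_of_le hρ.le] at this
    exact this
  have hset : Set.Iio ρ ∩ Set.Ioi (0 : ℝ) = Set.Ioo 0 ρ := by
    ext y; simp [and_comm]
  have hi : Integrable (fun z : Plane => u ‖z‖) := by
    rw [integrable_fun_norm_addHaar, integrableOn_congr_fun hcongr measurableSet_Ioi, IntegrableOn,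
      integrable_indicator_iff measurableSet_Iio, IntegrableOn,
      Measure.restrict_restrict measurableSet_Iio, hset]
    exact hi0
  have hv : ∫ z : Plane, u ‖z‖ = discIntegral ε * ρ ^ ε := by
    rw [integral_fun_norm_addHaar, setIntegral_congr_fun measurableSet_Ioi hcongr,
      integral_indicator measurableSet_Iio, Measure.restrict_restrict measurableSet_Iio, hset,
      ← integral_Ioc_eq_integral_Ioo, ← intervalIntegral.integral_of_le hρ.le,
      integral_rpow (Or.inl (by linarith))]
    simp only [finrank_euclideanSpace, Fintype.card_fin, discIntegral]
    rw [Real.zero_rpow (by linarith)]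
    simp
    ring
  rw [← hv, ofReal_integral_eq_lintegral_ofReal hi (Eventually.of_forall hu0),
    ← lintegral_indicator (measurableSet_lt measurable_norm measurable_const)]
  refine lintegral_congr fun z => ?_
  simp only [u, Set.indicator]
  by_cases h : ‖z‖ < ρ <;> simp [h]

theorem measurableSet_norm_lt (ρ : ℝ) : MeasurableSet {z : Plane | ‖z‖ < ρ} :=
  measurableSet_lt measurable_norm measurable_const

theorem ofReal_norm_rpow_le {ε ρ : ℝ} (hε : ε ≤ 2) (hρ : 0 < ρ) (z : Plane) :
    ENNReal.ofReal (‖z‖ ^ (ε - 2)) ≤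
      {z : Plane | ‖z‖ < ρ}.indicator (fun z => ENNReal.ofReal (‖z‖ ^ (ε - 2))) z +
        ENNReal.ofReal (ρ ^ (ε - 2)) := by
  by_cases h : ‖z‖ < ρ
  · rw [Set.indicator_of_mem (show z ∈ {z : Plane | ‖z‖ < ρ} from h)]
    exact le_self_add
  · rw [Set.indicator_of_notMem (show z ∉ {z : Plane | ‖z‖ < ρ} from h), zero_add]
    exact ENNReal.ofReal_le_ofReal (Real.rpow_le_rpow_of_nonpos hρ (not_lt.1 h) (by linarith))

theorem ae_enorm_le_eLpNorm_top (f : Plane → ℝ) : ∀ᵐ y, ‖f y‖ₑ ≤ eLpNorm f ∞ := by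
  rw [eLpNorm_exponent_top]
  exact ae_le_eLpNormEssSup

/-- Within distance `ρ` of `x`, `f` is bounded by its supremum and the kernel is integrable; beyond,
the kernel is at most `ρ^{ε-2}` and `f` is integrated. The radius is left free: it becomes
`(1+s)^{1/α}`, the diffusive length at time `s`. -/
theorem lintegral_potential_le {ε ρ : ℝ} (hε : 0 < ε) (hε2 : ε ≤ 2) (hρ : 0 < ρ) (f : Plane → ℝ)
    (x : Plane) :
    ∫⁻ y, ‖f y‖ₑ * ENNReal.ofReal (‖x - y‖ ^ (ε - 2)) ≤
      eLpNorm f ∞ * ENNReal.ofReal (discIntegral ε * ρ ^ ε) +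
        eLpNorm f 1 * ENNReal.ofReal (ρ ^ (ε - 2)) := by
  let k : Plane → ℝ≥0∞ := {z : Plane | ‖z‖ < ρ}.indicator fun z => ENNReal.ofReal (‖z‖ ^ (ε - 2))
  have hk : Measurable k :=
    Measurable.indicator (by fun_prop) (measurableSet_norm_lt ρ)
  have hkx : Measurable fun y => k (x - y) := hk.comp (measurable_const.sub measurable_id)
  calc ∫⁻ y, ‖f y‖ₑ * ENNReal.ofReal (‖x - y‖ ^ (ε - 2))
      ≤ ∫⁻ y, (eLpNorm f ∞ * k (x - y) + ‖f y‖ₑ * ENNReal.ofReal (ρ ^ (ε - 2))) := by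
        refine lintegral_mono_ae ?_
        filter_upwards [ae_enorm_le_eLpNorm_top f] with y hy
        calc _ ≤ ‖f y‖ₑ * (k (x - y) + ENNReal.ofReal (ρ ^ (ε - 2))) := by
              gcongr
              exact ofReal_norm_rpow_le hε2 hρ (x - y)
          _ ≤ _ := by
              rw [mul_add]
              gcongr
    _ = eLpNorm f ∞ * (∫⁻ z, k z) + eLpNorm f 1 * ENNReal.ofReal (ρ ^ (ε - 2)) := by
        rw [lintegral_add_left (hkx.const_mul _), lintegral_const_mul _ hkx,
          lintegral_sub_left_eq_self k x, lintegral_mul_const' _ _ ENNReal.ofReal_ne_top,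
          ← eLpNorm_one_eq_lintegral_enorm]
    _ = _ := by
        simp only [k]
        rw [lintegral_indicator (measurableSet_norm_lt ρ), lintegral_norm_rpow_lt hε hρ]

theorem lintegral_energy_le {ε ρ : ℝ} (hε : 0 < ε) (hε2 : ε ≤ 2) (hρ : 0 < ρ) {f : Plane → ℝ}
    (hf : AEStronglyMeasurable f) :
    ∫⁻ p : Plane × Plane, ‖f p.1‖ₑ * ‖f p.2‖ₑ * ENNReal.ofReal (‖p.1 - p.2‖ ^ (ε - 2)) ≤
      eLpNorm f 1 * (eLpNorm f ∞ * ENNReal.ofReal (discIntegral ε * ρ ^ ε) +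
        eLpNorm f 1 * ENNReal.ofReal (ρ ^ (ε - 2))) := by
  have hm : AEMeasurable (fun p : Plane × Plane => ‖f p.1‖ₑ * ‖f p.2‖ₑ *
      ENNReal.ofReal (‖p.1 - p.2‖ ^ (ε - 2))) (volume.prod volume) :=
    (hf.comp_fst.enorm.mul hf.comp_snd.enorm).mul (Measurable.aemeasurable (by fun_prop))
  rw [Measure.volume_eq_prod, lintegral_prod _ hm, eLpNorm_one_eq_lintegral_enorm (f := f),
    ← lintegral_mul_const'' _ hf.enorm]
  refine lintegral_mono fun x => ?_
  simp only [mul_assoc]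
  rw [lintegral_const_mul' _ _ enorm_ne_top]
  gcongr
  rw [← eLpNorm_one_eq_lintegral_enorm]
  exact lintegral_potential_le hε hε2 hρ f x

/-- At `z = 0` the identity rests on the convention `0^x = 0` for `x ≠ 0`, and `ε < 2` keeps the
exponent `ε - 2` away from 0. -/
theorem ofReal_rpow_mul_rpow {ε M : ℝ} (hM : 0 ≤ M) (hε : ε < 2) (z : Plane) :
    ENNReal.ofReal (M * ‖z‖ ^ ε) * ENNReal.ofReal (‖z‖ ^ (-2 : ℝ)) =
      ENNReal.ofReal M * ENNReal.ofReal (‖z‖ ^ (ε - 2)) := by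
  rw [← ENNReal.ofReal_mul (by positivity), ← ENNReal.ofReal_mul hM, mul_assoc,
    sub_eq_add_neg, Real.rpow_add' (norm_nonneg z) (by linarith)]

/-- The partial derivative of a function on the plane. -/
def partialDeriv (k : Fin 2) (Q : Plane → ℝ) (x : Plane) : ℝ := fderiv ℝ Q x (basisVec k)

/-- A bounded smooth function with bounded first derivatives. -/
structure IsBoundedSmooth (Q : Plane → ℝ) : Prop where
  contDiff : ContDiff ℝ ∞ Q
  bounded : ∃ A, ∀ x, |Q x| ≤ A
  deriv_bounded : ∃ B, ∀ k x, |partialDeriv k Q x| ≤ B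

theorem IsBoundedSmooth.continuous_partialDeriv {Q : Plane → ℝ} (hQ : IsBoundedSmooth Q)
    (k : Fin 2) : Continuous (partialDeriv k Q) :=
  (hQ.contDiff.continuous_fderiv (by simp)).clm_apply continuous_const

theorem partialDeriv_comp_sub_left {Q : Plane → ℝ} (hQ : Differentiable ℝ Q) (k : Fin 2)
    (x₀ y : Plane) :
    fderiv ℝ (fun y => Q (x₀ - y)) y (basisVec k) = - partialDeriv k Q (x₀ - y) := by
  have h : HasFDerivAt (Q ∘ fun y => x₀ - y) _ y :=
    (hQ (x₀ - y)).hasFDerivAt.comp y ((hasFDerivAt_id y).const_sub x₀)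
  change fderiv ℝ (Q ∘ fun y => x₀ - y) y (basisVec k) = _
  rw [h.fderiv]
  simp [partialDeriv]

/-- The modulus which the pairing estimate involves. -/
def pairModulus (Q : Plane → ℝ) (a b : Plane) : ℝ≥0∞ :=
  ‖partialDeriv 0 Q a - partialDeriv 0 Q b‖ₑ + ‖partialDeriv 1 Q a - partialDeriv 1 Q b‖ₑ

theorem IsRegular.enorm_convolution_advection_le {f : Plane → ℝ} (hf : IsRegular f)
    {Q : Plane → ℝ} (hQ : IsBoundedSmooth Q) (x₀ : Plane) :
    ‖(Q ⋆[ContinuousLinearMap.mul ℝ ℝ, volume] advection f) x₀‖ₑ ≤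
      ∫⁻ p : Plane × Plane, ‖f p.1‖ₑ * ‖f p.2‖ₑ * pairModulus Q (x₀ - p.1) (x₀ - p.2) *
        ENNReal.ofReal (‖p.1 - p.2‖ ^ (-2 : ℝ)) := by
  obtain ⟨A, hA⟩ := hQ.bounded
  obtain ⟨B, hB⟩ := hQ.deriv_bounded
  have hd := hQ.contDiff.differentiable (by simp)
  rw [convolution_eq_swap]
  have h := hf.enorm_integral_mul_advection_le (φ := fun y => Q (x₀ - y)) (A := A) (B := B)
    (hQ.contDiff.comp (contDiff_const.sub contDiff_id)) (fun x => hA _)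
    (fun k x => by rw [partialDeriv_comp_sub_left hd, abs_neg]; exact hB k _)
  simp only [partialDeriv_comp_sub_left hd] at h
  refine h.trans_eq (lintegral_congr fun p => ?_)
  congr 2
  rw [pairModulus, neg_sub_neg, neg_sub_neg, enorm_sub_rev, enorm_sub_rev (partialDeriv 1 Q _)]

theorem IsBoundedSmooth.measurable_pairModulus {Q : Plane → ℝ} (hQ : IsBoundedSmooth Q)
    {X : Type*} [MeasurableSpace X] {u v : X → Plane} (hu : Measurable u) (hv : Measurable v) :
    Measurable fun a => pairModulus Q (u a) (v a) := by
  have hq := fun k => (hQ.continuous_partialDeriv k).measurable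
  exact (((hq 0).comp hu).sub ((hq 0).comp hv)).enorm.add
    (((hq 1).comp hu).sub ((hq 1).comp hv)).enorm

/-- The pairing estimate in `L^∞`, from the Lipschitz seminorm of the derivatives of the kernel. -/
theorem IsRegular.enorm_convolution_advection_le_of_lipschitz {f : Plane → ℝ} (hf : IsRegular f)
    {Q : Plane → ℝ} (hQ : IsBoundedSmooth Q) {M ρ : ℝ} (hM : 0 ≤ M) (hρ : 0 < ρ)
    (h : ∀ a b, pairModulus Q a b ≤ ENNReal.ofReal (M * ‖a - b‖ ^ (1 : ℝ))) (x₀ : Plane) :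
    ‖(Q ⋆[ContinuousLinearMap.mul ℝ ℝ, volume] advection f) x₀‖ₑ ≤ ENNReal.ofReal M *
      (eLpNorm f 1 * (eLpNorm f ∞ * ENNReal.ofReal (discIntegral 1 * ρ ^ (1 : ℝ)) +
        eLpNorm f 1 * ENNReal.ofReal (ρ ^ (1 - 2 : ℝ)))) := by
  refine (hf.enorm_convolution_advection_le hQ x₀).trans ?_
  refine le_trans ?_ (mul_le_mul_right
    (lintegral_energy_le one_pos one_le_two hρ hf.integrable.1) _)
  rw [← lintegral_const_mul' _ _ ENNReal.ofReal_ne_top]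
  refine lintegral_mono fun p => ?_
  calc _ ≤ ‖f p.1‖ₑ * ‖f p.2‖ₑ * ENNReal.ofReal (M * ‖p.1 - p.2‖ ^ (1 : ℝ)) *
        ENNReal.ofReal (‖p.1 - p.2‖ ^ (-2 : ℝ)) := by
        gcongr
        refine (h _ _).trans_eq ?_
        rw [sub_sub_sub_cancel_left, norm_sub_rev]
    _ = _ := by
        rw [mul_assoc, ofReal_rpow_mul_rpow hM one_lt_two]
        ring

/-- The pairing estimate in `L¹`. -/
theorem IsRegular.lintegral_convolution_advection_le {f : Plane → ℝ} (hf : IsRegular f)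
    {Q : Plane → ℝ} (hQ : IsBoundedSmooth Q) {M ρ ε : ℝ} (hM : 0 ≤ M) (hρ : 0 < ρ) (hε : 0 < ε)
    (hε2 : ε < 2)
    (h : ∀ z, ∫⁻ a, pairModulus Q a (a + z) ≤ ENNReal.ofReal (M * ‖z‖ ^ ε)) :
    ∫⁻ x₀, ‖(Q ⋆[ContinuousLinearMap.mul ℝ ℝ, volume] advection f) x₀‖ₑ ≤ ENNReal.ofReal M *
      (eLpNorm f 1 * (eLpNorm f ∞ * ENNReal.ofReal (discIntegral ε * ρ ^ ε) +
        eLpNorm f 1 * ENNReal.ofReal (ρ ^ (ε - 2)))) := by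
  refine (lintegral_mono (hf.enorm_convolution_advection_le hQ)).trans ?_
  -- By Tonelli the integral over `x₀` comes first, for a fixed pair of points; by translation it
  -- depends on their difference only.
  rw [lintegral_lintegral_swap]
  · refine le_trans ?_ (mul_le_mul_right
      (lintegral_energy_le hε hε2.le hρ hf.integrable.1) _)
    rw [← lintegral_const_mul' _ _ ENNReal.ofReal_ne_top]
    refine lintegral_mono fun p => ?_
    have hm : Measurable fun x₀ => pairModulus Q (x₀ - p.1) (x₀ - p.2) :=
      hQ.measurable_pairModulus (measurable_id.sub_const p.1) (measurable_id.sub_const p.2)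
    have e : ∫⁻ x₀, pairModulus Q (x₀ - p.1) (x₀ - p.2) =
        ∫⁻ a, pairModulus Q a (a + (p.1 - p.2)) := by
      rw [← lintegral_sub_right_eq_self (fun a => pairModulus Q a (a + (p.1 - p.2))) p.1]
      refine lintegral_congr fun x₀ => ?_
      rw [sub_add_sub_cancel]
    simp only [mul_assoc]
    rw [lintegral_const_mul' _ _ enorm_ne_top, lintegral_const_mul' _ _ enorm_ne_top,
      lintegral_mul_const _ hm, e]
    calc _ ≤ ‖f p.1‖ₑ * (‖f p.2‖ₑ * (ENNReal.ofReal (M * ‖p.1 - p.2‖ ^ ε) *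
        ENNReal.ofReal (‖p.1 - p.2‖ ^ (-2 : ℝ)))) := by
          gcongr
          exact h _
      _ = _ := by
          rw [ofReal_rpow_mul_rpow hM hε2]
          ring
  · have h1 : AEMeasurable (fun p : Plane × Plane => ‖f p.1‖ₑ * ‖f p.2‖ₑ) :=
      AEMeasurable.mul hf.integrable.1.comp_fst.enorm hf.integrable.1.comp_snd.enorm
    have h2 : AEMeasurable (fun q : Plane × Plane × Plane => ‖f q.2.1‖ₑ * ‖f q.2.2‖ₑ)
        (volume.prod volume) := h1.comp_snd
    have h3 : Measurable fun q : Plane × Plane × Plane =>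
        pairModulus Q (q.1 - q.2.1) (q.1 - q.2.2) :=
      hQ.measurable_pairModulus (measurable_fst.sub (measurable_fst.comp measurable_snd))
        (measurable_fst.sub (measurable_snd.comp measurable_snd))
    have h4 : Measurable fun q : Plane × Plane × Plane =>
        ENNReal.ofReal (‖q.2.1 - q.2.2‖ ^ (-2 : ℝ)) := by fun_prop
    exact (h2.mul h3.aemeasurable).mul h4.aemeasurable

/-- The sum of the absolute values of the partial derivatives. -/
def gradSum (Q : Plane → ℝ) (a : Plane) : ℝ≥0∞ := ‖partialDeriv 0 Q a‖ₑ + ‖partialDeriv 1 Q a‖ₑ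

theorem pairModulus_le (Q : Plane → ℝ) (a b : Plane) :
    pairModulus Q a b ≤ gradSum Q a + gradSum Q b := by
  refine (add_le_add enorm_sub_le enorm_sub_le).trans_eq ?_
  simp only [gradSum]
  ring

theorem IsBoundedSmooth.measurable_gradSum {Q : Plane → ℝ} (hQ : IsBoundedSmooth Q) :
    Measurable (gradSum Q) :=
  (hQ.continuous_partialDeriv 0).measurable.enorm.add (hQ.continuous_partialDeriv 1).measurable.enorm

/-- The pairing estimate in `L^∞`, from integral bounds on the derivatives of the kernel. -/
theorem IsRegular.enorm_convolution_advection_le_of_lintegral {f : Plane → ℝ} (hf : IsRegular f)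
    {Q : Plane → ℝ} (hQ : IsBoundedSmooth Q) {M ρ ε : ℝ} (hM : 0 ≤ M)
    (hρ : 0 < ρ) (hε : 0 < ε) (hε2 : ε < 2)
    (h : ∀ z, ∫⁻ a, pairModulus Q a (a + z) ≤ ENNReal.ofReal (M * ‖z‖ ^ ε)) (x₀ : Plane) :
    ‖(Q ⋆[ContinuousLinearMap.mul ℝ ℝ, volume] advection f) x₀‖ₑ ≤
      eLpNorm f ∞ * eLpNorm f ∞ * (ENNReal.ofReal M * ENNReal.ofReal (discIntegral ε * ρ ^ ε)) +
        2 * (eLpNorm f ∞ * eLpNorm f 1 * ((∫⁻ a, gradSum Q a) * ENNReal.ofReal (ρ ^ (-2 : ℝ)))) := by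
  set E := eLpNorm f ∞ with hE
  let k : Plane → ℝ≥0∞ := {z : Plane | ‖z‖ < ρ}.indicator fun z => ENNReal.ofReal (‖z‖ ^ (-2 : ℝ))
  have hk : Measurable k :=
    Measurable.indicator (by fun_prop) (measurableSet_norm_lt ρ)
  have hf1 : AEMeasurable (fun p : Plane × Plane => ‖f p.1‖ₑ) := hf.integrable.1.comp_fst.enorm
  have hf2 : AEMeasurable (fun p : Plane × Plane => ‖f p.2‖ₑ) := hf.integrable.1.comp_snd.enorm
  have hW := hQ.measurable_pairModulus ((measurable_fst (α := Plane) (β := Plane)).const_sub x₀)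
    ((measurable_snd (α := Plane) (β := Plane)).const_sub x₀)
  have hWk : Measurable fun p : Plane × Plane =>
      pairModulus Q (x₀ - p.1) (x₀ - p.2) * k (p.1 - p.2) :=
    hW.mul (hk.comp (measurable_fst.sub measurable_snd))
  have hg1 : Measurable fun p : Plane × Plane => gradSum Q (x₀ - p.1) :=
    hQ.measurable_gradSum.comp (measurable_fst.const_sub x₀)
  have hg2 : Measurable fun p : Plane × Plane => gradSum Q (x₀ - p.2) :=
    hQ.measurable_gradSum.comp (measurable_snd.const_sub x₀)
  have hle1 : ∀ᵐ p : Plane × Plane, ‖f p.1‖ₑ ≤ E :=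
    Measure.quasiMeasurePreserving_fst.ae (ae_enorm_le_eLpNorm_top f)
  have hle2 : ∀ᵐ p : Plane × Plane, ‖f p.2‖ₑ ≤ E :=
    Measure.quasiMeasurePreserving_snd.ae (ae_enorm_le_eLpNorm_top f)
  -- Near the diagonal both values of `f` are bounded by the supremum. With `z = x - y`, integrating
  -- the modulus in `x` leaves `M |z|^{ε-2}` on the disc of radius `ρ`.
  have near : ∫⁻ p : Plane × Plane, pairModulus Q (x₀ - p.1) (x₀ - p.2) * k (p.1 - p.2) ≤
      ENNReal.ofReal M * ENNReal.ofReal (discIntegral ε * ρ ^ ε) := by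
    rw [Measure.volume_eq_prod, lintegral_prod _ hWk.aemeasurable]
    have e1 : ∀ x, ∫⁻ y, pairModulus Q (x₀ - x) (x₀ - y) * k (x - y) =
        ∫⁻ z, pairModulus Q (x₀ - x) (x₀ - x + z) * k z := fun x => by
      rw [← lintegral_sub_left_eq_self (fun z => pairModulus Q (x₀ - x) (x₀ - x + z) * k z) x]
      simp only [sub_add_sub_cancel]
    simp only [e1]
    rw [lintegral_lintegral_swap]
    · have e2 : ∀ z, ∫⁻ x, pairModulus Q (x₀ - x) (x₀ - x + z) * k z ≤
          {z : Plane | ‖z‖ < ρ}.indicator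
            (fun z => ENNReal.ofReal M * ENNReal.ofReal (‖z‖ ^ (ε - 2))) z := fun z => by
        have hz : Measurable fun x => pairModulus Q (x₀ - x) (x₀ - x + z) :=
          hQ.measurable_pairModulus (measurable_id.const_sub x₀)
            ((measurable_id.const_sub x₀).add_const z)
        rw [lintegral_mul_const _ hz,
          lintegral_sub_left_eq_self (fun a => pairModulus Q a (a + z)) x₀]
        simp only [k, Set.indicator]
        split_ifs
        · rw [← ofReal_rpow_mul_rpow hM hε2]
          gcongr
          exact h z
        · simp
      refine (lintegral_mono e2).trans_eq ?_
      rw [lintegral_indicator (measurableSet_norm_lt ρ),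
        lintegral_const_mul' _ _ ENNReal.ofReal_ne_top, lintegral_norm_rpow_lt hε hρ]
    · exact ((hQ.measurable_pairModulus (measurable_fst.const_sub x₀)
        ((measurable_fst.const_sub x₀).add measurable_snd)).mul
        (hk.comp measurable_snd)).aemeasurable
  -- Away from the diagonal the kernel is at most `ρ⁻²` and the modulus is split into two gradients.
  -- The value of `f` at the point of the gradient is bounded by the supremum, and the other one is
  -- integrated.
  have far1 : ∫⁻ p : Plane × Plane, E * gradSum Q (x₀ - p.1) * ‖f p.2‖ₑ =
      E * eLpNorm f 1 * ∫⁻ a, gradSum Q a := by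
    rw [Measure.volume_eq_prod, lintegral_prod_mul
      (f := fun x => E * gradSum Q (x₀ - x)) (g := fun y => ‖f y‖ₑ)
      ((hQ.measurable_gradSum.comp (measurable_id.const_sub x₀)).const_mul E).aemeasurable
      hf.integrable.1.enorm, lintegral_const_mul' _ _ hf.memLp_top.2.ne,
      lintegral_sub_left_eq_self (gradSum Q) x₀, eLpNorm_one_eq_lintegral_enorm]
    ring
  have far2 : ∫⁻ p : Plane × Plane, ‖f p.1‖ₑ * (E * gradSum Q (x₀ - p.2)) =
      E * eLpNorm f 1 * ∫⁻ a, gradSum Q a := by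
    rw [Measure.volume_eq_prod, lintegral_prod_mul
      (f := fun x => ‖f x‖ₑ) (g := fun y => E * gradSum Q (x₀ - y))
      hf.integrable.1.enorm
      ((hQ.measurable_gradSum.comp (measurable_id.const_sub x₀)).const_mul E).aemeasurable,
      lintegral_const_mul' _ _ hf.memLp_top.2.ne,
      lintegral_sub_left_eq_self (gradSum Q) x₀, eLpNorm_one_eq_lintegral_enorm]
    ring
  calc _ ≤ ∫⁻ p : Plane × Plane, ‖f p.1‖ₑ * ‖f p.2‖ₑ * pairModulus Q (x₀ - p.1) (x₀ - p.2) *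
        ENNReal.ofReal (‖p.1 - p.2‖ ^ (-2 : ℝ)) := hf.enorm_convolution_advection_le hQ x₀
    _ ≤ ∫⁻ p : Plane × Plane, (E * E * (pairModulus Q (x₀ - p.1) (x₀ - p.2) * k (p.1 - p.2)) +
        (E * gradSum Q (x₀ - p.1) * ‖f p.2‖ₑ + ‖f p.1‖ₑ * (E * gradSum Q (x₀ - p.2))) *
          ENNReal.ofReal (ρ ^ (-2 : ℝ))) := by
        refine lintegral_mono_ae ?_
        filter_upwards [hle1, hle2] with p h1 h2
        have h3 := ofReal_norm_rpow_le (ε := 0) (by norm_num) hρ (p.1 - p.2)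
        rw [zero_sub] at h3
        calc _ ≤ ‖f p.1‖ₑ * ‖f p.2‖ₑ * pairModulus Q (x₀ - p.1) (x₀ - p.2) *
              (k (p.1 - p.2) + ENNReal.ofReal (ρ ^ (-2 : ℝ))) := by
              gcongr
          _ = ‖f p.1‖ₑ * ‖f p.2‖ₑ * (pairModulus Q (x₀ - p.1) (x₀ - p.2) * k (p.1 - p.2)) +
              ‖f p.1‖ₑ * ‖f p.2‖ₑ * pairModulus Q (x₀ - p.1) (x₀ - p.2) *
              ENNReal.ofReal (ρ ^ (-2 : ℝ)) := by ring
          _ ≤ E * E * (pairModulus Q (x₀ - p.1) (x₀ - p.2) * k (p.1 - p.2)) +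
              (‖f p.1‖ₑ * ‖f p.2‖ₑ * (gradSum Q (x₀ - p.1) + gradSum Q (x₀ - p.2))) *
              ENNReal.ofReal (ρ ^ (-2 : ℝ)) := by
              gcongr
              exact pairModulus_le Q _ _
          _ = E * E * (pairModulus Q (x₀ - p.1) (x₀ - p.2) * k (p.1 - p.2)) +
              (‖f p.1‖ₑ * gradSum Q (x₀ - p.1) * ‖f p.2‖ₑ +
                ‖f p.1‖ₑ * (‖f p.2‖ₑ * gradSum Q (x₀ - p.2))) *
              ENNReal.ofReal (ρ ^ (-2 : ℝ)) := by ring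
          _ ≤ _ := by gcongr
    _ = E * E * (∫⁻ p : Plane × Plane, pairModulus Q (x₀ - p.1) (x₀ - p.2) * k (p.1 - p.2)) +
        (E * eLpNorm f 1 * (∫⁻ a, gradSum Q a) + E * eLpNorm f 1 * ∫⁻ a, gradSum Q a) *
          ENNReal.ofReal (ρ ^ (-2 : ℝ)) := by
        rw [lintegral_add_left (hWk.const_mul _), lintegral_const_mul _ hWk,
          lintegral_mul_const' _ _ ENNReal.ofReal_ne_top,
          lintegral_add_left' (f := fun p : Plane × Plane => E * gradSum Q (x₀ - p.1) * ‖f p.2‖ₑ)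
            ((hg1.const_mul E).aemeasurable.mul hf2), far1, far2]
    _ ≤ E * E * (ENNReal.ofReal M * ENNReal.ofReal (discIntegral ε * ρ ^ ε)) +
        (E * eLpNorm f 1 * (∫⁻ a, gradSum Q a) + E * eLpNorm f 1 * ∫⁻ a, gradSum Q a) *
          ENNReal.ofReal (ρ ^ (-2 : ℝ)) := by gcongr
    _ = _ := by ring

/-! ### Smoothness of the fractional heat kernel -/

/-- The symbol `e^{-t|ξ|^α}` of the fractional heat kernel, in Mathlib's normalisation. -/
def heatSymbol (α t : ℝ) (ξ : Plane) : ℝ := Real.exp (-t * (2 * Real.pi * ‖ξ‖) ^ α)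

theorem continuous_heatSymbol {α : ℝ} (hα : 0 ≤ α) (t : ℝ) : Continuous (heatSymbol α t) := by
  unfold heatSymbol
  refine Real.continuous_exp.comp (continuous_const.mul ?_)
  exact (continuous_const.mul continuous_norm).rpow_const fun _ => Or.inr hα

theorem integrable_norm_pow_mul_heatSymbol {α t : ℝ} (hα : 0 < α) (ht : 0 < t) (n : ℕ) :
    Integrable fun ξ : Plane => ‖ξ‖ ^ n * heatSymbol α t ξ := by
  have h := integrable_fun_norm_addHaar (E := Plane) volume
    (f := fun y : ℝ => y ^ n * Real.exp (-t * (2 * Real.pi * y) ^ α))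
  refine h.2 ?_
  have h1 := integrableOn_rpow_mul_exp_neg_mul_rpow (s := (n : ℝ) + 1) (p := α)
    (b := t * (2 * Real.pi) ^ α) (by linarith [n.cast_nonneg (α := ℝ)]) hα (by positivity)
  refine h1.congr_fun (fun y hy => ?_) measurableSet_Ioi
  have hy : 0 < y := hy
  simp only [finrank_euclideanSpace, Fintype.card_fin]
  rw [Real.mul_rpow (by positivity) hy.le, Real.rpow_add_one hy.ne', Real.rpow_natCast]
  simp
  ring_nf

theorem integrable_heatSymbol {α t : ℝ} (hα : 0 < α) (ht : 0 < t) :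
    Integrable (heatSymbol α t) := by
  simpa using integrable_norm_pow_mul_heatSymbol hα ht 0

theorem heatSymbol_pos (α t : ℝ) (ξ : Plane) : 0 < heatSymbol α t ξ := Real.exp_pos _

theorem heatKernel_eq (α t : ℝ) (x : Plane) :
    heatKernel α t x = (𝓕⁻ (fun ξ => (heatSymbol α t ξ : ℂ)) x).re := rfl

/-- The derivative of an inverse Fourier transform. -/
theorem hasFDerivAt_fourierInv {m : Plane → ℂ} (hm : Integrable m)
    (hm1 : Integrable fun ξ => ‖ξ‖ * ‖m ξ‖) (x : Plane) :
    HasFDerivAt (𝓕⁻ m) (-(𝓕 (VectorFourier.fourierSMulRight (innerSL ℝ) m) (-x))) x := by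
  have h := (Real.hasFDerivAt_fourier hm hm1 (-x)).comp x (hasFDerivAt_id x).neg
  rw [funext (Real.fourierInv_eq_fourier_neg m)]
  convert! h using 1
  ext v
  simp

theorem fderiv_fourierInv_apply {m : Plane → ℂ} (hm : Integrable m)
    (hm1 : Integrable fun ξ => ‖ξ‖ * ‖m ξ‖) (k : Fin 2) (x : Plane) :
    fderiv ℝ (𝓕⁻ m) x (basisVec k) =
      𝓕⁻ (fun ξ => (2 * Real.pi * Complex.I) * (ξ k : ℂ) * m ξ) x := by
  have hi : Integrable (VectorFourier.fourierSMulRight (innerSL ℝ) m) := by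
    refine (hm1.const_mul (2 * Real.pi)).mono' hm.1.fourierSMulRight ?_
    refine Eventually.of_forall fun ξ => ?_
    refine (VectorFourier.norm_fourierSMulRight_le _ _ _).trans ?_
    have : ‖innerSL ℝ (E := Plane)‖ ≤ 1 := norm_innerSL_le ℝ
    calc _ ≤ 2 * Real.pi * 1 * ‖ξ‖ * ‖m ξ‖ := by gcongr
      _ = _ := by ring
  rw [(hasFDerivAt_fourierInv hm hm1 x).fderiv, neg_apply,
    Real.fourier_continuousLinearMap_apply hi, Real.fourierInv_eq_fourier_neg, Real.fourier_eq,
    Real.fourier_eq, ← integral_neg]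
  congr 1 with ξ
  rw [VectorFourier.fourierSMulRight_apply, ← smul_neg]
  congr 1
  have e : (innerSL ℝ) ξ (basisVec k) = ξ k := by
    simp [basisVec, EuclideanSpace.inner_single_right]
  rw [e, smul_eq_mul, Complex.real_smul]
  ring

theorem contDiff_fourierInv {m : Plane → ℂ}
    (hm : ∀ n : ℕ, Integrable fun ξ => ‖ξ‖ ^ n * ‖m ξ‖) : ContDiff ℝ ∞ (𝓕⁻ m) := by
  rw [funext (Real.fourierInv_eq_fourier_neg m)]
  exact (Real.contDiff_fourier (N := ⊤) fun n _ => hm n).comp contDiff_neg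

theorem integrable_norm_pow_mul_norm_heatSymbol {α t : ℝ} (hα : 0 < α) (ht : 0 < t) (n : ℕ) :
    Integrable fun ξ : Plane => ‖ξ‖ ^ n * ‖(heatSymbol α t ξ : ℂ)‖ := by
  refine (integrable_norm_pow_mul_heatSymbol hα ht n).congr (Eventually.of_forall fun ξ => ?_)
  simp [abs_of_pos (heatSymbol_pos α t ξ)]

theorem contDiff_heatKernel {α t : ℝ} (hα : 0 < α) (ht : 0 < t) :
    ContDiff ℝ ∞ (heatKernel α t) :=
  Complex.reCLM.contDiff.comp
    (contDiff_fourierInv (integrable_norm_pow_mul_norm_heatSymbol hα ht))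

theorem partialDeriv_re_fourierInv {m : Plane → ℂ} (hm : Integrable m)
    (hm1 : Integrable fun ξ => ‖ξ‖ * ‖m ξ‖) (k : Fin 2) (x : Plane) :
    partialDeriv k (fun x => (𝓕⁻ m x).re) x =
      (𝓕⁻ (fun ξ => (2 * Real.pi * Complex.I) * (ξ k : ℂ) * m ξ) x).re := by
  have h : HasFDerivAt (fun x => (𝓕⁻ m x).re) _ x :=
    Complex.reCLM.hasFDerivAt.comp x (hasFDerivAt_fourierInv hm hm1 x)
  rw [partialDeriv, h.fderiv, ← fderiv_fourierInv_apply hm hm1,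
    (hasFDerivAt_fourierInv hm hm1 x).fderiv]
  rfl

theorem partialDeriv_heatKernel {α t : ℝ} (hα : 0 < α) (ht : 0 < t) (k : Fin 2) (x : Plane) :
    partialDeriv k (heatKernel α t) x =
      (𝓕⁻ (fun ξ => (2 * Real.pi * Complex.I) * (ξ k : ℂ) * (heatSymbol α t ξ : ℂ)) x).re :=
  partialDeriv_re_fourierInv (integrable_heatSymbol hα ht).ofReal
    (by simpa using integrable_norm_pow_mul_norm_heatSymbol hα ht 1) k x

theorem norm_two_pi_I_mul_apply_mul (ξ : Plane) (k : Fin 2) (z : ℂ) :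
    ‖(2 * Real.pi * Complex.I) * (ξ k : ℂ) * z‖ = 2 * Real.pi * |ξ k| * ‖z‖ := by
  simp [abs_of_pos Real.pi_pos]

theorem norm_ofReal_heatSymbol (α t : ℝ) (ξ : Plane) :
    ‖(heatSymbol α t ξ : ℂ)‖ = heatSymbol α t ξ := by
  simp [abs_of_pos (heatSymbol_pos α t ξ)]

theorem integrable_norm_pow_mul_apply_heatSymbol {α t : ℝ} (hα : 0 < α) (ht : 0 < t) (k : Fin 2)
    (n : ℕ) : Integrable fun ξ : Plane =>
      ‖ξ‖ ^ n * ‖(2 * Real.pi * Complex.I) * (ξ k : ℂ) * (heatSymbol α t ξ : ℂ)‖ := by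
  have hc := continuous_heatSymbol hα.le t
  refine ((integrable_norm_pow_mul_heatSymbol hα ht (n + 1)).const_mul (2 * Real.pi)).mono'
    (Continuous.aestronglyMeasurable (by fun_prop)) (Eventually.of_forall fun ξ => ?_)
  rw [norm_mul, norm_pow, norm_norm, norm_norm, norm_two_pi_I_mul_apply_mul,
    norm_ofReal_heatSymbol]
  have h1 := abs_apply_le_norm ξ k
  have h2 := (heatSymbol_pos α t ξ).le
  calc _ ≤ ‖ξ‖ ^ n * (2 * Real.pi * ‖ξ‖ * heatSymbol α t ξ) := by gcongr
    _ = _ := by ring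

theorem partialDeriv_partialDeriv_heatKernel {α t : ℝ} (hα : 0 < α) (ht : 0 < t) (k l : Fin 2)
    (x : Plane) :
    partialDeriv l (partialDeriv k (heatKernel α t)) x =
      (𝓕⁻ (fun ξ => (2 * Real.pi * Complex.I) * (ξ l : ℂ) *
        ((2 * Real.pi * Complex.I) * (ξ k : ℂ) * (heatSymbol α t ξ : ℂ))) x).re := by
  have h := integrable_norm_pow_mul_apply_heatSymbol hα ht k
  have hc := continuous_heatSymbol hα.le t
  rw [funext (partialDeriv_heatKernel hα ht k)]
  refine partialDeriv_re_fourierInv ?_ (by simpa using h 1) l x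
  refine (integrable_norm_iff (Continuous.aestronglyMeasurable (by fun_prop))).1 ?_
  simpa using h 0

theorem contDiff_partialDeriv {Q : Plane → ℝ} (hQ : ContDiff ℝ ∞ Q) (k : Fin 2) :
    ContDiff ℝ ∞ (partialDeriv k Q) :=
  (hQ.fderiv_right (m := ∞) (by simp)).clm_apply contDiff_const

theorem abs_heatKernel_le {α t : ℝ} (x : Plane) :
    |heatKernel α t x| ≤ ∫ ξ, heatSymbol α t ξ := by
  rw [heatKernel_eq]
  refine (Complex.abs_re_le_norm _).trans ((norm_fourierInv_le _ _).trans_eq ?_)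
  congr 1 with ξ
  simp [abs_of_pos (heatSymbol_pos α t ξ)]

theorem isBoundedSmooth_heatKernel {α t : ℝ} (hα : 0 < α) (ht : 0 < t) :
    IsBoundedSmooth (heatKernel α t) := by
  refine ⟨contDiff_heatKernel hα ht, ⟨_, abs_heatKernel_le⟩,
    ⟨2 * Real.pi * ∫ ξ : Plane, ‖ξ‖ ^ 1 * heatSymbol α t ξ, fun k x => ?_⟩⟩
  rw [partialDeriv_heatKernel hα ht]
  refine (Complex.abs_re_le_norm _).trans ((norm_fourierInv_le _ _).trans ?_)
  rw [← integral_const_mul]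
  refine integral_mono (by simpa using integrable_norm_pow_mul_apply_heatSymbol hα ht k 0)
    ((integrable_norm_pow_mul_heatSymbol hα ht 1).const_mul _) fun ξ => ?_
  rw [norm_two_pi_I_mul_apply_mul, norm_ofReal_heatSymbol, pow_one]
  have h1 := abs_apply_le_norm ξ k
  have h2 := (heatSymbol_pos α t ξ).le
  rw [← mul_assoc]
  gcongr

/-- A bound for the second derivatives of the heat kernel. -/
theorem abs_partialDeriv_partialDeriv_heatKernel_le {α t : ℝ} (hα : 0 < α) (ht : 0 < t)
    (k l : Fin 2) (x : Plane) : |partialDeriv l (partialDeriv k (heatKernel α t)) x| ≤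
      (2 * Real.pi) ^ 2 * ∫ ξ : Plane, ‖ξ‖ ^ 2 * heatSymbol α t ξ := by
  have hc := continuous_heatSymbol hα.le t
  rw [partialDeriv_partialDeriv_heatKernel hα ht]
  refine (Complex.abs_re_le_norm _).trans ((norm_fourierInv_le _ _).trans ?_)
  rw [← integral_const_mul]
  have hle : ∀ ξ : Plane, ‖(2 * Real.pi * Complex.I) * (ξ l : ℂ) *
        ((2 * Real.pi * Complex.I) * (ξ k : ℂ) * (heatSymbol α t ξ : ℂ))‖ ≤
        (2 * Real.pi) ^ 2 * (‖ξ‖ ^ 2 * heatSymbol α t ξ) := fun ξ => by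
    rw [norm_two_pi_I_mul_apply_mul, norm_two_pi_I_mul_apply_mul, norm_ofReal_heatSymbol]
    have h1 := abs_apply_le_norm ξ k
    have h3 := abs_apply_le_norm ξ l
    have h2 := (heatSymbol_pos α t ξ).le
    calc _ ≤ 2 * Real.pi * ‖ξ‖ * (2 * Real.pi * ‖ξ‖ * heatSymbol α t ξ) := by gcongr
      _ = _ := by ring
  have hi := (integrable_norm_pow_mul_heatSymbol hα ht 2).const_mul ((2 * Real.pi) ^ 2)
  exact integral_mono (hi.mono' (Continuous.aestronglyMeasurable (by fun_prop))
    (Eventually.of_forall fun ξ => by simpa using hle ξ)) hi hle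

/-! ### Integrability of Fourier transforms -/

theorem hasWeakDeriv_partialDeriv {f : Plane → ℝ} (hf : ContDiff ℝ ∞ f) (i : Fin 2) :
    HasWeakDeriv i f (partialDeriv i f) := by
  have hd : Continuous (partialDeriv i f) := (contDiff_partialDeriv hf i).continuous
  refine ⟨hf.continuous.locallyIntegrable, hd.locallyIntegrable, fun φ hφ hc => ?_⟩
  have hc' : HasCompactSupport (fun x => fderiv ℝ φ x (basisVec i)) := hc.fderiv_apply (𝕜 := ℝ) _
  have hcont : Continuous (fun x => fderiv ℝ φ x (basisVec i)) :=
    (hφ.continuous_fderiv (by simp)).clm_apply continuous_const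
  exact integral_mul_fderiv_eq_neg_fderiv_mul_of_integrable (μ := (volume : Measure Plane))
    (𝕜 := ℝ) (f := f) (g := φ) (v := basisVec i)
    ((hd.mul hφ.continuous).integrable_of_hasCompactSupport hc.mul_left)
    ((hf.continuous.mul hcont).integrable_of_hasCompactSupport hc'.mul_left)
    ((hf.continuous.mul hφ.continuous).integrable_of_hasCompactSupport hc.mul_left)
    (fun x _ => hf.differentiable (by simp) x) (fun x _ => hφ.differentiable (by simp) x)

/-- The inverse of the symbol of `(1 - ∂₀)(1 - ∂₁)`. -/
def besselWeight (x : Plane) : ℂ :=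
  ((1 - (2 * Real.pi * x 0 : ℝ) * Complex.I) * (1 - (2 * Real.pi * x 1 : ℝ) * Complex.I))⁻¹

theorem one_sub_mul_I_ne_zero (s : ℝ) : (1 - (s : ℂ) * Complex.I) ≠ 0 := fun h => by
  have := congrArg Complex.re h
  simp at this

theorem continuous_besselWeight : Continuous besselWeight := by
  unfold besselWeight
  refine Continuous.inv₀ (by fun_prop) fun x => ?_
  exact mul_ne_zero (one_sub_mul_I_ne_zero _) (one_sub_mul_I_ne_zero _)

theorem norm_one_sub_mul_I_sq (s : ℝ) : ‖(1 - (s : ℂ) * Complex.I)‖ ^ 2 = 1 + s ^ 2 := by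
  rw [← Complex.normSq_eq_norm_sq, Complex.normSq_apply]
  simp
  ring

/-- The square of the modulus is a product of two integrable functions of one variable. This is why
`(1 - ∂₀)(1 - ∂₁)` is used: the only second derivative to be controlled is the mixed one. -/
theorem memLp_besselWeight : MemLp besselWeight 2 := by
  refine (memLp_two_iff_integrable_sq_norm continuous_besselWeight.aestronglyMeasurable).2 ?_
  have h1 : Integrable fun y : ℝ => (1 + (2 * Real.pi * y) ^ 2)⁻¹ :=
    integrable_inv_one_add_sq.comp_mul_left' (by positivity)
  have h2 := Integrable.fintype_prod (ι := Fin 2) (f := fun _ (y : ℝ) => (1 + (2 * Real.pi * y) ^ 2)⁻¹)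
    (μ := fun _ => volume) fun _ => h1
  have h3 := (PiLp.volume_preserving_ofLp (Fin 2)).integrable_comp_of_integrable h2
  refine h3.congr (Eventually.of_forall fun x => ?_)
  simp only [Function.comp, Fin.prod_univ_two, besselWeight, norm_inv, norm_mul, mul_pow, inv_pow,
    norm_one_sub_mul_I_sq, mul_inv]

theorem memLp_two_heatSymbol : MemLp (heatSymbol 1 (1 / 2)) 2 := by
  refine (memLp_two_iff_integrable_sq
    (continuous_heatSymbol zero_le_one _).aestronglyMeasurable).2 ?_
  refine (integrable_heatSymbol (α := 1) (t := 1) one_pos one_pos).congr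
    (Eventually.of_forall fun ξ => ?_)
  simp only [heatSymbol, ← Real.exp_nat_mul]
  congr 1
  push_cast
  ring

/-- A bound for the `L¹` norm of the Fourier transform. -/
theorem lintegral_enorm_fourier_le {m : Plane → ℝ} (hm : ContDiff ℝ ∞ m) {K : ℝ}
    (h0 : ∀ ξ, |m ξ| ≤ K * heatSymbol 1 (1 / 2) ξ)
    (h1 : ∀ i ξ, |partialDeriv i m ξ| ≤ K * heatSymbol 1 (1 / 2) ξ)
    (h2 : ∀ ξ, |partialDeriv 1 (partialDeriv 0 m) ξ| ≤ K * heatSymbol 1 (1 / 2) ξ) :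
    ∫⁻ x, ‖𝓕 (fun ξ => (m ξ : ℂ)) x‖ₑ ≤
      eLpNorm besselWeight 2 * eLpNorm (fun ξ => 4 * K * heatSymbol 1 (1 / 2) ξ) 2 := by
  have hg1 : Integrable fun ξ => K * heatSymbol 1 (1 / 2) ξ :=
    (integrable_heatSymbol one_pos (by norm_num)).const_mul K
  have hg2 : MemLp (fun ξ => 4 * K * heatSymbol 1 (1 / 2) ξ) 2 :=
    memLp_two_heatSymbol.const_mul (4 * K)
  have c1 := fun i => contDiff_partialDeriv hm i
  have c2 := contDiff_partialDeriv (c1 0) 1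
  have i0 : Integrable m := hg1.mono' hm.continuous.aestronglyMeasurable (Eventually.of_forall h0)
  have i1 : ∀ i, Integrable (partialDeriv i m) := fun i =>
    hg1.mono' (c1 i).continuous.aestronglyMeasurable (Eventually.of_forall (h1 i))
  have i2 : Integrable (partialDeriv 1 (partialDeriv 0 m)) :=
    hg1.mono' c2.continuous.aestronglyMeasurable (Eventually.of_forall h2)
  -- This is `(1 - ∂₀)(1 - ∂₁) m`, so that `𝓕 m = besselWeight · 𝓕 n`; Cauchy–Schwarz and Plancherel
  -- then conclude.
  let n : Plane → ℝ := fun ξ =>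
    m ξ - partialDeriv 0 m ξ - partialDeriv 1 m ξ + partialDeriv 1 (partialDeriv 0 m) ξ
  have hnc : Continuous n := ((hm.continuous.sub (c1 0).continuous).sub (c1 1).continuous).add
    c2.continuous
  have hn1 : Integrable (fun ξ => (n ξ : ℂ)) := (((i0.sub (i1 0)).sub (i1 1)).add i2).ofReal
  have hnle : ∀ ξ, ‖(n ξ : ℂ)‖ ≤ ‖4 * K * heatSymbol 1 (1 / 2) ξ‖ := fun ξ => by
    rw [Complex.norm_real]
    refine le_trans ?_ (le_abs_self _)
    have a0 := h0 ξ
    have a1 := h1 0 ξ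
    have a2 := h1 1 ξ
    have a3 := h2 ξ
    rw [abs_le] at a0 a1 a2 a3
    rw [Real.norm_eq_abs, abs_le]
    constructor <;> simp only [n] <;> linarith
  have hn2 : MemLp (fun ξ => (n ξ : ℂ)) 2 :=
    hg2.mono hn1.1 (Eventually.of_forall hnle)
  have hF : ∀ x, 𝓕 (fun ξ => (n ξ : ℂ)) x =
      ((1 - (2 * Real.pi * x 0 : ℝ) * Complex.I) * (1 - (2 * Real.pi * x 1 : ℝ) * Complex.I)) *
        𝓕 (fun ξ => (m ξ : ℂ)) x := fun x => by
    have e : (fun ξ => (n ξ : ℂ)) = (fun ξ => (m ξ : ℂ)) - (fun ξ => (partialDeriv 0 m ξ : ℂ)) -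
        (fun ξ => (partialDeriv 1 m ξ : ℂ)) +
        (fun ξ => (partialDeriv 1 (partialDeriv 0 m) ξ : ℂ)) := by
      funext ξ
      simp [n]
    have hsub : ∀ {u v : Plane → ℂ}, Integrable u → Integrable v →
        𝓕 (u - v) x = 𝓕 u x - 𝓕 v x := fun {u v} hu hv => by
      simp only [Real.fourier_eq, Pi.sub_apply, smul_sub]
      exact integral_sub ((Real.fourierIntegral_convergent_iff x).2 hu)
        ((Real.fourierIntegral_convergent_iff x).2 hv)
    have hadd : ∀ {u v : Plane → ℂ}, Integrable u → Integrable v →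
        𝓕 (u + v) x = 𝓕 u x + 𝓕 v x := fun {u v} hu hv => by
      simp only [Real.fourier_eq, Pi.add_apply, smul_add]
      exact integral_add ((Real.fourierIntegral_convergent_iff x).2 hu)
        ((Real.fourierIntegral_convergent_iff x).2 hv)
    have j0 : Integrable (fun ξ => (m ξ : ℂ)) := i0.ofReal
    have j1 : ∀ i, Integrable (fun ξ => (partialDeriv i m ξ : ℂ)) := fun i => (i1 i).ofReal
    have j2 : Integrable (fun ξ => (partialDeriv 1 (partialDeriv 0 m) ξ : ℂ)) := i2.ofReal
    rw [e, hadd ((j0.sub (j1 0)).sub (j1 1)) j2, hsub (j0.sub (j1 0)) (j1 1), hsub j0 (j1 0),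
      (hasWeakDeriv_partialDeriv (c1 0) 1).fourier_eq (i1 0) i2,
      (hasWeakDeriv_partialDeriv hm 0).fourier_eq i0 (i1 0),
      (hasWeakDeriv_partialDeriv hm 1).fourier_eq i0 (i1 1)]
    ring
  have e : 𝓕 (fun ξ => (m ξ : ℂ)) = besselWeight • 𝓕 (fun ξ => (n ξ : ℂ)) := by
    funext x
    rw [Pi.smul_apply', smul_eq_mul, hF, besselWeight, inv_mul_cancel_left₀]
    exact mul_ne_zero (one_sub_mul_I_ne_zero _) (one_sub_mul_I_ne_zero _)
  rw [← eLpNorm_one_eq_lintegral_enorm, e]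
  refine (eLpNorm_smul_le_mul_eLpNorm (p := 2) (q := 2)
    (continuous_fourier_of_integrable hn1).aestronglyMeasurable
    continuous_besselWeight.aestronglyMeasurable).trans ?_
  rw [eLpNorm_fourier_eq hn1 hn2]
  gcongr
  exact eLpNorm_mono hnle

/-! ### Regularised symbols -/

/-- Since `a ≥ 1/2`, one has `ρ^a ≥ √ρ - 1` for every `ρ`; half of the exponential `e^{-√ρ}` absorbs
the polynomial. The constant depends neither on `a` nor on the regularisation. -/
theorem one_add_sqrt_pow_mul_exp_neg_rpow_le {a ρ : ℝ} (ha : 1 / 2 ≤ a) (hρ : 0 < ρ) :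
    (1 + √ρ) ^ 4 * Real.exp (-ρ ^ a) ≤
      (Real.exp 1 * (2 ^ 4 * 24 * Real.exp (1 / 2))) * Real.exp (-(√ρ / 2)) := by
  set s := √ρ with hs
  have hs0 : 0 < s := Real.sqrt_pos.2 hρ
  have h1 : s - 1 ≤ ρ ^ a := by
    by_cases h : 1 ≤ ρ
    · have : s ≤ ρ ^ a := by
        rw [hs, Real.sqrt_eq_rpow]
        exact Real.rpow_le_rpow_of_exponent_le h ha
      linarith
    · have : s ≤ 1 := Real.sqrt_le_one.2 (not_le.1 h).le
      have := Real.rpow_nonneg hρ.le a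
      linarith
  have h2 : Real.exp (-ρ ^ a) ≤ Real.exp 1 * (Real.exp (-(s / 2)) * Real.exp (-(s / 2))) := by
    rw [← Real.exp_add, ← Real.exp_add]
    exact Real.exp_le_exp.2 (by linarith)
  have h4 : (1 + s) ^ 4 ≤ (2 ^ 4 * 24 * Real.exp (1 / 2)) * Real.exp (s / 2) := by
    have h := Real.pow_div_factorial_le_exp ((1 + s) / 2) (by positivity) 4
    rw [show ((Nat.factorial 4 : ℕ) : ℝ) = 24 by norm_num [Nat.factorial],
      div_le_iff₀ (by norm_num), add_div, Real.exp_add] at h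
    calc (1 + s) ^ 4 = 2 ^ 4 * (1 / 2 + s / 2) ^ 4 := by ring
      _ ≤ 2 ^ 4 * (Real.exp (1 / 2) * Real.exp (s / 2) * 24) := by gcongr
      _ = _ := by ring
  calc (1 + s) ^ 4 * Real.exp (-ρ ^ a)
      ≤ ((2 ^ 4 * 24 * Real.exp (1 / 2)) * Real.exp (s / 2)) *
        (Real.exp 1 * (Real.exp (-(s / 2)) * Real.exp (-(s / 2)))) :=
        mul_le_mul h4 h2 (Real.exp_pos _).le (by positivity)
    _ = (Real.exp 1 * (2 ^ 4 * 24 * Real.exp (1 / 2))) * Real.exp (-(s / 2)) *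
        (Real.exp (s / 2) * Real.exp (-(s / 2))) := by ring
    _ = _ := by rw [← Real.exp_add, add_neg_cancel, Real.exp_zero, mul_one]

theorem partialDeriv_mul {f g : Plane → ℝ} (hf : Differentiable ℝ f) (hg : Differentiable ℝ g)
    (k : Fin 2) (x : Plane) : partialDeriv k (fun x => f x * g x) x =
      f x * partialDeriv k g x + g x * partialDeriv k f x := by
  have h : HasFDerivAt (fun x => f x * g x) _ x := (hf x).hasFDerivAt.mul (hg x).hasFDerivAt
  rw [partialDeriv, h.fderiv]
  rfl

theorem partialDeriv_add {f g : Plane → ℝ} (hf : Differentiable ℝ f) (hg : Differentiable ℝ g)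
    (k : Fin 2) (x : Plane) : partialDeriv k (fun x => f x + g x) x =
      partialDeriv k f x + partialDeriv k g x := by
  have h : HasFDerivAt (fun x => f x + g x) _ x := (hf x).hasFDerivAt.add (hg x).hasFDerivAt
  rw [partialDeriv, h.fderiv]
  rfl

theorem partialDeriv_apply (i k : Fin 2) (x : Plane) :
    partialDeriv k (fun x => x i) x = if i = k then 1 else 0 := by
  rw [partialDeriv, (hasFDerivAt_apply_plane i x).fderiv]
  simp [basisVec]

/-- The regularised square of the frequency. -/
def regSq (ε : ℝ) (ξ : Plane) : ℝ := (2 * Real.pi) ^ 2 * ‖ξ‖ ^ 2 + ε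

theorem regSq_pos {ε : ℝ} (hε : 0 < ε) (ξ : Plane) : 0 < regSq ε ξ := by
  unfold regSq; positivity

theorem contDiff_regSq (ε : ℝ) : ContDiff ℝ ∞ (regSq ε) :=
  (contDiff_const.mul (contDiff_norm_sq ℝ)).add contDiff_const

theorem partialDeriv_comp_regSq {ε : ℝ} {F F' : ℝ → ℝ} {ξ : Plane}
    (hF : HasDerivAt F (F' (regSq ε ξ)) (regSq ε ξ)) (k : Fin 2) :
    partialDeriv k (fun ξ => F (regSq ε ξ)) ξ = 8 * Real.pi ^ 2 * ξ k * F' (regSq ε ξ) := by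
  have h1 : HasFDerivAt (regSq ε) _ ξ :=
    ((hasStrictFDerivAt_norm_sq ξ).hasFDerivAt.const_mul ((2 * Real.pi) ^ 2)).add_const ε
  have h : HasFDerivAt (fun ξ => F (regSq ε ξ)) _ ξ := hF.comp_hasFDerivAt ξ h1
  rw [partialDeriv, h.fderiv]
  simp [EuclideanSpace.inner_single_right]
  ring

theorem hasDerivAt_exp_neg_rpow (a : ℝ) {ρ : ℝ} (hρ : 0 < ρ) :
    HasDerivAt (fun ρ : ℝ => Real.exp (-ρ ^ a)) (-(a * ρ ^ (a - 1)) * Real.exp (-ρ ^ a)) ρ := by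
  have h : HasDerivAt (fun ρ : ℝ => Real.exp (-ρ ^ a)) _ ρ :=
    ((Real.hasDerivAt_rpow_const (p := a) (Or.inl hρ.ne')).neg).exp
  exact h.congr_deriv (mul_comm _ _)

theorem hasDerivAt_deriv_exp_neg_rpow (a : ℝ) {ρ : ℝ} (hρ : 0 < ρ) :
    HasDerivAt (fun ρ : ℝ => -(a * ρ ^ (a - 1)) * Real.exp (-ρ ^ a))
      ((a ^ 2 * (ρ ^ (a - 1)) ^ 2 - a * (a - 1) * ρ ^ (a - 2)) * Real.exp (-ρ ^ a)) ρ := by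
  have h1 : HasDerivAt (fun ρ : ℝ => -(a * ρ ^ (a - 1))) (-(a * ((a - 1) * ρ ^ (a - 1 - 1)))) ρ :=
    ((Real.hasDerivAt_rpow_const (p := a - 1) (Or.inl hρ.ne')).const_mul a).neg
  have h : HasDerivAt (fun ρ : ℝ => -(a * ρ ^ (a - 1)) * Real.exp (-ρ ^ a)) _ ρ :=
    h1.mul (hasDerivAt_exp_neg_rpow a hρ)
  refine h.congr_deriv ?_
  rw [show a - 1 - 1 = a - 2 by ring]
  ring

/-- The smooth regularisation of the symbol `e^{-|ξ|^{2a}}`. -/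
def regSymbol (a ε : ℝ) (ξ : Plane) : ℝ := Real.exp (-regSq ε ξ ^ a)

theorem contDiff_regSymbol (a : ℝ) {ε : ℝ} (hε : 0 < ε) : ContDiff ℝ ∞ (regSymbol a ε) :=
  (((contDiff_regSq ε).rpow_const_of_ne fun ξ => (regSq_pos hε ξ).ne').neg).exp

theorem partialDeriv_regSymbol (a : ℝ) {ε : ℝ} (hε : 0 < ε) (k : Fin 2) (ξ : Plane) :
    partialDeriv k (regSymbol a ε) ξ = 8 * Real.pi ^ 2 * ξ k *
      (-(a * regSq ε ξ ^ (a - 1)) * regSymbol a ε ξ) :=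
  partialDeriv_comp_regSq (F' := fun ρ => -(a * ρ ^ (a - 1)) * Real.exp (-ρ ^ a))
    (hasDerivAt_exp_neg_rpow a (regSq_pos hε ξ)) k

theorem partialDeriv_one_zero_regSymbol (a : ℝ) {ε : ℝ} (hε : 0 < ε) (ξ : Plane) :
    partialDeriv 1 (partialDeriv 0 (regSymbol a ε)) ξ = (8 * Real.pi ^ 2 * ξ 0) *
      (8 * Real.pi ^ 2 * ξ 1 * ((a ^ 2 * (regSq ε ξ ^ (a - 1)) ^ 2 -
        a * (a - 1) * regSq ε ξ ^ (a - 2)) * regSymbol a ε ξ)) := by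
  have hF := hasDerivAt_deriv_exp_neg_rpow a (regSq_pos hε ξ)
  have h1 : DifferentiableAt ℝ (fun ξ : Plane => 8 * Real.pi ^ 2 * ξ 0) ξ :=
    (hasFDerivAt_apply_plane 0 ξ).differentiableAt.const_mul _
  have h2 : DifferentiableAt ℝ (fun ξ => (fun ρ : ℝ => -(a * ρ ^ (a - 1)) * Real.exp (-ρ ^ a))
      (regSq ε ξ)) ξ :=
    hF.differentiableAt.comp ξ ((contDiff_regSq ε).differentiable (by simp) ξ)
  have h3 : partialDeriv 1 (fun ξ : Plane => 8 * Real.pi ^ 2 * ξ 0) ξ = 0 := by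
    have h : HasFDerivAt (fun ξ : Plane => 8 * Real.pi ^ 2 * ξ 0) _ ξ :=
      (hasFDerivAt_apply_plane 0 ξ).const_mul (8 * Real.pi ^ 2)
    rw [partialDeriv, h.fderiv]
    simp [basisVec]
  have h : HasFDerivAt (fun ξ : Plane => 8 * Real.pi ^ 2 * ξ 0 *
      (fun ρ : ℝ => -(a * ρ ^ (a - 1)) * Real.exp (-ρ ^ a)) (regSq ε ξ)) _ ξ :=
    h1.hasFDerivAt.mul h2.hasFDerivAt
  rw [show partialDeriv 0 (regSymbol a ε) = _ from funext (partialDeriv_regSymbol a hε 0),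
    partialDeriv]
  erw [h.fderiv]
  have h4 := partialDeriv_comp_regSq (F' := fun ρ => (a ^ 2 * (ρ ^ (a - 1)) ^ 2 -
    a * (a - 1) * ρ ^ (a - 2)) * Real.exp (-ρ ^ a)) hF 1
  rw [add_apply, smul_apply, smul_apply]
  change _ * partialDeriv 1 _ ξ + _ * partialDeriv 1 _ ξ = _
  rw [h3, h4, mul_zero, add_zero]
  rfl

/-- A polynomial of the kind by which differentiation multiplies the symbol. -/
structure IsQuadraticSymbol (q : Plane → ℝ) : Prop where
  contDiff : ContDiff ℝ ∞ q
  le : ∀ ξ, |q ξ| ≤ ‖ξ‖ + ‖ξ‖ ^ 2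
  deriv_le : ∀ i ξ, |partialDeriv i q ξ| ≤ 2 * (1 + ‖ξ‖)
  deriv_deriv_le : ∀ ξ, |partialDeriv 1 (partialDeriv 0 q) ξ| ≤ 2

theorem isQuadraticSymbol_apply (k : Fin 2) : IsQuadraticSymbol fun ξ => ξ k := by
  have e : ∀ i, partialDeriv i (fun ξ : Plane => ξ k) = fun _ => if k = i then 1 else 0 :=
    fun i => funext (partialDeriv_apply k i)
  refine ⟨contDiff_apply_plane k, fun ξ => ?_, fun i ξ => ?_, fun ξ => ?_⟩
  · nlinarith [abs_apply_le_norm ξ k, sq_nonneg ‖ξ‖]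
  · have := norm_nonneg ξ
    rw [e]
    split_ifs <;> simp <;> linarith
  · rw [e, partialDeriv, fderiv_const_apply]
    simp

theorem isQuadraticSymbol_apply_mul_apply (k l : Fin 2) :
    IsQuadraticSymbol fun ξ => ξ k * ξ l := by
  have hd := fun k => (contDiff_apply_plane k).differentiable (by simp)
  have e : ∀ i, partialDeriv i (fun ξ : Plane => ξ k * ξ l) =
      fun ξ => ξ k * (if l = i then 1 else 0) + ξ l * (if k = i then 1 else 0) := fun i => by
    funext ξ
    rw [partialDeriv_mul (hd k) (hd l), partialDeriv_apply, partialDeriv_apply]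
  refine ⟨(contDiff_apply_plane k).mul (contDiff_apply_plane l), fun ξ => ?_, fun i ξ => ?_,
    fun ξ => ?_⟩
  · rw [abs_mul]
    nlinarith [abs_apply_le_norm ξ k, abs_apply_le_norm ξ l, norm_nonneg ξ, abs_nonneg (ξ k),
      abs_nonneg (ξ l)]
  · have h1 := abs_apply_le_norm ξ k
    have h2 := abs_apply_le_norm ξ l
    have := norm_nonneg ξ
    rw [e]
    refine (abs_add_le _ _).trans ?_
    rw [abs_mul, abs_mul]
    split_ifs <;> simp <;> linarith
  · have h : HasFDerivAt (fun ξ : Plane => ξ k * (if l = 0 then (1 : ℝ) else 0) +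
        ξ l * (if k = 0 then (1 : ℝ) else 0)) _ ξ :=
      ((hasFDerivAt_apply_plane k ξ).mul_const _).add ((hasFDerivAt_apply_plane l ξ).mul_const _)
    rw [e, partialDeriv, h.fderiv]
    fin_cases k <;> fin_cases l <;> simp [basisVec]

/-! ### Bounds for the regularised symbols -/

/-- The constant in the bounds for the regularised symbols. -/
def symbolConst : ℝ := 14000 * (Real.exp 1 * (2 ^ 4 * 24 * Real.exp (1 / 2)))

/-- The fourth power and the number 14000 are chosen to dominate the symbol, its first derivatives
and its mixed second derivative together; the largest of the totals met below is 13122. -/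
theorem regSymbol_weight_le {a ε : ℝ} (ha : 1 / 2 ≤ a) (hε : 0 < ε) (ξ : Plane) :
    14000 * ((1 + √(regSq ε ξ)) ^ 4 * regSymbol a ε ξ) ≤ symbolConst * heatSymbol 1 (1 / 2) ξ := by
  have h1 := one_add_sqrt_pow_mul_exp_neg_rpow_le ha (regSq_pos hε ξ)
  have h2 : 2 * Real.pi * ‖ξ‖ ≤ √(regSq ε ξ) := by
    refine Real.le_sqrt_of_sq_le ?_
    unfold regSq
    nlinarith
  have h3 : Real.exp (-(√(regSq ε ξ) / 2)) ≤ heatSymbol 1 (1 / 2) ξ := by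
    unfold heatSymbol
    rw [Real.rpow_one]
    exact Real.exp_le_exp.2 (by linarith)
  rw [symbolConst, mul_assoc]
  refine mul_le_mul_of_nonneg_left (h1.trans ?_) (by norm_num)
  gcongr

theorem norm_le_sqrt_regSq {ε : ℝ} (hε : 0 < ε) (ξ : Plane) : ‖ξ‖ ≤ √(regSq ε ξ) := by
  refine Real.le_sqrt_of_sq_le ?_
  unfold regSq
  nlinarith [Real.pi_gt_three, sq_nonneg ‖ξ‖, mul_nonneg (sq_nonneg ‖ξ‖) Real.pi_pos.le]

/-- The exponent `a - 1/2` of the product lies in `[0, 1/2]`: the product is at most 1 for `ρ ≤ 1`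
and at most `√ρ` beyond. -/
theorem rpow_sub_one_mul_sqrt_le {a ρ : ℝ} (ha : 1 / 2 ≤ a) (ha1 : a ≤ 1) (hρ : 0 < ρ) :
    ρ ^ (a - 1) * √ρ ≤ 1 + √ρ := by
  rw [Real.sqrt_eq_rpow, ← Real.rpow_add hρ]
  have h0 : 0 ≤ ρ ^ (1 / 2 : ℝ) := by positivity
  by_cases h : ρ ≤ 1
  · have := Real.rpow_le_one hρ.le h (z := a - 1 + 1 / 2) (by linarith)
    linarith
  · have := Real.rpow_le_rpow_of_exponent_le (not_le.1 h).le (y := a - 1 + 1 / 2) (z := 1 / 2)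
      (by linarith)
    linarith

theorem eight_pi_sq_le : 8 * Real.pi ^ 2 ≤ 80 := by
  nlinarith [Real.pi_lt_d2, Real.pi_pos]

theorem abs_partialDeriv_regSymbol_le {a ε : ℝ} (ha : 1 / 2 ≤ a) (ha1 : a ≤ 1) (hε : 0 < ε)
    (k : Fin 2) (ξ : Plane) :
    |partialDeriv k (regSymbol a ε) ξ| ≤ 80 * (1 + √(regSq ε ξ)) * regSymbol a ε ξ := by
  have hρ := regSq_pos hε ξ
  have hE : 0 < regSymbol a ε ξ := Real.exp_pos _
  have hv : 0 < regSq ε ξ ^ (a - 1) := by positivity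
  rw [partialDeriv_regSymbol a hε, abs_mul, abs_mul (8 * Real.pi ^ 2), abs_mul (-_), abs_neg,
    abs_mul a, abs_of_pos hE, abs_of_pos hv, abs_of_pos (show 0 < 8 * Real.pi ^ 2 by positivity),
    abs_of_pos (show 0 < a by linarith)]
  have h1 := (abs_apply_le_norm ξ k).trans (norm_le_sqrt_regSq hε ξ)
  calc _ ≤ 80 * √(regSq ε ξ) * (1 * regSq ε ξ ^ (a - 1) * regSymbol a ε ξ) := by
        gcongr
        exact eight_pi_sq_le
    _ = 80 * (regSq ε ξ ^ (a - 1) * √(regSq ε ξ)) * regSymbol a ε ξ := by ring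
    _ ≤ _ := by
        gcongr
        exact rpow_sub_one_mul_sqrt_le ha ha1 hρ

/-- For `a = 1/2` the mixed derivative of `e^{-|ξ|}` behaves like `1/|ξ|` at the origin, so a bound
uniform in `ε` needs the extra factor `√ρ`. That factor will come from the polynomial `q`, which
vanishes at the origin: the method serves the derivatives of the heat kernel, not the kernel itself.
-/
theorem abs_partialDeriv_one_zero_regSymbol_mul_le {a ε : ℝ} (ha : 1 / 2 ≤ a) (ha1 : a ≤ 1)
    (hε : 0 < ε) (ξ : Plane) :
    √(regSq ε ξ) * |partialDeriv 1 (partialDeriv 0 (regSymbol a ε)) ξ| ≤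
      12800 * (1 + √(regSq ε ξ)) ^ 3 * regSymbol a ε ξ := by
  have hρ := regSq_pos hε ξ
  have hE : 0 < regSymbol a ε ξ := Real.exp_pos _
  have hv : 0 < regSq ε ξ ^ (a - 1) := by positivity
  have hw : 0 < regSq ε ξ ^ (a - 2) := by positivity
  have hwv : regSq ε ξ ^ (a - 2) * √(regSq ε ξ) ^ 2 = regSq ε ξ ^ (a - 1) := by
    rw [Real.sq_sqrt hρ.le, ← Real.rpow_add_one hρ.ne']
    congr 1
    ring
  have h0 := (abs_apply_le_norm ξ 0).trans (norm_le_sqrt_regSq hε ξ)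
  have h1 := (abs_apply_le_norm ξ 1).trans (norm_le_sqrt_regSq hε ξ)
  have hy := rpow_sub_one_mul_sqrt_le ha ha1 hρ
  have hp : 0 < 8 * Real.pi ^ 2 := by positivity
  rw [partialDeriv_one_zero_regSymbol a hε, abs_mul,
    abs_mul (8 * Real.pi ^ 2) (ξ 0), abs_mul (8 * Real.pi ^ 2 * ξ 1),
    abs_mul (8 * Real.pi ^ 2) (ξ 1), abs_mul _ (regSymbol a ε ξ), abs_of_pos hE, abs_of_pos hp]
  have hx := Real.sqrt_nonneg (regSq ε ξ)
  set x := √(regSq ε ξ)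
  set v := regSq ε ξ ^ (a - 1)
  set w := regSq ε ξ ^ (a - 2)
  have hvw : |a ^ 2 * v ^ 2 - a * (a - 1) * w| ≤ v ^ 2 + w := by
    rw [abs_le]
    have e1 : a ^ 2 * v ^ 2 ≤ 1 * v ^ 2 := by gcongr; nlinarith
    have e2 : a * (1 - a) * w ≤ 1 * w := by gcongr; nlinarith
    have e3 : 0 ≤ a * (1 - a) * w :=
      mul_nonneg (mul_nonneg (by linarith) (by linarith)) hw.le
    have e4 : 0 ≤ a ^ 2 * v ^ 2 := by positivity
    constructor <;> nlinarith
  calc x * (8 * Real.pi ^ 2 * |ξ 0| * (8 * Real.pi ^ 2 * |ξ 1| *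
        (|a ^ 2 * v ^ 2 - a * (a - 1) * w| * regSymbol a ε ξ)))
      ≤ x * (80 * x * (80 * x * ((v ^ 2 + w) * regSymbol a ε ξ))) := by
        gcongr <;> exact eight_pi_sq_le
    _ = 6400 * (x * (v * x) ^ 2 + x * (w * x ^ 2)) * regSymbol a ε ξ := by ring
    _ = 6400 * (x * (v * x) ^ 2 + v * x) * regSymbol a ε ξ := by rw [hwv, mul_comm x v]
    _ ≤ 6400 * ((1 + x) * (1 + x) ^ 2 + (1 + x) ^ 3) * regSymbol a ε ξ := by
        have e5 : v * x ≤ (1 + x) ^ 3 := hy.trans (le_self_pow₀ (by linarith) (by norm_num))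
        have e6 : 0 ≤ v * x := by positivity
        gcongr
        linarith
    _ = _ := by ring

/-- The right-hand side does not depend on `ε`, so the bound survives the limit `ε → 0` through
Fatou's lemma. -/
theorem IsQuadraticSymbol.lintegral_enorm_fourier_regSymbol_le {q : Plane → ℝ}
    (hq : IsQuadraticSymbol q) {a ε : ℝ} (ha : 1 / 2 ≤ a) (ha1 : a ≤ 1) (hε : 0 < ε) :
    ∫⁻ x, ‖𝓕 (fun ξ => ((q ξ * regSymbol a ε ξ : ℝ) : ℂ)) x‖ₑ ≤ eLpNorm besselWeight 2 *
      eLpNorm (fun ξ => 4 * symbolConst * heatSymbol 1 (1 / 2) ξ) 2 := by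
  have hE := contDiff_regSymbol a hε
  have hdE := hE.differentiable (by simp)
  have hdq := hq.contDiff.differentiable (by simp)
  have key := regSymbol_weight_le ha hε
  have hx := fun ξ => norm_le_sqrt_regSq hε ξ
  have hE0 : ∀ ξ, 0 < regSymbol a ε ξ := fun ξ => Real.exp_pos _
  have e1 : ∀ k, partialDeriv k (fun ξ => q ξ * regSymbol a ε ξ) = fun ξ =>
      q ξ * partialDeriv k (regSymbol a ε) ξ + regSymbol a ε ξ * partialDeriv k q ξ :=
    fun k => funext fun ξ => partialDeriv_mul hdq hdE k ξ
  have hd1 := fun k => (contDiff_partialDeriv hE k).differentiable (by simp)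
  have hd2 := fun k => (contDiff_partialDeriv hq.contDiff k).differentiable (by simp)
  refine lintegral_enorm_fourier_le (hq.contDiff.mul hE) (fun ξ => ?_) (fun k ξ => ?_)
    fun ξ => ?_
  · refine le_trans ?_ (key ξ)
    rw [abs_mul, abs_of_pos (hE0 ξ), ← mul_assoc]
    refine mul_le_mul_of_nonneg_right ((hq.le ξ).trans ?_) (hE0 ξ).le
    have h0 := norm_nonneg ξ
    have h1 := hx ξ
    generalize √(regSq ε ξ) = x at *
    calc ‖ξ‖ + ‖ξ‖ ^ 2 ≤ x + x ^ 2 := by gcongr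
      _ ≤ (1 + x) ^ 2 := by nlinarith
      _ ≤ (1 + x) ^ 4 := pow_le_pow_right₀ (by linarith) (by norm_num)
      _ ≤ _ := by
        have : 0 ≤ (1 + x) ^ 4 := by positivity
        linarith
  · refine le_trans ?_ (key ξ)
    rw [e1]
    refine (abs_add_le _ _).trans ?_
    rw [abs_mul, abs_mul, abs_of_pos (hE0 ξ)]
    have h0 := norm_nonneg ξ
    have h1 := hx ξ
    have h2 := hE0 ξ
    have h3 := abs_partialDeriv_regSymbol_le ha ha1 hε k ξ
    have h4 := hq.le ξ
    have h5 := hq.deriv_le k ξ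
    generalize √(regSq ε ξ) = x at *
    generalize regSymbol a ε ξ = E at *
    have hx0 : 0 ≤ x := h0.trans h1
    have h6 : |q ξ| ≤ (1 + x) ^ 2 := h4.trans (by nlinarith)
    have h7 : |partialDeriv k q ξ| ≤ 2 * (1 + x) := h5.trans (by linarith)
    calc _ ≤ (1 + x) ^ 2 * (80 * (1 + x) * E) + E * (2 * (1 + x)) := by gcongr
      _ = (80 * (1 + x) ^ 3 + 2 * (1 + x) ^ 1) * E := by ring
      _ ≤ (80 * (1 + x) ^ 4 + 2 * (1 + x) ^ 4) * E := by
          gcongr <;> first | linarith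
      _ ≤ _ := by
          have : 0 ≤ (1 + x) ^ 4 * E := by positivity
          linarith
  · refine le_trans ?_ (key ξ)
    rw [e1, partialDeriv_add (f := fun ξ => q ξ * partialDeriv 0 (regSymbol a ε) ξ)
        (g := fun ξ => regSymbol a ε ξ * partialDeriv 0 q ξ) (hdq.mul (hd1 0)) (hdE.mul (hd2 0)), partialDeriv_mul hdq (hd1 0),
      partialDeriv_mul hdE (hd2 0)]
    have h0 := norm_nonneg ξ
    have h1 := hx ξ
    have h2 := hE0 ξ
    have h3 := fun k => abs_partialDeriv_regSymbol_le ha ha1 hε k ξ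
    have h4 := hq.le ξ
    have h5 := fun k => hq.deriv_le k ξ
    have h8 := abs_partialDeriv_one_zero_regSymbol_mul_le ha ha1 hε ξ
    have h9 := hq.deriv_deriv_le ξ
    refine (abs_add_le _ _).trans ((add_le_add (abs_add_le _ _) (abs_add_le _ _)).trans ?_)
    simp only [abs_mul]
    rw [abs_of_pos (hE0 ξ)]
    generalize √(regSq ε ξ) = x at *
    generalize hG : |partialDeriv 1 (partialDeriv 0 (regSymbol a ε)) ξ| = G at *
    generalize regSymbol a ε ξ = E at *
    have hG0 : 0 ≤ G := hG ▸ abs_nonneg _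
    have hx0 : 0 ≤ x := h0.trans h1
    -- The factor `x = √ρ` is kept here, to be paired with the singular mixed derivative `G`.
    have h6 : |q ξ| ≤ x * (1 + x) := h4.trans (by nlinarith)
    have h7 : ∀ k, |partialDeriv k q ξ| ≤ 2 * (1 + x) := fun k => (h5 k).trans (by linarith)
    calc _ ≤ x * (1 + x) * G + 80 * (1 + x) * E * (2 * (1 + x)) +
          (E * 2 + 2 * (1 + x) * (80 * (1 + x) * E)) := by
          gcongr
          · exact h3 0
          · exact h7 1
          · exact h7 0
          · exact h3 1
      _ = (1 + x) * (x * G) + (320 * (1 + x) ^ 2 + 2) * E := by ring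
      _ ≤ (1 + x) * (12800 * (1 + x) ^ 3 * E) + (320 * (1 + x) ^ 4 + 2 * (1 + x) ^ 4) * E := by
          have e2 : 1 ≤ (1 + x) ^ 4 := one_le_pow₀ (by linarith)
          gcongr
          · linarith
          · norm_num
          · linarith
      _ = 13122 * ((1 + x) ^ 4 * E) := by ring
      _ ≤ _ := by
          have : 0 ≤ (1 + x) ^ 4 * E := by positivity
          linarith

theorem regSymbol_le {a ε : ℝ} (ha : 1 / 2 ≤ a) (hε : 0 < ε) (ξ : Plane) :
    (1 + ‖ξ‖) ^ 2 * regSymbol a ε ξ ≤ symbolConst * heatSymbol 1 (1 / 2) ξ := by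
  refine le_trans ?_ (regSymbol_weight_le ha hε ξ)
  have h1 := norm_le_sqrt_regSq hε ξ
  have h0 := norm_nonneg ξ
  have h2 : 0 < regSymbol a ε ξ := Real.exp_pos _
  have h3 : 0 ≤ (1 + √(regSq ε ξ)) ^ 4 := by positivity
  rw [← mul_assoc]
  refine mul_le_mul_of_nonneg_right ?_ h2.le
  calc (1 + ‖ξ‖) ^ 2 ≤ (1 + √(regSq ε ξ)) ^ 2 := by gcongr
    _ ≤ (1 + √(regSq ε ξ)) ^ 4 := pow_le_pow_right₀ (by linarith) (by norm_num)
    _ ≤ _ := by linarith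

theorem tendsto_regSymbol {α : ℝ} (hα : 0 < α) (ξ : Plane) :
    Tendsto (fun n : ℕ => regSymbol (α / 2) (1 / ((n : ℝ) + 1)) ξ) atTop
      (𝓝 (heatSymbol α 1 ξ)) := by
  have h1 : Tendsto (fun n : ℕ => regSq (1 / ((n : ℝ) + 1)) ξ) atTop
      (𝓝 ((2 * Real.pi * ‖ξ‖) ^ 2)) := by
    have := (tendsto_one_div_add_atTop_nhds_zero_nat (𝕜 := ℝ)).const_add
      ((2 * Real.pi) ^ 2 * ‖ξ‖ ^ 2)
    rw [add_zero, ← mul_pow] at this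
    simpa only [regSq, mul_pow] using this
  have h2 := (h1.rpow_const (p := α / 2) (Or.inr (by positivity))).neg.rexp
  have e : heatSymbol α 1 ξ = Real.exp (-((2 * Real.pi * ‖ξ‖) ^ 2) ^ (α / 2)) := by
    rw [heatSymbol, ← Real.rpow_natCast, ← Real.rpow_mul (by positivity), neg_one_mul]
    congr 3
    push_cast
    ring
  rw [e]
  exact h2

/-- The `L¹` norm of the inverse Fourier transform is lower semicontinuous. -/
theorem lintegral_enorm_fourierInv_le_of_tendsto {m : ℕ → Plane → ℂ} {m' : Plane → ℂ}
    {g : Plane → ℝ} {B : ℝ≥0∞} (hm : ∀ n, Continuous (m n)) (hg : Integrable g)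
    (hle : ∀ n ξ, ‖m n ξ‖ ≤ g ξ) (hlim : ∀ ξ, Tendsto (fun n => m n ξ) atTop (𝓝 (m' ξ)))
    (hB : ∀ n, ∫⁻ x, ‖𝓕 (m n) x‖ₑ ≤ B) : ∫⁻ x, ‖𝓕⁻ m' x‖ₑ ≤ B := by
  have hin : ∀ n, Integrable (m n) :=
    fun n => hg.mono' (hm n).aestronglyMeasurable (Eventually.of_forall (hle n))
  have hlim : ∀ x, Tendsto (fun n => 𝓕 (m n) x) atTop (𝓝 (𝓕 m' x)) := fun x => by
    simp only [Real.fourier_eq]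
    refine tendsto_integral_of_dominated_convergence _
      (fun n => ((Real.fourierIntegral_convergent_iff x).2 (hin n)).1) hg
      (fun n => Eventually.of_forall fun ξ => ?_) (Eventually.of_forall fun ξ => ?_)
    · rw [Circle.norm_smul]
      exact hle n ξ
    · exact (hlim ξ).const_smul _
  simp only [Real.fourierInv_eq_fourier_neg]
  rw [lintegral_neg_eq_self (fun x => ‖𝓕 m' x‖ₑ)]
  calc ∫⁻ x, ‖𝓕 m' x‖ₑ
      = ∫⁻ x, liminf (fun n => ‖𝓕 (m n) x‖ₑ) atTop :=
        lintegral_congr fun x => ((hlim x).enorm.liminf_eq).symm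
    _ ≤ liminf (fun n => ∫⁻ x, ‖𝓕 (m n) x‖ₑ) atTop :=
        lintegral_liminf_le fun n => (continuous_fourier_of_integrable (hin n)).measurable.enorm
    _ ≤ liminf (fun _ : ℕ => B) atTop := liminf_le_liminf (Eventually.of_forall hB)
    _ = B := liminf_const _

/-- The inverse Fourier transforms of the symbols of derivatives of the heat kernel are
integrable. -/
theorem IsQuadraticSymbol.lintegral_enorm_fourierInv_heatSymbol_lt_top {q : Plane → ℝ}
    (hq : IsQuadraticSymbol q) {α : ℝ} (hα1 : 1 ≤ α) (hα2 : α ≤ 2) :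
    ∫⁻ x, ‖𝓕⁻ (fun ξ => ((q ξ * heatSymbol α 1 ξ : ℝ) : ℂ)) x‖ₑ < ⊤ := by
  have hε : ∀ n : ℕ, 0 < 1 / ((n : ℝ) + 1) := fun n => by positivity
  have ha : 1 / 2 ≤ α / 2 := by linarith
  have hle : ∀ (n : ℕ) ξ, ‖((q ξ * regSymbol (α / 2) (1 / ((n : ℝ) + 1)) ξ : ℝ) : ℂ)‖ ≤
      symbolConst * heatSymbol 1 (1 / 2) ξ := fun n ξ => by
    refine le_trans ?_ (regSymbol_le ha (hε n) ξ)
    have h0 : 0 < regSymbol (α / 2) (1 / ((n : ℝ) + 1)) ξ := Real.exp_pos _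
    rw [Complex.norm_real, norm_mul, Real.norm_eq_abs, Real.norm_of_nonneg h0.le]
    refine mul_le_mul_of_nonneg_right ((hq.le ξ).trans ?_) h0.le
    nlinarith [norm_nonneg ξ]
  have hB := memLp_besselWeight.2
  have hS := (memLp_two_heatSymbol.const_mul (4 * symbolConst)).2
  have hint : Integrable fun ξ => symbolConst * heatSymbol 1 (1 / 2) ξ :=
    (integrable_heatSymbol one_pos (by norm_num)).const_mul _
  have hcn : ∀ n : ℕ, Continuous fun ξ : Plane =>
      ((q ξ * regSymbol (α / 2) (1 / ((n : ℝ) + 1)) ξ : ℝ) : ℂ) := fun n =>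
    Complex.continuous_ofReal.comp
      (hq.contDiff.continuous.mul (contDiff_regSymbol _ (hε n)).continuous)
  refine lt_of_le_of_lt (lintegral_enorm_fourierInv_le_of_tendsto hcn hint hle (fun ξ => ?_)
    fun n => hq.lintegral_enorm_fourier_regSymbol_le ha (by linarith) (hε n))
    (ENNReal.mul_lt_top hB hS)
  exact (Complex.continuous_ofReal.tendsto _).comp
    ((tendsto_regSymbol (by linarith) ξ).const_mul (q ξ))

theorem enorm_re_le (z : ℂ) : ‖z.re‖ₑ ≤ ‖z‖ₑ := by
  simpa only [← ofReal_norm, Real.norm_eq_abs] using ENNReal.ofReal_le_ofReal (Complex.abs_re_le_norm z)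

theorem fourierInv_const_mul (c : ℂ) (m : Plane → ℂ) (x : Plane) :
    𝓕⁻ (fun ξ => c * m ξ) x = c * 𝓕⁻ m x := by
  simp only [Real.fourierInv_eq, ← integral_const_mul]
  congr 1 with ξ
  rw [mul_smul_comm]

theorem lintegral_enorm_partialDeriv_heatKernel_lt_top {α : ℝ} (hα1 : 1 ≤ α) (hα2 : α ≤ 2)
    (k : Fin 2) : ∫⁻ x, ‖partialDeriv k (heatKernel α 1) x‖ₑ < ⊤ := by
  refine lt_of_le_of_lt ?_ (ENNReal.mul_lt_top (a := ‖(2 * Real.pi * Complex.I)‖ₑ)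
    enorm_lt_top ((isQuadraticSymbol_apply k).lintegral_enorm_fourierInv_heatSymbol_lt_top
      hα1 hα2))
  rw [← lintegral_const_mul' _ _ enorm_ne_top]
  refine lintegral_mono fun x => ?_
  rw [partialDeriv_heatKernel (by linarith) one_pos, ← enorm_mul, ← fourierInv_const_mul]
  simp only [Complex.ofReal_mul, ← mul_assoc]
  exact enorm_re_le _

theorem lintegral_enorm_partialDeriv_partialDeriv_heatKernel_lt_top {α : ℝ} (hα1 : 1 ≤ α)
    (hα2 : α ≤ 2) (k l : Fin 2) :
    ∫⁻ x, ‖partialDeriv l (partialDeriv k (heatKernel α 1)) x‖ₑ < ⊤ := by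
  refine lt_of_le_of_lt ?_ (ENNReal.mul_lt_top (a := ‖(2 * Real.pi * Complex.I) ^ 2‖ₑ)
    enorm_lt_top
    ((isQuadraticSymbol_apply_mul_apply l k).lintegral_enorm_fourierInv_heatSymbol_lt_top
      hα1 hα2))
  rw [← lintegral_const_mul' _ _ enorm_ne_top]
  refine lintegral_mono fun x => ?_
  rw [partialDeriv_partialDeriv_heatKernel (by linarith) one_pos, ← enorm_mul,
    ← fourierInv_const_mul]
  have e : (fun ξ : Plane => (2 * Real.pi * Complex.I) * (ξ l : ℂ) *
        ((2 * Real.pi * Complex.I) * (ξ k : ℂ) * (heatSymbol α 1 ξ : ℂ))) = fun ξ =>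
        (2 * Real.pi * Complex.I) ^ 2 * ((ξ l * ξ k * heatSymbol α 1 ξ : ℝ) : ℂ) := by
    funext ξ
    push_cast
    ring
  rw [e]
  exact enorm_re_le _

/-! ### The heat kernel of the square root of the Laplacian is integrable -/

theorem image_sub_div_Ioi {c : ℝ} (hc : 0 < c) :
    (fun u : ℝ => u - c / u) '' Set.Ioi 0 = Set.univ := by
  refine Set.eq_univ_of_forall fun w => ⟨(w + √(w ^ 2 + 4 * c)) / 2, ?_, ?_⟩
  · have h : |w| < √(w ^ 2 + 4 * c) := by
      rw [← Real.sqrt_sq_eq_abs]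
      exact Real.sqrt_lt_sqrt (sq_nonneg w) (by linarith)
    have := neg_abs_le w
    exact Set.mem_Ioi.2 (by linarith)
  · have h : |w| < √(w ^ 2 + 4 * c) := by
      rw [← Real.sqrt_sq_eq_abs]
      exact Real.sqrt_lt_sqrt (sq_nonneg w) (by linarith)
    have h0 := neg_abs_le w
    have h1 : w + √(w ^ 2 + 4 * c) ≠ 0 := by linarith
    have h2 := Real.sq_sqrt (show 0 ≤ w ^ 2 + 4 * c by positivity)
    field_simp
    nlinarith

theorem image_div_Ioi {c : ℝ} (hc : 0 < c) :
    (fun u : ℝ => c / u) '' Set.Ioi 0 = Set.Ioi 0 := by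
  ext w
  constructor
  · rintro ⟨u, hu, rfl⟩
    exact div_pos hc hu
  · intro hw
    exact ⟨c / w, div_pos hc hw, div_div_cancel₀ hc.ne'⟩

/-- The Cauchy–Schlömilch substitution: `w = u - c/u` maps the half-line bijectively onto `ℝ` with
`dw = (1 + c/u²) du`, and `u ↦ c/u` exchanges the two parts of this measure, so each carries half of
the Gaussian integral. -/
theorem integral_exp_neg_sub_div_sq {c : ℝ} (hc : 0 < c) :
    2 * ∫ u in Set.Ioi (0 : ℝ), Real.exp (-(u - c / u) ^ 2) = √Real.pi := by
  let G : ℝ → ℝ := fun u => Real.exp (-(u - c / u) ^ 2)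
  have hd : ∀ u ∈ Set.Ioi (0 : ℝ), HasDerivWithinAt (fun u : ℝ => u - c / u) (1 + c / u ^ 2)
      (Set.Ioi 0) u := fun u hu => by
    have hu : 0 < u := hu
    have h : HasDerivAt (fun u : ℝ => u - c * u⁻¹) _ u :=
      (hasDerivAt_id u).sub ((hasDerivAt_inv hu.ne').const_mul c)
    refine (h.congr_deriv ?_).hasDerivWithinAt
    field_simp
    ring
  have hinj : Set.InjOn (fun u : ℝ => u - c / u) (Set.Ioi 0) := fun u hu v hv h => by
    have hu : 0 < u := hu
    have hv : 0 < v := hv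
    simp only at h
    field_simp at h
    have h1 : (u - v) * (u * v + c) = 0 := by linear_combination h
    rcases mul_eq_zero.1 h1 with h2 | h2
    · linarith
    · have : 0 < u * v + c := by positivity
      linarith
  have hd' : ∀ u ∈ Set.Ioi (0 : ℝ), HasDerivWithinAt (fun u : ℝ => c / u) (-(c / u ^ 2))
      (Set.Ioi 0) u := fun u hu => by
    have hu : 0 < u := hu
    have h : HasDerivAt (fun u : ℝ => c * u⁻¹) _ u := (hasDerivAt_inv hu.ne').const_mul c
    refine (h.congr_deriv ?_).hasDerivWithinAt
    field_simp
  have hinj' : Set.InjOn (fun u : ℝ => c / u) (Set.Ioi 0) := fun u hu v hv h => by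
    have hu : 0 < u := hu
    have hv : 0 < v := hv
    simp only at h
    field_simp at h
    linarith
  have h1 := integral_image_eq_integral_abs_deriv_smul measurableSet_Ioi hd hinj
    (fun w => Real.exp (-w ^ 2))
  have h2 := integral_image_eq_integral_abs_deriv_smul measurableSet_Ioi hd' hinj' G
  have hi0 : Integrable fun w : ℝ => Real.exp (-w ^ 2) := by
    simpa using integrable_exp_neg_mul_sq one_pos
  have h3 := (integrableOn_image_iff_integrableOn_abs_deriv_smul measurableSet_Ioi hd hinj
    (fun w => Real.exp (-w ^ 2))).1 hi0.integrableOn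
  rw [image_sub_div_Ioi hc, setIntegral_univ] at h1
  rw [image_div_Ioi hc] at h2
  have hpi : ∫ w : ℝ, Real.exp (-w ^ 2) = √Real.pi := by
    simpa using integral_gaussian 1
  have hG : ∀ u ∈ Set.Ioi (0 : ℝ), |-(c / u ^ 2)| • G (c / u) = c / u ^ 2 * G u := fun u hu => by
    have hu : 0 < u := hu
    rw [abs_neg, abs_of_pos (by positivity), smul_eq_mul]
    simp only [G]
    rw [div_div_cancel₀ hc.ne', ← neg_sub u, neg_sq]
  have hH : ∀ u ∈ Set.Ioi (0 : ℝ), |1 + c / u ^ 2| • Real.exp (-(u - c / u) ^ 2) =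
      G u + c / u ^ 2 * G u := fun u hu => by
    have hu : 0 < u := hu
    rw [abs_of_pos (by positivity), smul_eq_mul, add_mul, one_mul]
  rw [setIntegral_congr_fun measurableSet_Ioi hG] at h2
  rw [setIntegral_congr_fun measurableSet_Ioi hH] at h1
  rw [integrableOn_congr_fun hH measurableSet_Ioi] at h3
  have hGm : Measurable G := by
    simp only [G]
    fun_prop
  have hGi : IntegrableOn G (Set.Ioi 0) := by
    refine Integrable.mono' h3 hGm.aestronglyMeasurable ?_
    filter_upwards [ae_restrict_mem measurableSet_Ioi] with u hu
    have hu : 0 < u := hu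
    have h0 : 0 < G u := Real.exp_pos _
    rw [Real.norm_of_nonneg h0.le]
    exact le_add_of_nonneg_right (by positivity)
  have hGi' : IntegrableOn (fun u => c / u ^ 2 * G u) (Set.Ioi 0) := by
    have := h3.sub hGi
    refine this.congr (Eventually.of_forall fun u => ?_)
    simp
  rw [integral_add hGi hGi', ← h2, hpi] at h1
  linarith

/-- Completing the square, `u² + c²/u² = (u - c/u)² + 2c`. This is the subordination of the Poisson
kernel to the Gaussians. -/
theorem integral_exp_neg_sq_sub_div_sq {c : ℝ} (hc : 0 ≤ c) :
    ∫ u in Set.Ioi (0 : ℝ), 2 / √Real.pi * Real.exp (-u ^ 2) * Real.exp (-(c / u) ^ 2) =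
      Real.exp (-(2 * c)) := by
  have hπ : 0 < √Real.pi := Real.sqrt_pos.2 Real.pi_pos
  rcases hc.eq_or_lt with rfl | hc
  · have h := integral_gaussian_Ioi 1
    simp only [div_one, neg_mul, one_mul] at h
    simp only [zero_div, ne_eq, OfNat.ofNat_ne_zero, not_false_eq_true, zero_pow, neg_zero,
      Real.exp_zero, mul_one, mul_zero]
    rw [integral_const_mul, h]
    field_simp
  · have h := integral_exp_neg_sub_div_sq hc
    have e : ∀ u ∈ Set.Ioi (0 : ℝ), 2 / √Real.pi * Real.exp (-u ^ 2) * Real.exp (-(c / u) ^ 2) =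
        (2 / √Real.pi * Real.exp (-(2 * c))) * Real.exp (-(u - c / u) ^ 2) := fun u hu => by
      have hu : 0 < u := hu
      rw [mul_assoc, mul_assoc, ← Real.exp_add, ← Real.exp_add]
      congr 2
      field_simp
      ring
    rw [setIntegral_congr_fun measurableSet_Ioi e, integral_const_mul]
    rw [show ∫ u in Set.Ioi (0 : ℝ), Real.exp (-(u - c / u) ^ 2) = √Real.pi / 2 by linarith]
    field_simp

theorem heatSymbol_one_one (ξ : Plane) : heatSymbol 1 1 ξ =
    ∫ u in Set.Ioi (0 : ℝ), 2 / √Real.pi * Real.exp (-u ^ 2) *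
      gaussian (Real.pi / u ^ 2) ξ := by
  rw [heatSymbol, Real.rpow_one,
    show -1 * (2 * Real.pi * ‖ξ‖) = -(2 * (Real.pi * ‖ξ‖)) by ring,
    ← integral_exp_neg_sq_sub_div_sq (by positivity)]
  refine setIntegral_congr_fun measurableSet_Ioi fun u hu => ?_
  have hu : 0 < u := hu
  simp only [gaussian]
  congr 3
  field_simp

theorem fourierInv_gaussian {s : ℝ} (hs : 0 < s) (x : Plane) :
    𝓕⁻ (fun ξ => (gaussian s ξ : ℂ)) x = ((s⁻¹ * gaussian s⁻¹ x : ℝ) : ℂ) := by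
  rw [Real.fourierInv_eq_fourier_neg, fourier_gaussian_plane hs, norm_neg, gaussian]
  congr 3
  field_simp

theorem lintegral_enorm_fourierInv_gaussian {s : ℝ} (hs : 0 < s) :
    ∫⁻ x, ‖𝓕⁻ (fun ξ => (gaussian s ξ : ℂ)) x‖ₑ = 1 := by
  have h1 : ∫ z, gaussian s⁻¹ z = s := by
    have h := fourier_gaussian_plane (inv_pos.2 hs) 0
    simp only [Real.fourier_eq, inner_zero_right, neg_zero, AddChar.map_zero_eq_one, one_smul,
      norm_zero] at h
    rw [integral_complex_ofReal] at h
    have := Complex.ofReal_injective h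
    simpa using this
  have h2 : ∀ x, 0 ≤ s⁻¹ * gaussian s⁻¹ x := fun x => by
    unfold gaussian; positivity
  simp only [fourierInv_gaussian hs, ← ofReal_norm, Complex.norm_real,
    Real.norm_of_nonneg (h2 _)]
  rw [← ofReal_integral_eq_lintegral_ofReal ((integrable_gaussian (inv_pos.2 hs)).const_mul _)
    (Eventually.of_forall h2), integral_const_mul, h1, inv_mul_cancel₀ hs.ne', ENNReal.ofReal_one]

/-- By subordination the kernel is a superposition, with weights `w` of finite total mass, of
inverse transforms of Gaussians, each of `L¹` norm 1. The bound is needed for `α = 1` only, where no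
derivative falls on the kernel at late times. -/
theorem lintegral_enorm_heatKernel_one_lt_top : ∫⁻ x, ‖heatKernel 1 1 x‖ₑ < ⊤ := by
  let w : ℝ → ℝ := fun u => 2 / √Real.pi * Real.exp (-u ^ 2)
  have hw0 : ∀ u, 0 ≤ w u := fun u => by positivity
  have hwc : Continuous w := by fun_prop
  have hwi : Integrable w := by
    have : Integrable fun w : ℝ => Real.exp (-w ^ 2) := by
      simpa using integrable_exp_neg_mul_sq one_pos
    exact this.const_mul _
  have hg1 : ∀ s ξ, 0 ≤ s → gaussian s ξ ≤ 1 := fun s ξ hs => by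
    refine Real.exp_le_one_iff.2 ?_
    have : 0 ≤ Real.pi * s * ‖ξ‖ ^ 2 := by positivity
    linarith
  have hgm : Measurable fun p : Plane × ℝ => gaussian (Real.pi / p.2 ^ 2) p.1 := by
    unfold gaussian
    fun_prop
  have key : ∀ x, ‖heatKernel 1 1 x‖ₑ ≤ ∫⁻ u in Set.Ioi (0 : ℝ),
      ENNReal.ofReal (w u) * ‖𝓕⁻ (fun ξ => (gaussian (Real.pi / u ^ 2) ξ : ℂ)) x‖ₑ := fun x => by
    let K : Plane → ℝ → ℂ := fun ξ u =>
      (Real.fourierChar (inner ℝ ξ x) : ℂ) * ((w u * gaussian (Real.pi / u ^ 2) ξ : ℝ) : ℂ)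
    have hKm : Measurable (Function.uncurry K) := by
      have h1 : Continuous fun p : Plane × ℝ => (Real.fourierChar (inner ℝ p.1 x) : ℂ) :=
        continuous_subtype_val.comp
          (Real.continuous_fourierChar.comp (continuous_fst.inner continuous_const))
      exact h1.measurable.mul
        (Complex.measurable_ofReal.comp ((hwc.measurable.comp measurable_snd).mul hgm))
    have hn : ∀ ξ u, ‖K ξ u‖ = w u * gaussian (Real.pi / u ^ 2) ξ := fun ξ u => by
      simp only [K]
      rw [norm_mul, Circle.norm_coe, one_mul, Complex.norm_real]
      exact Real.norm_of_nonneg (mul_nonneg (hw0 u) (Real.exp_pos _).le)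
    -- Integrating the modulus in `u` reproduces `heatSymbol 1 1`, which is integrable.
    have hKi : Integrable (Function.uncurry K) (volume.prod (volume.restrict (Set.Ioi 0))) := by
      rw [integrable_prod_iff hKm.aestronglyMeasurable]
      refine ⟨Eventually.of_forall fun ξ => ?_, ?_⟩
      · refine hwi.integrableOn.mono' (hKm.comp measurable_prodMk_left).aestronglyMeasurable
          (Eventually.of_forall fun u => ?_)
        change ‖K ξ u‖ ≤ _
        rw [hn]
        exact mul_le_of_le_one_right (hw0 u) (hg1 _ _ (by positivity))
      · refine (integrable_heatSymbol one_pos one_pos).congr (Eventually.of_forall fun ξ => ?_)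
        change _ = ∫ u in Set.Ioi 0, ‖K ξ u‖
        simp only [hn]
        exact heatSymbol_one_one ξ
    have e : 𝓕⁻ (fun ξ => (heatSymbol 1 1 ξ : ℂ)) x = ∫ u in Set.Ioi (0 : ℝ),
        (w u : ℂ) * 𝓕⁻ (fun ξ => (gaussian (Real.pi / u ^ 2) ξ : ℂ)) x := by
      have h1 : ∀ ξ : Plane, Real.fourierChar (inner ℝ ξ x) • (heatSymbol 1 1 ξ : ℂ) =
          ∫ u in Set.Ioi (0 : ℝ), K ξ u := fun ξ => by
        simp only [K]
        rw [integral_const_mul, integral_complex_ofReal, heatSymbol_one_one, Circle.smul_def,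
          smul_eq_mul]
      have h2 : ∀ u : ℝ, (w u : ℂ) * 𝓕⁻ (fun ξ => (gaussian (Real.pi / u ^ 2) ξ : ℂ)) x =
          ∫ ξ, K ξ u := fun u => by
        rw [← fourierInv_const_mul, Real.fourierInv_eq]
        simp only [K, Complex.ofReal_mul, Circle.smul_def, smul_eq_mul]
      simp only [h2]
      rw [Real.fourierInv_eq, ← integral_integral_swap hKi]
      exact integral_congr_ae (Eventually.of_forall h1)
    rw [heatKernel_eq, e]
    refine (enorm_re_le _).trans ((enorm_integral_le_lintegral_enorm _).trans_eq ?_)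
    refine lintegral_congr fun u => ?_
    rw [enorm_mul, ← ofReal_norm (w u : ℂ), Complex.norm_real, Real.norm_of_nonneg (hw0 u)]
  refine lt_of_le_of_lt (lintegral_mono key) ?_
  rw [lintegral_lintegral_swap]
  · have e : ∀ u ∈ Set.Ioi (0 : ℝ), ∫⁻ x, ENNReal.ofReal (w u) *
        ‖𝓕⁻ (fun ξ => (gaussian (Real.pi / u ^ 2) ξ : ℂ)) x‖ₑ = ENNReal.ofReal (w u) :=
      fun u hu => by
        have hu : 0 < u := hu
        rw [lintegral_const_mul' _ _ ENNReal.ofReal_ne_top,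
          lintegral_enorm_fourierInv_gaussian (by positivity), mul_one]
    rw [setLIntegral_congr_fun measurableSet_Ioi e]
    refine lt_of_le_of_lt (setLIntegral_le_lintegral _ _) ?_
    exact hwi.lintegral_lt_top
  -- The transform has a closed form for `u > 0` only; measurability is proved for that form and
  -- carried over almost everywhere.
  · have h3 : AEMeasurable (fun p : Plane × ℝ => ENNReal.ofReal (w p.2) *
        ‖(((Real.pi / p.2 ^ 2)⁻¹ * gaussian (Real.pi / p.2 ^ 2)⁻¹ p.1 : ℝ) : ℂ)‖ₑ)
        (volume.prod (volume.restrict (Set.Ioi 0))) := by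
      unfold gaussian
      refine Measurable.aemeasurable ?_
      fun_prop
    refine h3.congr ?_
    have h4 : ∀ᵐ p : Plane × ℝ ∂(volume.prod (volume.restrict (Set.Ioi 0))), p.2 ∈ Set.Ioi 0 :=
      Measure.quasiMeasurePreserving_snd.ae (ae_restrict_mem measurableSet_Ioi)
    filter_upwards [h4] with p hp
    have hp : 0 < p.2 := hp
    simp only [Function.uncurry]
    rw [fourierInv_gaussian (by positivity)]

/-! ### Moduli of continuity -/

theorem eq_basisVec_sum (v : Plane) : v = v 0 • basisVec 0 + v 1 • basisVec 1 := by
  ext i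
  fin_cases i <;> simp [basisVec]

theorem fderiv_apply_eq (F : Plane → ℝ) (x v : Plane) :
    fderiv ℝ F x v = v 0 * partialDeriv 0 F x + v 1 * partialDeriv 1 F x := by
  conv_lhs => rw [eq_basisVec_sum v]
  simp [partialDeriv]

theorem norm_fderiv_le_of_partialDeriv_le {F : Plane → ℝ} {B : ℝ} {x : Plane}
    (h : ∀ l, |partialDeriv l F x| ≤ B) : ‖fderiv ℝ F x‖ ≤ 2 * B := by
  have hB : 0 ≤ B := (abs_nonneg _).trans (h 0)
  refine ContinuousLinearMap.opNorm_le_bound _ (by positivity) fun v => ?_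
  rw [fderiv_apply_eq]
  refine (abs_add_le _ _).trans ?_
  rw [abs_mul, abs_mul]
  calc _ ≤ ‖v‖ * B + ‖v‖ * B := by
        gcongr
        exacts [abs_apply_le_norm v 0, h 0, abs_apply_le_norm v 1, h 1]
    _ = _ := by ring

theorem abs_sub_le_of_partialDeriv_le {F : Plane → ℝ} (hF : Differentiable ℝ F) {B : ℝ}
    (h : ∀ l x, |partialDeriv l F x| ≤ B) (a b : Plane) : |F a - F b| ≤ 2 * B * ‖a - b‖ :=
  convex_univ.norm_image_sub_le_of_norm_fderiv_le (𝕜 := ℝ) (fun x _ => hF x)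
    (fun x _ => norm_fderiv_le_of_partialDeriv_le fun l => h l x) (Set.mem_univ b) (Set.mem_univ a)

theorem enorm_apply_le (z : Plane) (j : Fin 2) : ‖z j‖ₑ ≤ ‖z‖ₑ := by
  simpa only [← ofReal_norm, Real.norm_eq_abs] using ENNReal.ofReal_le_ofReal (abs_apply_le_norm z j)

/-- The `L¹` modulus of continuity is controlled by the `L¹` norm of the gradient. -/
theorem lintegral_enorm_sub_le {F : Plane → ℝ} (hF : ContDiff ℝ ∞ F) (z : Plane) :
    ∫⁻ a, ‖F a - F (a + z)‖ₑ ≤ ‖z‖ₑ * ∫⁻ a, gradSum F a := by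
  have hc := fun l => (contDiff_partialDeriv hF l).continuous
  have hg : Measurable (gradSum F) := (hc 0).measurable.enorm.add (hc 1).measurable.enorm
  have hline : ∀ a (s : ℝ), HasDerivAt (fun s : ℝ => F (a + s • z)) (fderiv ℝ F (a + s • z) z) s :=
    fun a s => by
      have h1 : HasDerivAt (fun s : ℝ => a + s • z) z s := by
        simpa using ((hasDerivAt_id s).smul_const z).const_add a
      exact (hF.differentiable (by simp) _).hasFDerivAt.comp_hasDerivAt s h1
  have hcont : Continuous fun p : Plane × ℝ => gradSum F (p.1 + p.2 • z) := by
    have h1 : Continuous fun p : Plane × ℝ => p.1 + p.2 • z := by fun_prop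
    exact ((hc 0).comp h1).enorm.add ((hc 1).comp h1).enorm
  have key : ∀ a, ‖F a - F (a + z)‖ₑ ≤
      ∫⁻ s in Set.Ioc (0 : ℝ) 1, ‖z‖ₑ * gradSum F (a + s • z) := fun a => by
    have hd : Continuous fun s : ℝ => fderiv ℝ F (a + s • z) z :=
      ((hF.continuous_fderiv (by simp)).comp (by fun_prop)).clm_apply continuous_const
    have h := intervalIntegral.integral_eq_sub_of_hasDerivAt (a := 0) (b := 1)
      (fun s _ => hline a s) (hd.intervalIntegrable _ _)
    rw [zero_smul, add_zero, one_smul] at h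
    rw [enorm_sub_rev, ← h, intervalIntegral.integral_of_le zero_le_one]
    refine (enorm_integral_le_lintegral_enorm _).trans (lintegral_mono fun s => ?_)
    rw [fderiv_apply_eq, gradSum, mul_add]
    refine (enorm_add_le _ _).trans ?_
    rw [enorm_mul, enorm_mul]
    gcongr <;> exact enorm_apply_le z _
  refine (lintegral_mono key).trans ?_
  rw [lintegral_lintegral_swap (hcont.measurable.const_mul _).aemeasurable]
  have e : ∀ s : ℝ, ∫⁻ a, ‖z‖ₑ * gradSum F (a + s • z) = ‖z‖ₑ * ∫⁻ a, gradSum F a := fun s => by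
    rw [lintegral_const_mul' _ _ enorm_ne_top, lintegral_add_right_eq_self (gradSum F) (s • z)]
  simp [e]

/-! ### Scaling -/

theorem heatSymbol_scaling {α t : ℝ} (hα : α ≠ 0) (ht : 0 < t) (ξ : Plane) :
    heatSymbol α t ξ = heatSymbol α 1 (t ^ (1 / α) • ξ) := by
  have h : 0 < t ^ (1 / α) := by positivity
  rw [heatSymbol, heatSymbol, norm_smul, Real.norm_of_nonneg h.le,
    show 2 * Real.pi * (t ^ (1 / α) * ‖ξ‖) = t ^ (1 / α) * (2 * Real.pi * ‖ξ‖) by ring,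
    Real.mul_rpow h.le (by positivity), ← Real.rpow_mul ht.le, one_div_mul_cancel hα,
    Real.rpow_one]
  congr 1
  ring

theorem heatKernel_scaling {α t : ℝ} (hα : α ≠ 0) (ht : 0 < t) (x : Plane) :
    heatKernel α t x =
      (t ^ (1 / α))⁻¹ ^ 2 * heatKernel α 1 ((t ^ (1 / α))⁻¹ • x) := by
  set l := t ^ (1 / α) with hl
  have h : 0 < l := by positivity
  rw [heatKernel_eq, heatKernel_eq, Real.fourierInv_eq, Real.fourierInv_eq]
  have h1 := Measure.integral_comp_smul (volume : Measure Plane)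
    (fun ξ => Real.fourierChar (inner ℝ ξ (l⁻¹ • x)) • (heatSymbol α 1 ξ : ℂ)) l
  have e : ∀ ξ : Plane, Real.fourierChar (inner ℝ (l • ξ) (l⁻¹ • x)) •
      (heatSymbol α 1 (l • ξ) : ℂ) = Real.fourierChar (inner ℝ ξ x) • (heatSymbol α t ξ : ℂ) :=
    fun ξ => by
      rw [heatSymbol_scaling hα ht, real_inner_smul_left, real_inner_smul_right,
        mul_inv_cancel_left₀ h.ne']
  simp only [e] at h1
  rw [h1, finrank_euclideanSpace, Fintype.card_fin, abs_of_pos (by positivity), inv_pow,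
    Complex.smul_re, smul_eq_mul]

theorem partialDeriv_const_mul_comp_smul {F : Plane → ℝ} (hF : Differentiable ℝ F) (c r : ℝ)
    (k : Fin 2) (x : Plane) :
    partialDeriv k (fun x => c * F (r • x)) x = c * r * partialDeriv k F (r • x) := by
  have h0 : HasFDerivAt (fun x : Plane => r • x) (r • ContinuousLinearMap.id ℝ Plane) x :=
    (hasFDerivAt_id x).const_smul r
  have h : HasFDerivAt (fun x => c * F (r • x)) _ x :=
    ((hF (r • x)).hasFDerivAt.comp x h0).const_mul c
  rw [partialDeriv, h.fderiv]
  simp [partialDeriv]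
  ring

theorem partialDeriv_heatKernel_scaling {α t : ℝ} (hα : 0 < α) (ht : 0 < t) (k : Fin 2)
    (x : Plane) : partialDeriv k (heatKernel α t) x =
      (t ^ (1 / α))⁻¹ ^ 3 * partialDeriv k (heatKernel α 1) ((t ^ (1 / α))⁻¹ • x) := by
  rw [show heatKernel α t = _ from funext (heatKernel_scaling hα.ne' ht),
    partialDeriv_const_mul_comp_smul ((contDiff_heatKernel hα one_pos).differentiable (by simp))]
  ring

theorem lintegral_comp_smul_plane {r : ℝ} (hr : 0 < r) {F : Plane → ℝ≥0∞} (hF : Measurable F) :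
    ∫⁻ x, F (r • x) = ENNReal.ofReal (r⁻¹ ^ 2) * ∫⁻ x, F x := by
  rw [← lintegral_map hF (measurable_const_smul r), Measure.map_addHaar_smul _ hr.ne',
    lintegral_smul_measure, finrank_euclideanSpace, Fintype.card_fin, abs_of_pos (by positivity),
    inv_pow, smul_eq_mul]

theorem pairModulus_heatKernel_scaling {α t : ℝ} (hα : 0 < α) (ht : 0 < t) (a b : Plane) :
    pairModulus (heatKernel α t) a b = ENNReal.ofReal ((t ^ (1 / α))⁻¹ ^ 3) *
      pairModulus (heatKernel α 1) ((t ^ (1 / α))⁻¹ • a) ((t ^ (1 / α))⁻¹ • b) := by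
  have h : 0 ≤ (t ^ (1 / α))⁻¹ ^ 3 := by positivity
  simp only [pairModulus, partialDeriv_heatKernel_scaling hα ht, ← mul_sub, enorm_mul,
    Real.enorm_of_nonneg h, mul_add]

theorem gradSum_heatKernel_scaling {α t : ℝ} (hα : 0 < α) (ht : 0 < t) (a : Plane) :
    gradSum (heatKernel α t) a = ENNReal.ofReal ((t ^ (1 / α))⁻¹ ^ 3) *
      gradSum (heatKernel α 1) ((t ^ (1 / α))⁻¹ • a) := by
  have h : 0 ≤ (t ^ (1 / α))⁻¹ ^ 3 := by positivity
  simp only [gradSum, partialDeriv_heatKernel_scaling hα ht, enorm_mul,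
    Real.enorm_of_nonneg h, mul_add]

/-! ### Estimates for the heat kernel -/

/-- At time 1 the second derivatives are bounded. Scaling gives three powers of `t^{-1/α}` from the
gradient in the plane and a fourth from the rescaled distance. -/
theorem exists_pairModulus_heatKernel_le {α : ℝ} (hα : 0 < α) :
    ∃ C : ℝ, 0 ≤ C ∧ ∀ t : ℝ, 0 < t → ∀ a b, pairModulus (heatKernel α t) a b ≤
      ENNReal.ofReal (C * t ^ (-(4 / α)) * ‖a - b‖ ^ (1 : ℝ)) := by
  let B := (2 * Real.pi) ^ 2 * ∫ ξ : Plane, ‖ξ‖ ^ 2 * heatSymbol α 1 ξ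
  have hB : 0 ≤ B := (abs_nonneg _).trans
    (abs_partialDeriv_partialDeriv_heatKernel_le hα one_pos 0 0 0)
  refine ⟨4 * B, by positivity, fun t ht a b => ?_⟩
  have h1 : ∀ a b, pairModulus (heatKernel α 1) a b ≤ ENNReal.ofReal (4 * B * ‖a - b‖) :=
    fun a b => by
      have h2 : ∀ k, ‖partialDeriv k (heatKernel α 1) a - partialDeriv k (heatKernel α 1) b‖ₑ ≤
          ENNReal.ofReal (2 * B * ‖a - b‖) := fun k => by
        rw [← ofReal_norm]
        exact ENNReal.ofReal_le_ofReal (abs_sub_le_of_partialDeriv_le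
          ((contDiff_partialDeriv (contDiff_heatKernel hα one_pos) k).differentiable (by simp))
          (fun l x => abs_partialDeriv_partialDeriv_heatKernel_le hα one_pos k l x) a b)
      refine (add_le_add (h2 0) (h2 1)).trans_eq ?_
      rw [← ENNReal.ofReal_add (by positivity) (by positivity)]
      congr 1
      ring
  have hl : 0 < t ^ (1 / α) := by positivity
  rw [pairModulus_heatKernel_scaling hα ht]
  refine (mul_le_mul_right (h1 _ _) _).trans_eq ?_
  rw [← ENNReal.ofReal_mul (by positivity), ← smul_sub, norm_smul,
    Real.norm_of_nonneg (by positivity), Real.rpow_one]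
  congr 1
  have e : t ^ (-(4 / α)) = (t ^ (1 / α))⁻¹ ^ 4 := by
    rw [← Real.rpow_neg ht.le, ← Real.rpow_natCast, ← Real.rpow_mul ht.le]
    congr 1
    push_cast
    ring
  rw [e]
  ring

theorem lintegral_gradSum_heatKernel_one_lt_top {α : ℝ} (hα1 : 1 ≤ α) (hα2 : α ≤ 2) :
    ∫⁻ a, gradSum (heatKernel α 1) a < ⊤ := by
  have hQ := isBoundedSmooth_heatKernel (α := α) (t := 1) (by linarith) one_pos
  simp only [gradSum]
  rw [lintegral_add_left (hQ.continuous_partialDeriv 0).measurable.enorm]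
  exact ENNReal.add_lt_top.2 ⟨lintegral_enorm_partialDeriv_heatKernel_lt_top hα1 hα2 0,
    lintegral_enorm_partialDeriv_heatKernel_lt_top hα1 hα2 1⟩

theorem exists_lintegral_gradSum_heatKernel_le {α : ℝ} (hα1 : 1 ≤ α) (hα2 : α ≤ 2) :
    ∃ C : ℝ, 0 ≤ C ∧ ∀ t : ℝ, 0 < t → ∫⁻ a, gradSum (heatKernel α t) a ≤
      ENNReal.ofReal (C * t ^ (-(1 / α))) := by
  have hα : 0 < α := by linarith
  refine ⟨(∫⁻ a, gradSum (heatKernel α 1) a).toReal, ENNReal.toReal_nonneg, fun t ht => ?_⟩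
  have hl : 0 < t ^ (1 / α) := by positivity
  have hm : Measurable (gradSum (heatKernel α 1)) :=
    (isBoundedSmooth_heatKernel hα one_pos).measurable_gradSum
  simp only [gradSum_heatKernel_scaling hα ht]
  rw [lintegral_const_mul' _ _ ENNReal.ofReal_ne_top, lintegral_comp_smul_plane (by positivity) hm,
    ENNReal.ofReal_mul ENNReal.toReal_nonneg,
    ENNReal.ofReal_toReal (lintegral_gradSum_heatKernel_one_lt_top hα1 hα2).ne, ← mul_assoc,
    ← ENNReal.ofReal_mul (by positivity), mul_comm, Real.rpow_neg ht.le]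
  refine le_of_eq ?_
  congr 2
  field_simp

/-- At time 1 the modulus is at most a constant (integrable gradient) and at most a constant times
`|z|` (integrable second derivatives), hence at most a constant times `|z|^ε`; scaling gives the
power of `t`. The exponent `ε = 1` serves early times, and smaller ones keep the singularity at `s =
t` integrable. -/
theorem exists_lintegral_pairModulus_heatKernel_le {α : ℝ} (hα1 : 1 ≤ α) (hα2 : α ≤ 2) :
    ∃ C : ℝ, 0 ≤ C ∧ ∀ t : ℝ, 0 < t → ∀ ε : ℝ, 0 < ε → ε ≤ 1 → ∀ z,
      ∫⁻ a, pairModulus (heatKernel α t) a (a + z) ≤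
        ENNReal.ofReal (C * t ^ (-((1 + ε) / α)) * ‖z‖ ^ ε) := by
  have hα : 0 < α := by linarith
  let A := ∫⁻ a, gradSum (heatKernel α 1) a
  let D := (∫⁻ a, gradSum (partialDeriv 0 (heatKernel α 1)) a) +
    ∫⁻ a, gradSum (partialDeriv 1 (heatKernel α 1)) a
  have hP := contDiff_heatKernel hα one_pos
  have hQ := isBoundedSmooth_heatKernel hα one_pos
  have hA : A < ⊤ := lintegral_gradSum_heatKernel_one_lt_top hα1 hα2
  have hm := fun k => (hQ.continuous_partialDeriv k).measurable
  have hD : D < ⊤ := by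
    have h : ∀ k, ∫⁻ a, gradSum (partialDeriv k (heatKernel α 1)) a < ⊤ := fun k => by
      simp only [gradSum]
      rw [lintegral_add_left
        (contDiff_partialDeriv (contDiff_partialDeriv hP k) 0).continuous.measurable.enorm]
      exact ENNReal.add_lt_top.2
        ⟨lintegral_enorm_partialDeriv_partialDeriv_heatKernel_lt_top hα1 hα2 k 0,
          lintegral_enorm_partialDeriv_partialDeriv_heatKernel_lt_top hα1 hα2 k 1⟩
    exact ENNReal.add_lt_top.2 ⟨h 0, h 1⟩
  have h1 : ∀ z, ∫⁻ a, pairModulus (heatKernel α 1) a (a + z) ≤ 2 * A := fun z => by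
    refine (lintegral_mono fun a => pairModulus_le _ a (a + z)).trans_eq ?_
    rw [lintegral_add_left hQ.measurable_gradSum,
      lintegral_add_right_eq_self (gradSum (heatKernel α 1)) z, two_mul]
  have h2 : ∀ z, ∫⁻ a, pairModulus (heatKernel α 1) a (a + z) ≤ ‖z‖ₑ * D := fun z => by
    have h0 : Measurable fun a =>
        ‖partialDeriv 0 (heatKernel α 1) a - partialDeriv 0 (heatKernel α 1) (a + z)‖ₑ :=
      ((hm 0).sub ((hm 0).comp (measurable_add_const z))).enorm
    simp only [pairModulus]
    rw [lintegral_add_left h0, mul_add]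
    exact add_le_add (lintegral_enorm_sub_le (contDiff_partialDeriv hP 0) z)
      (lintegral_enorm_sub_le (contDiff_partialDeriv hP 1) z)
  have h3 : ∀ ε : ℝ, 0 < ε → ε ≤ 1 → ∀ z, ∫⁻ a, pairModulus (heatKernel α 1) a (a + z) ≤
      ENNReal.ofReal ((2 * A + D).toReal * ‖z‖ ^ ε) := fun ε h0 h1' z => by
    have hAD : 2 * A + D ≠ ⊤ := (ENNReal.add_lt_top.2 ⟨ENNReal.mul_lt_top (by simp) hA, hD⟩).ne
    rw [ENNReal.ofReal_mul ENNReal.toReal_nonneg, ENNReal.ofReal_toReal hAD]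
    by_cases hz : ‖z‖ ≤ 1
    · refine (h2 z).trans ?_
      rw [mul_comm, ← ofReal_norm]
      gcongr
      · exact le_add_self
      · calc ‖z‖ = ‖z‖ ^ (1 : ℝ) := (Real.rpow_one _).symm
          _ ≤ _ := Real.rpow_le_rpow_of_exponent_ge' (norm_nonneg z) hz h0.le h1'
    · refine (h1 z).trans (le_self_add.trans (le_mul_of_one_le_right zero_le ?_))
      rw [← ENNReal.ofReal_one]
      exact ENNReal.ofReal_le_ofReal (Real.one_le_rpow (not_le.1 hz).le h0.le)
  refine ⟨(2 * A + D).toReal, ENNReal.toReal_nonneg, fun t ht ε h0 h1' z => ?_⟩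
  have hl : 0 < t ^ (1 / α) := by positivity
  have hmeas : Measurable fun a => pairModulus (heatKernel α 1) a (a + (t ^ (1 / α))⁻¹ • z) :=
    hQ.measurable_pairModulus measurable_id (measurable_id.add_const _)
  simp only [pairModulus_heatKernel_scaling hα ht, smul_add]
  rw [lintegral_const_mul' _ _ ENNReal.ofReal_ne_top,
    lintegral_comp_smul_plane (by positivity) hmeas, ← mul_assoc,
    ← ENNReal.ofReal_mul (by positivity)]
  refine (mul_le_mul_right (h3 ε h0 h1' _) _).trans_eq ?_
  rw [← ENNReal.ofReal_mul (by positivity), norm_smul, Real.norm_of_nonneg (by positivity),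
    Real.mul_rpow (by positivity) (norm_nonneg z)]
  congr 1
  have e : t ^ (-((1 + ε) / α)) = (t ^ (1 / α))⁻¹ * (t ^ (1 / α))⁻¹ ^ ε := by
    rw [← Real.rpow_neg ht.le, ← Real.rpow_mul ht.le, ← Real.rpow_add ht]
    congr 1
    ring
  rw [e]
  field_simp

/-- The scaling of the kernel preserves the `L¹` norm, so time 1 is enough. -/
theorem exists_eLpNorm_heatKernel_one_le :
    ∃ C : ℝ, 0 ≤ C ∧ ∀ t : ℝ, 0 < t → eLpNorm (heatKernel 1 t) 1 ≤ ENNReal.ofReal C := by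
  refine ⟨(∫⁻ x, ‖heatKernel 1 1 x‖ₑ).toReal, ENNReal.toReal_nonneg, fun t ht => ?_⟩
  have hm : Measurable fun x => ‖heatKernel 1 1 x‖ₑ :=
    (contDiff_heatKernel one_pos one_pos).continuous.measurable.enorm
  rw [ENNReal.ofReal_toReal lintegral_enorm_heatKernel_one_lt_top.ne,
    eLpNorm_one_eq_lintegral_enorm]
  simp only [heatKernel_scaling one_ne_zero ht, enorm_mul]
  rw [lintegral_const_mul' _ _ enorm_ne_top,
    lintegral_comp_smul_plane (F := fun x => ‖heatKernel 1 1 x‖ₑ) (by positivity) hm, ← mul_assoc,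
    Real.enorm_of_nonneg (by positivity), ← ENNReal.ofReal_mul (by positivity), inv_inv,
    ← mul_pow, inv_mul_cancel₀ (by positivity), one_pow, ENNReal.ofReal_one, one_mul]

/-! ### Sobolev norms -/

theorem weakDeriv_congr_ae {i : Fin 2} {f f' : Plane → ℝ} (h : f =ᵐ[volume] f') :
    weakDeriv i f =ᵐ[volume] weakDeriv i f' := by
  by_cases hf : ∃ g, HasWeakDeriv i f g
  · obtain ⟨g, hg⟩ := hf
    exact hg.weakDeriv_ae_eq.trans (hg.congr h ae_eq_rfl).weakDeriv_ae_eq.symm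
  · have hf' : ¬ ∃ g, HasWeakDeriv i f' g := fun ⟨g, hg⟩ => hf ⟨g, hg.congr h.symm ae_eq_rfl⟩
    rw [weakDeriv, weakDeriv, dif_neg hf, dif_neg hf']

theorem sobolevNorm_congr_ae (k : ℕ) {p : ℝ≥0∞} {f f' : Plane → ℝ} (h : f =ᵐ[volume] f') :
    sobolevNorm k f p = sobolevNorm k f' p := by
  induction k generalizing f f' with
  | zero => exact eLpNorm_congr_ae h
  | succ k ih =>
    simp only [sobolevNorm]
    rw [eLpNorm_congr_ae h]
    congr 1
    exact Finset.sum_congr rfl fun i _ => ih (weakDeriv_congr_ae h)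

theorem MemSobolev.memLp {k : ℕ} {p : ℝ≥0∞} {f : Plane → ℝ} (h : MemSobolev k f p) :
    MemLp f p := by
  cases k with
  | zero => exact h
  | succ k => exact h.1

theorem sobolevNorm_le_add {k : ℕ} {p : ℝ≥0∞} (hp : 1 ≤ p) {f g : Plane → ℝ}
    (hf : MemSobolev k f p) (hg : MemSobolev k g p) :
    sobolevNorm k f p ≤ sobolevNorm k (f - g) p + sobolevNorm k g p := by
  have h0 : ∀ {f g : Plane → ℝ}, MemLp f p → MemLp g p →
      eLpNorm f p ≤ eLpNorm (f - g) p + eLpNorm g p := fun {f g} hf hg => by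
    conv_lhs => rw [← sub_add_cancel f g]
    exact eLpNorm_add_le (hf.1.sub hg.1) hg.1 hp
  induction k generalizing f g with
  | zero => exact h0 hf hg
  | succ k ih =>
    simp only [sobolevNorm]
    rw [add_add_add_comm, ← Finset.sum_add_distrib]
    refine add_le_add (h0 hf.1 hg.1) (Finset.sum_le_sum fun i _ => ?_)
    rw [sobolevNorm_congr_ae k ((hf.2 i).1.sub (hg.2 i).1).weakDeriv_ae_eq]
    exact ih (hf.2 i).2 (hg.2 i).2

theorem sobolevNorm_lt_top {k : ℕ} {p : ℝ≥0∞} {f : Plane → ℝ} (hf : MemSobolev k f p) :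
    sobolevNorm k f p < ⊤ := by
  induction k generalizing f with
  | zero => exact hf.2
  | succ k ih =>
    simp only [sobolevNorm]
    exact ENNReal.add_lt_top.2 ⟨hf.1.2, ENNReal.sum_lt_top.2 fun i _ => ih (hf.2 i).2⟩

theorem eLpNorm_le_sobolevNorm (k : ℕ) (p : ℝ≥0∞) (f : Plane → ℝ) :
    eLpNorm f p ≤ sobolevNorm k f p := by
  cases k with
  | zero => exact le_rfl
  | succ k => exact le_self_add

theorem sobolevNorm_weakDeriv_le (k : ℕ) (p : ℝ≥0∞) (f : Plane → ℝ) (i : Fin 2) :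
    sobolevNorm k (weakDeriv i f) p ≤ sobolevNorm (k + 1) f p :=
  (Finset.single_le_sum (f := fun i => sobolevNorm k (weakDeriv i f) p) (fun _ _ => zero_le)
    (Finset.mem_univ i)).trans le_add_self

/-- A function continuous with values in a Sobolev space is bounded on compact sets. -/
theorem ContinuousInSobolev.exists_sobolevNorm_le {I : Set ℝ} {k : ℕ} {p : ℝ≥0∞} (hp : 1 ≤ p)
    {θ : ℝ → Plane → ℝ} (h : ContinuousInSobolev I k p θ) {K : Set ℝ} (hK : IsCompact K)
    (hKI : K ⊆ I) : ∃ C : ℝ≥0∞, C < ⊤ ∧ ∀ s ∈ K, sobolevNorm k (θ s) p ≤ C := by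
  refine hK.induction_on (p := fun S => ∃ C : ℝ≥0∞, C < ⊤ ∧ ∀ s ∈ S, sobolevNorm k (θ s) p ≤ C)
    ⟨0, by simp, by simp⟩ (fun S T hST ⟨C, hC, hT⟩ => ⟨C, hC, fun s hs => hT s (hST hs)⟩)
    (fun S T ⟨C, hC, hS⟩ ⟨D, hD, hT⟩ => ⟨max C D, max_lt hC hD, fun s hs => ?_⟩) fun s hs => ?_
  · rcases hs with hs | hs
    · exact (hS s hs).trans (le_max_left _ _)
    · exact (hT s hs).trans (le_max_right _ _)
  · have h1 := (h s (hKI hs)).2.eventually (gt_mem_nhds one_pos)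
    refine ⟨{r | r ∈ K ∧ sobolevNorm k (θ r - θ s) p < 1}, ?_, 1 + sobolevNorm k (θ s) p,
      ENNReal.add_lt_top.2 ⟨by simp, sobolevNorm_lt_top (h s (hKI hs)).1⟩, fun r hr => ?_⟩
    · filter_upwards [self_mem_nhdsWithin, nhdsWithin_mono s hKI h1] with r h2 h3
      exact ⟨h2, h3⟩
    · refine (sobolevNorm_le_add hp (h r (hKI hr.1)).1 (h s (hKI hs)).1).trans ?_
      gcongr
      exact hr.2.le

theorem isRegular_of_memSobolev {f : Plane → ℝ} (h1 : MemSobolev 2 f 1) (h2 : MemSobolev 2 f 2)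
    (hi : MemSobolev 2 f ⊤) : IsRegular f :=
  ⟨memLp_one_iff_integrable.1 h1.1, h2.1, hi.1, fun i => (h1.2 i).1,
    fun i => memLp_one_iff_integrable.1 (h1.2 i).2.1, fun i => (h2.2 i).2.1⟩

theorem IsMildSolution.isRegular {α : ℝ} {θ₀ : Plane → ℝ} {θ : ℝ → Plane → ℝ}
    (h : IsMildSolution α θ₀ θ) {s : ℝ} (hs : 0 < s) : IsRegular (θ s) :=
  isRegular_of_memSobolev (h.continuous_W2p 1 le_rfl s hs).1
    (h.continuous_W2p 2 one_le_two s hs).1 (h.continuous_W2p ⊤ le_top s hs).1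

/-! ### The advection term in `L¹` -/

theorem eLpNorm_mul_one_le {f g : Plane → ℝ} (hf : AEStronglyMeasurable f)
    (hg : AEStronglyMeasurable g) :
    eLpNorm (fun x => f x * g x) 1 ≤ eLpNorm f 2 * eLpNorm g 2 :=
  eLpNorm_smul_le_mul_eLpNorm (p := 2) (q := 2) (φ := f) (f := g) hg hf

theorem aestronglyMeasurable_advection {f : Plane → ℝ} (hf : MemSobolev 2 f 2) :
    AEStronglyMeasurable (advection f) :=
  ((memLp_riesz 1 hf.1).1.neg.mul (hf.2 0).2.1.1).add ((memLp_riesz 0 hf.1).1.mul (hf.2 1).2.1.1)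

theorem eLpNorm_advection_le {f : Plane → ℝ} (hf : MemSobolev 2 f 2) :
    eLpNorm (advection f) 1 ≤
      eLpNorm f 2 * (eLpNorm (weakDeriv 0 f) 2 + eLpNorm (weakDeriv 1 f) 2) := by
  have hR := fun j => memLp_riesz j hf.1
  have hD := fun i => (hf.2 i).2.1.1
  refine (eLpNorm_add_le ((hR 1).1.neg.mul (hD 0)) ((hR 0).1.mul (hD 1)) le_rfl).trans ?_
  rw [mul_add]
  refine add_le_add ((eLpNorm_mul_one_le (hR 1).1.neg (hD 0)).trans ?_)
    ((eLpNorm_mul_one_le (hR 0).1 (hD 1)).trans ?_)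
  · rw [eLpNorm_neg]
    gcongr
    exact eLpNorm_riesz_le 1 hf.1
  · gcongr
    exact eLpNorm_riesz_le 0 hf.1

theorem integrable_advection {f : Plane → ℝ} (hf : MemSobolev 2 f 2) :
    Integrable (advection f) :=
  memLp_one_iff_integrable.1 ⟨aestronglyMeasurable_advection hf, (eLpNorm_advection_le hf).trans_lt
    (ENNReal.mul_lt_top hf.1.2 (ENNReal.add_lt_top.2 ⟨(hf.2 0).2.1.2, (hf.2 1).2.1.2⟩))⟩

/-- Bilinearity: `Rf ∂f - Rg ∂g = Rf ∂(f-g) + R(f-g) ∂g`, followed by Cauchy–Schwarz. -/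
theorem eLpNorm_riesz_mul_sub_le (i j : Fin 2) {f g : Plane → ℝ} (hf : MemSobolev 2 f 2)
    (hg : MemSobolev 2 g 2) :
    eLpNorm (fun x => riesz j f x * weakDeriv i f x - riesz j g x * weakDeriv i g x) 1 ≤
      2 * (sobolevNorm 2 (f - g) 2 + sobolevNorm 2 g 2) * sobolevNorm 2 (f - g) 2 := by
  set N := sobolevNorm 2 (f - g) 2
  set A := sobolevNorm 2 g 2
  have hRf := memLp_riesz j hf.1
  have hRg := memLp_riesz j hg.1
  have hDf := (hf.2 i).2.1.1
  have hDg := (hg.2 i).2.1.1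
  have e : (fun x => riesz j f x * weakDeriv i f x - riesz j g x * weakDeriv i g x) =
      (fun x => riesz j f x * (weakDeriv i f - weakDeriv i g) x) +
        fun x => (riesz j f - riesz j g) x * weakDeriv i g x := by
    funext x
    simp only [Pi.add_apply, Pi.sub_apply]
    ring
  have h1 : eLpNorm (riesz j f) 2 ≤ N + A :=
    (eLpNorm_riesz_le j hf.1).trans ((eLpNorm_le_sobolevNorm 2 2 f).trans
      (sobolevNorm_le_add one_le_two hf hg))
  have h2 : eLpNorm (weakDeriv i f - weakDeriv i g) 2 ≤ N := by
    rw [← eLpNorm_congr_ae ((hf.2 i).1.sub (hg.2 i).1).weakDeriv_ae_eq]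
    exact (eLpNorm_le_sobolevNorm 1 2 _).trans (sobolevNorm_weakDeriv_le 1 2 _ i)
  have h3 : eLpNorm (riesz j f - riesz j g) 2 ≤ N := by
    rw [← eLpNorm_congr_ae (riesz_sub_ae_eq j hf.1 hg.1)]
    exact (eLpNorm_riesz_le j (hf.1.sub hg.1)).trans (eLpNorm_le_sobolevNorm 2 2 _)
  have h4 : eLpNorm (weakDeriv i g) 2 ≤ A :=
    (eLpNorm_le_sobolevNorm 1 2 _).trans (sobolevNorm_weakDeriv_le 1 2 _ i)
  rw [e]
  refine (eLpNorm_add_le (hRf.1.mul (hDf.sub hDg)) ((hRf.1.sub hRg.1).mul hDg) le_rfl).trans ?_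
  calc _ ≤ (N + A) * N + N * A :=
        add_le_add ((eLpNorm_mul_one_le hRf.1 (hDf.sub hDg)).trans (mul_le_mul' h1 h2))
          ((eLpNorm_mul_one_le (hRf.1.sub hRg.1) hDg).trans (mul_le_mul' h3 h4))
    _ ≤ (N + A) * N + N * (N + A) := by
        gcongr
        exact le_add_self
    _ = _ := by ring

theorem eLpNorm_advection_sub_le {f g : Plane → ℝ} (hf : MemSobolev 2 f 2)
    (hg : MemSobolev 2 g 2) : eLpNorm (advection f - advection g) 1 ≤
      4 * (sobolevNorm 2 (f - g) 2 + sobolevNorm 2 g 2) * sobolevNorm 2 (f - g) 2 := by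
  have hm : ∀ i j, AEStronglyMeasurable
      (fun x => riesz j f x * weakDeriv i f x - riesz j g x * weakDeriv i g x) := fun i j =>
    ((memLp_riesz j hf.1).1.mul (hf.2 i).2.1.1).sub ((memLp_riesz j hg.1).1.mul (hg.2 i).2.1.1)
  have e : advection f - advection g =
      (fun x => riesz 0 f x * weakDeriv 1 f x - riesz 0 g x * weakDeriv 1 g x) -
        fun x => riesz 1 f x * weakDeriv 0 f x - riesz 1 g x * weakDeriv 0 g x := by
    funext x
    simp only [advection, Pi.sub_apply]
    ring
  rw [e]
  refine (eLpNorm_sub_le (hm 1 0) (hm 0 1) le_rfl).trans ((add_le_add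
    (eLpNorm_riesz_mul_sub_le 1 0 hf hg) (eLpNorm_riesz_mul_sub_le 0 1 hf hg)).trans_eq ?_)
  ring

/-- The advection term depends continuously on time in `L¹`. -/
theorem IsMildSolution.tendsto_eLpNorm_advection_sub {α : ℝ} {θ₀ : Plane → ℝ}
    {θ : ℝ → Plane → ℝ} (h : IsMildSolution α θ₀ θ) {s₀ : ℝ} (hs₀ : 0 < s₀) :
    Tendsto (fun s => eLpNorm (advection (θ s) - advection (θ s₀)) 1) (𝓝 s₀) (𝓝 0) := by
  have hW := h.continuous_W2p 2 one_le_two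
  have h1 := (hW s₀ hs₀).2
  rw [IsOpen.nhdsWithin_eq isOpen_Ioi hs₀] at h1
  have hA := (sobolevNorm_lt_top (hW s₀ hs₀).1).ne
  have h2 : Tendsto (fun s => 4 * (sobolevNorm 2 (θ s - θ s₀) 2 + sobolevNorm 2 (θ s₀) 2) *
      sobolevNorm 2 (θ s - θ s₀) 2) (𝓝 s₀) (𝓝 (4 * (0 + sobolevNorm 2 (θ s₀) 2) * 0)) := by
    refine ENNReal.Tendsto.mul (ENNReal.Tendsto.const_mul (h1.add_const _) (Or.inr (by simp)))
      (Or.inr (by simp)) h1 (Or.inr ?_)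
    rw [zero_add]
    exact ENNReal.mul_ne_top (by simp) hA
  rw [mul_zero] at h2
  refine tendsto_of_tendsto_of_tendsto_of_le_of_le' tendsto_const_nhds h2
    (Eventually.of_forall fun _ => zero_le) ?_
  filter_upwards [lt_mem_nhds hs₀] with s hs
  exact eLpNorm_advection_sub_le (hW s hs).1 (hW s₀ hs₀).1

/-! ### Joint continuity of the Duhamel integrand -/

/-- Scaling reduces continuity in time to continuity in space at time 1. -/
theorem continuousAt_heatKernel {α : ℝ} (hα : 0 < α) {t : ℝ} (ht : 0 < t) (x : Plane) :
    ContinuousAt (fun p : ℝ × Plane => heatKernel α p.1 p.2) (t, x) := by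
  have hl : ContinuousAt (fun p : ℝ × Plane => (p.1 ^ (1 / α))⁻¹) (t, x) :=
    (continuousAt_fst.rpow_const (Or.inl ht.ne')).inv₀ (by positivity)
  have h : ContinuousAt (fun p : ℝ × Plane => (p.1 ^ (1 / α))⁻¹ ^ 2 *
      heatKernel α 1 ((p.1 ^ (1 / α))⁻¹ • p.2)) (t, x) :=
    (hl.pow 2).mul ((contDiff_heatKernel hα one_pos).continuous.continuousAt.comp
      (hl.smul continuousAt_snd))
  refine h.congr ?_
  filter_upwards [continuousAt_fst.eventually (lt_mem_nhds ht)] with p hp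
  exact (heatKernel_scaling hα.ne' hp p.2).symm

theorem tendsto_heatKernel_sub {α : ℝ} (hα : 0 < α) {s₀ t : ℝ} (hst : s₀ < t) (x₀ y : Plane) :
    Tendsto (fun p : ℝ × Plane => heatKernel α (t - p.1) (p.2 - y)) (𝓝 (s₀, x₀))
      (𝓝 (heatKernel α (t - s₀) (x₀ - y))) := by
  have h2 := continuousAt_heatKernel hα (sub_pos.2 hst) (x₀ - y)
  have h3 : Tendsto (fun p : ℝ × Plane => (t - p.1, p.2 - y)) (𝓝 (s₀, x₀))
      (𝓝 (t - s₀, x₀ - y)) :=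
    ContinuousAt.tendsto (f := fun p : ℝ × Plane => (t - p.1, p.2 - y)) (by fun_prop)
  generalize heatKernel α = K at h2 ⊢
  exact Tendsto.comp (g := fun p : ℝ × Plane => K p.1 p.2) h2 h3

theorem abs_heatKernel_le_of_le {α : ℝ} (hα : 0 < α) {τ t : ℝ} (hτ : 0 < τ) (ht : τ ≤ t)
    (x : Plane) : |heatKernel α t x| ≤ ∫ ξ, heatSymbol α τ ξ := by
  refine (abs_heatKernel_le x).trans (integral_mono (integrable_heatSymbol hα (hτ.trans_le ht))
    (integrable_heatSymbol hα hτ) fun ξ => ?_)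
  simp only [heatSymbol]
  gcongr

/-- Joint continuity supplies the measurability that Fubini and the absolute convergence require.
The variation is split in two: with the advection frozen at `s₀` the kernel is handled by dominated
convergence; the change of the advection is small in `L¹` while the kernel stays bounded, since `t -
s` remains above `τ`. -/
theorem IsMildSolution.continuousAt_duhamelIntegrand {α : ℝ} (hα : 0 < α) {θ₀ : Plane → ℝ}
    {θ : ℝ → Plane → ℝ} (h : IsMildSolution α θ₀ θ) {t s₀ : ℝ} (hs₀ : 0 < s₀) (hst : s₀ < t)
    (x₀ : Plane) :
    ContinuousAt (fun p : ℝ × Plane => duhamelIntegrand α θ t p.1 p.2) (s₀, x₀) := by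
  have hW := fun s (hs : 0 < s) => (h.continuous_W2p 2 one_le_two s hs).1
  set τ := (t - s₀) / 2 with hτ
  have hτ0 : 0 < τ := by rw [hτ]; linarith
  set A := ∫ ξ, heatSymbol α τ ξ with hA
  have hev : ∀ᶠ p : ℝ × Plane in 𝓝 (s₀, x₀), 0 < p.1 ∧ τ ≤ t - p.1 := by
    have h1 : ∀ᶠ s in 𝓝 s₀, 0 < s ∧ s < s₀ + τ :=
      (lt_mem_nhds hs₀).and (gt_mem_nhds (by linarith))
    filter_upwards [continuousAt_fst.eventually h1] with p hp
    exact ⟨hp.1, by linarith [hp.2]⟩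
  have hc : ∀ s, 0 < t - s → Continuous (heatKernel α (t - s)) :=
    fun s hs => (contDiff_heatKernel hα hs).continuous
  have hi : ∀ (s : ℝ) (x : Plane) {g : Plane → ℝ}, τ ≤ t - s → Integrable g →
      Integrable fun y => heatKernel α (t - s) (x - y) * g y := fun s x {g} hs hg =>
    hg.bdd_mul (c := A) ((hc s (hτ0.trans_le hs)).comp
      (continuous_const.sub continuous_id)).aestronglyMeasurable
      (Eventually.of_forall fun y => abs_heatKernel_le_of_le hα hτ0 hs _)
  have hdef : ∀ s x, duhamelIntegrand α θ t s x =
      ∫ y, heatKernel α (t - s) (x - y) * advection (θ s) y := fun s x => by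
    rw [duhamelIntegrand, convolution_eq_swap]
    rfl
  have hG := integrable_advection (hW s₀ hs₀)
  have h1 : Tendsto (fun p : ℝ × Plane =>
      ∫ y, heatKernel α (t - p.1) (p.2 - y) * advection (θ s₀) y) (𝓝 (s₀, x₀))
      (𝓝 (duhamelIntegrand α θ t s₀ x₀)) := by
    rw [hdef]
    refine tendsto_integral_filter_of_dominated_convergence (fun y => A * ‖advection (θ s₀) y‖)
      ?_ ?_ (hG.norm.const_mul A) (Eventually.of_forall fun y => ?_)
    · filter_upwards [hev] with p hp
      exact (hi p.1 p.2 hp.2 hG).1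
    · filter_upwards [hev] with p hp
      refine Eventually.of_forall fun y => ?_
      rw [norm_mul]
      gcongr
      exact abs_heatKernel_le_of_le hα hτ0 hp.2 _
    · refine Tendsto.mul_const (advection (θ s₀) y) ?_
      exact tendsto_heatKernel_sub hα hst x₀ y
  have h4 : Tendsto (fun p : ℝ × Plane =>
      A * (eLpNorm (advection (θ p.1) - advection (θ s₀)) 1).toReal) (𝓝 (s₀, x₀)) (𝓝 0) := by
    have h5 := (h.tendsto_eLpNorm_advection_sub hs₀).comp
      (continuousAt_fst (X := ℝ) (Y := Plane) (p := (s₀, x₀)))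
    have h6 := ((ENNReal.tendsto_toReal ENNReal.zero_ne_top).comp h5).const_mul A
    simpa using h6
  have h7 : Tendsto (fun p : ℝ × Plane => duhamelIntegrand α θ t p.1 p.2 -
      ∫ y, heatKernel α (t - p.1) (p.2 - y) * advection (θ s₀) y) (𝓝 (s₀, x₀)) (𝓝 0) := by
    refine squeeze_zero_norm' ?_ h4
    filter_upwards [hev] with p hp
    have hF := integrable_advection (hW p.1 hp.1)
    rw [hdef, ← integral_sub (hi p.1 p.2 hp.2 hF) (hi p.1 p.2 hp.2 hG), eLpNorm_one_eq_lintegral_enorm,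
      ← integral_norm_eq_lintegral_enorm (hF.sub hG).1, ← integral_const_mul]
    refine norm_integral_le_of_norm_le ((hF.sub hG).norm.const_mul A)
      (Eventually.of_forall fun y => ?_)
    rw [← mul_sub, norm_mul]
    exact mul_le_mul_of_nonneg_right (abs_heatKernel_le_of_le hα hτ0 hp.2 _) (norm_nonneg _)
  have h8 := h7.add h1
  simpa [ContinuousAt] using h8

/-! ### Bounds for the advection term through the Fourier transform -/

/-- The weight in the Sobolev embedding of `H²` in the Fourier algebra. -/
def sobolevWeight (ξ : Plane) : ℝ := (1 + ‖ξ‖ ^ 2)⁻¹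

theorem continuous_sobolevWeight : Continuous sobolevWeight :=
  (by fun_prop : Continuous fun ξ : Plane => 1 + ‖ξ‖ ^ 2).inv₀ fun ξ => by positivity

theorem memLp_sobolevWeight : MemLp sobolevWeight 2 := by
  refine (memLp_two_iff_integrable_sq continuous_sobolevWeight.aestronglyMeasurable).2 ?_
  have h := integrable_rpow_neg_one_add_norm_sq (E := Plane) (μ := volume) (r := 4)
    (by rw [finrank_euclideanSpace, Fintype.card_fin]; norm_num)
  refine h.congr (Eventually.of_forall fun ξ => ?_)
  have : 0 < 1 + ‖ξ‖ ^ 2 := by positivity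
  simp only [sobolevWeight]
  rw [inv_pow, show (-4 / 2 : ℝ) = -(2 : ℕ) by norm_num, Real.rpow_neg this.le, Real.rpow_natCast]

theorem eLpNorm_two_comp_smul {σ : ℝ} (hσ : 0 < σ) {F : Plane → ℝ} (hF : Continuous F) :
    eLpNorm (fun ξ => F (σ • ξ)) 2 = ENNReal.ofReal σ⁻¹ * eLpNorm F 2 := by
  have hm : Measurable fun ξ => ‖F ξ‖ₑ ^ (2 : ℝ) := hF.measurable.enorm.pow_const _
  rw [eLpNorm_eq_lintegral_rpow_enorm_toReal (by simp) (by simp),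
    eLpNorm_eq_lintegral_rpow_enorm_toReal (by simp) (by simp)]
  simp only [ENNReal.toReal_ofNat]
  rw [lintegral_comp_smul_plane (F := fun ξ => ‖F ξ‖ₑ ^ (2 : ℝ)) hσ hm,
    ENNReal.mul_rpow_of_nonneg _ _ (by norm_num), ENNReal.ofReal_rpow_of_nonneg (by positivity)
    (by norm_num), ← Real.sqrt_eq_rpow, Real.sqrt_sq (by positivity)]

/-- The `L¹` norm is controlled by `L²` norms with weights. -/
theorem lintegral_enorm_le_sobolevWeight {σ : ℝ} (hσ : 0 < σ) {h : Plane → ℂ}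
    (hh : AEStronglyMeasurable h) :
    ∫⁻ ξ, ‖h ξ‖ₑ ≤ ENNReal.ofReal σ⁻¹ * eLpNorm sobolevWeight 2 *
      (eLpNorm h 2 + ENNReal.ofReal (σ ^ 2) * eLpNorm (fun ξ => (‖ξ‖ ^ 2) • h ξ) 2) := by
  have hn : Continuous fun ξ : Plane => ‖ξ‖ ^ 2 := by fun_prop
  have hm1 : AEStronglyMeasurable fun ξ : Plane => (‖ξ‖ ^ 2) • h ξ :=
    hn.aestronglyMeasurable.smul hh
  have hw : Continuous fun ξ : Plane => sobolevWeight (σ • ξ) :=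
    continuous_sobolevWeight.comp (by fun_prop)
  -- Multiplying and dividing by `1 + σ²|ξ|²` prepares Cauchy–Schwarz. The free scale `σ` is what
  -- makes the resulting bound decay at the correct rate in time.
  have e : h = (fun ξ : Plane => sobolevWeight (σ • ξ)) •
      (h + (σ ^ 2) • fun ξ : Plane => (‖ξ‖ ^ 2) • h ξ) := by
    funext ξ
    simp only [Pi.smul_apply', Pi.add_apply, Pi.smul_apply, sobolevWeight, norm_smul,
      Real.norm_of_nonneg hσ.le, smul_smul, mul_pow]
    have : 0 < 1 + σ ^ 2 * ‖ξ‖ ^ 2 := by positivity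
    rw [smul_add, smul_smul, ← add_smul, ← mul_one_add, inv_mul_cancel₀ this.ne', one_smul]
  rw [← eLpNorm_one_eq_lintegral_enorm, e]
  refine (eLpNorm_smul_le_mul_eLpNorm (p := 2) (q := 2) (hh.add (hm1.const_smul _))
    hw.aestronglyMeasurable).trans ?_
  rw [← e, eLpNorm_two_comp_smul hσ continuous_sobolevWeight]
  gcongr
  refine (eLpNorm_add_le hh (hm1.const_smul _) one_le_two).trans ?_
  rw [eLpNorm_const_smul, Real.enorm_of_nonneg (by positivity)]

/-- The homogeneous Sobolev seminorm of order `n`, through the Fourier transform. -/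
def fourierSeminorm (n : ℕ) (f : Plane → ℝ) : ℝ≥0∞ :=
  eLpNorm (fun ξ => (‖ξ‖ ^ n) • 𝓕 (fun x => (f x : ℂ)) ξ) 2

theorem fourierSeminorm_zero {f : Plane → ℝ} (hf : Integrable f) (hf2 : MemLp f 2) :
    fourierSeminorm 0 f = eLpNorm f 2 := by
  have hc : Integrable (fun x => (f x : ℂ)) := hf.ofReal
  have hc2 : MemLp (fun x => (f x : ℂ)) 2 := hf2.ofReal
  simp only [fourierSeminorm, pow_zero, one_smul]
  refine (eLpNorm_fourier_eq hc hc2).trans (eLpNorm_congr_norm_ae (Eventually.of_forall fun x => ?_))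
  simp

theorem continuous_fourier_ofReal {f : Plane → ℝ} (hf : Integrable f) :
    Continuous (𝓕 (fun x => (f x : ℂ))) := by
  have hc : Integrable (fun x => (f x : ℂ)) := hf.ofReal
  exact continuous_fourier_of_integrable hc

theorem lintegral_norm_pow_mul_fourier_le {σ : ℝ} (hσ : 0 < σ) {f : Plane → ℝ}
    (hf : Integrable f) (n : ℕ) :
    ∫⁻ ξ, ‖(‖ξ‖ ^ n) • 𝓕 (fun x => (f x : ℂ)) ξ‖ₑ ≤
      ENNReal.ofReal σ⁻¹ * eLpNorm sobolevWeight 2 *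
        (fourierSeminorm n f + ENNReal.ofReal (σ ^ 2) * fourierSeminorm (n + 2) f) := by
  have hc := continuous_fourier_ofReal hf
  have h := lintegral_enorm_le_sobolevWeight hσ
    (h := fun ξ => (‖ξ‖ ^ n) • 𝓕 (fun x => (f x : ℂ)) ξ)
    (Continuous.aestronglyMeasurable (by fun_prop))
  simp only [smul_smul, ← pow_add, add_comm 2 n] at h
  exact h

/-- The Riesz transforms are unbounded on `L^∞`, but their symbol has modulus at most 1, so they do
not increase the `L¹` norm of the Fourier transform, which controls the supremum. -/
theorem eLpNorm_riesz_top_le (j : Fin 2) {f : Plane → ℝ} (hf : Integrable f) (hf2 : MemLp f 2) :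
    eLpNorm (riesz j f) ⊤ ≤ ∫⁻ ξ, ‖𝓕 (fun x => (f x : ℂ)) ξ‖ₑ := by
  by_cases h : ∫⁻ ξ, ‖𝓕 (fun x => (f x : ℂ)) ξ‖ₑ = ⊤
  · rw [h]
    exact le_top
  have hm := (continuous_fourier_ofReal hf).aestronglyMeasurable (μ := volume)
  have hF : Integrable (𝓕 (fun x => (f x : ℂ))) := ⟨hm, lt_top_iff_ne_top.2 h⟩
  rw [eLpNorm_exponent_top]
  refine eLpNormEssSup_le_of_ae_enorm_bound ?_
  filter_upwards [ae_abs_riesz_le j hf hf2 hF] with x hx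
  rw [← ofReal_integral_norm_eq_lintegral_enorm hF, ← ofReal_norm]
  exact ENNReal.ofReal_le_ofReal hx

theorem norm_fourier_weakDeriv_le {f : Plane → ℝ} (hf : IsRegular f) (i : Fin 2) (ξ : Plane) :
    ‖𝓕 (fun x => (weakDeriv i f x : ℂ)) ξ‖ ≤
      ‖(2 * Real.pi) • (‖ξ‖ ^ 1) • 𝓕 (fun x => (f x : ℂ)) ξ‖ := by
  rw [(hf.hasWeakDeriv i).fourier_eq hf.integrable (hf.deriv_integrable i), norm_mul, norm_mul,
    Complex.norm_I, mul_one, Complex.norm_real, norm_smul, norm_smul, ← mul_assoc, norm_mul,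
    pow_one, norm_norm]
  gcongr
  exact abs_apply_le_norm ξ i

theorem eLpNorm_weakDeriv_top_le {f : Plane → ℝ} (hf : IsRegular f) (i : Fin 2) :
    eLpNorm (weakDeriv i f) ⊤ ≤ ENNReal.ofReal (2 * Real.pi) *
      ∫⁻ ξ, ‖(‖ξ‖ ^ 1) • 𝓕 (fun x => (f x : ℂ)) ξ‖ₑ := by
  have hle : ∫⁻ ξ, ‖𝓕 (fun x => (weakDeriv i f x : ℂ)) ξ‖ₑ ≤ ENNReal.ofReal (2 * Real.pi) *
      ∫⁻ ξ, ‖(‖ξ‖ ^ 1) • 𝓕 (fun x => (f x : ℂ)) ξ‖ₑ := by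
    rw [← lintegral_const_mul' _ _ ENNReal.ofReal_ne_top]
    refine lintegral_mono fun ξ => ?_
    rw [← Real.enorm_of_nonneg (by positivity), ← enorm_smul]
    exact enorm_le_iff_norm_le.2 (norm_fourier_weakDeriv_le hf i ξ)
  refine le_trans ?_ hle
  by_cases h : ∫⁻ ξ, ‖𝓕 (fun x => (weakDeriv i f x : ℂ)) ξ‖ₑ = ⊤
  · rw [h]
    exact le_top
  have hm := (continuous_fourier_ofReal (hf.deriv_integrable i)).aestronglyMeasurable (μ := volume)
  have hF : Integrable (𝓕 (fun x => (weakDeriv i f x : ℂ))) := ⟨hm, lt_top_iff_ne_top.2 h⟩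
  have hc : Integrable (fun x => (weakDeriv i f x : ℂ)) := (hf.deriv_integrable i).ofReal
  have hc2 : MemLp (fun x => (weakDeriv i f x : ℂ)) 2 := (hf.deriv_memLp_two i).ofReal
  rw [eLpNorm_exponent_top]
  refine eLpNormEssSup_le_of_ae_enorm_bound ?_
  filter_upwards [ae_norm_le_integral_norm_fourier hc hc2 hF] with x hx
  rw [← ofReal_integral_norm_eq_lintegral_enorm hF, ← ofReal_norm]
  rw [Complex.norm_real] at hx
  exact ENNReal.ofReal_le_ofReal hx

theorem eLpNorm_weakDeriv_two_le {f : Plane → ℝ} (hf : IsRegular f) (i : Fin 2) :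
    eLpNorm (weakDeriv i f) 2 ≤ ENNReal.ofReal (2 * Real.pi) * fourierSeminorm 1 f := by
  rw [← fourierSeminorm_zero (hf.deriv_integrable i) (hf.deriv_memLp_two i), fourierSeminorm,
    fourierSeminorm, ← Real.enorm_of_nonneg (show 0 ≤ 2 * Real.pi by positivity),
    ← eLpNorm_const_smul]
  simp only [pow_zero, one_smul]
  exact eLpNorm_mono fun ξ => norm_fourier_weakDeriv_le hf i ξ

/-- Plancherel applied to `g`, whose transform is `(2π|ξ|)^n 𝓕 f`; the factor `(2π)^n ≥ 1` is
dropped. -/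
theorem fourierSeminorm_le_of_isFracDeriv {f g : Plane → ℝ} (hf : Integrable f) (n : ℕ)
    (h : IsFracDeriv n f g) (hg : MemLp g 2) : fourierSeminorm n f ≤ eLpNorm g 2 := by
  have hg2 : MemLp (fun x => (g x : ℂ)) 2 := hg.ofReal
  have hc := continuous_fourier_ofReal hf
  have hF : Continuous fun ξ : Plane =>
      (((2 * Real.pi * ‖ξ‖) ^ (n : ℝ) : ℝ) : ℂ) * 𝓕 (fun x => (f x : ℂ)) ξ := by
    simp only [Real.rpow_natCast]
    fun_prop
  have h1 := fourier_toLp_ae_eq_of_forall hg2 hF.locallyIntegrable h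
  have h2 : eLpNorm g 2 = eLpNorm (fun x => (g x : ℂ)) 2 :=
    eLpNorm_congr_norm_ae (Eventually.of_forall fun x => by simp)
  rw [h2, ← eLpNorm_fourier_toLp hg2, eLpNorm_congr_ae h1]
  refine eLpNorm_mono fun ξ => ?_
  rw [norm_smul, norm_mul, Complex.norm_real, Real.rpow_natCast, norm_pow, norm_norm, norm_pow,
    norm_mul, norm_norm, Real.norm_of_nonneg (show 0 ≤ 2 * Real.pi by positivity)]
  gcongr
  exact le_mul_of_one_le_left (norm_nonneg ξ) (by linarith [Real.pi_gt_three])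

theorem add_eLpNorm_weakDeriv_weakDeriv_le (p : ℝ≥0∞) (f : Plane → ℝ) :
    eLpNorm (weakDeriv 0 (weakDeriv 0 f)) p + eLpNorm (weakDeriv 1 (weakDeriv 1 f)) p ≤
      sobolevNorm 2 f p := by
  have h3 : ∀ i, eLpNorm (weakDeriv i (weakDeriv i f)) p ≤ sobolevNorm 1 (weakDeriv i f) p :=
    fun i => (eLpNorm_le_sobolevNorm 0 p _).trans (sobolevNorm_weakDeriv_le 0 p (weakDeriv i f) i)
  refine (add_le_add (h3 0) (h3 1)).trans ?_
  have e : sobolevNorm 2 f p = eLpNorm f p + ∑ i, sobolevNorm 1 (weakDeriv i f) p := rfl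
  rw [e, Fin.sum_univ_two]
  exact le_add_self

/-- The symbol of the Laplacian is `-(2π|ξ|)²`. This takes the place of the decay of derivatives at
times before 1, where only the regularity in `W^{2,p}` is available. -/
theorem fourierSeminorm_two_le {f : Plane → ℝ} (h1 : MemSobolev 2 f 1) (h2 : MemSobolev 2 f 2) :
    fourierSeminorm 2 f ≤ sobolevNorm 2 f 2 := by
  have hi := fun {g : Plane → ℝ} (hg : MemLp g 1) => memLp_one_iff_integrable.1 hg
  have hf := hi h1.1
  have hd := fun i => hi (h1.2 i).2.1
  have hdd := fun i => hi ((h1.2 i).2.2 i).2.memLp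
  have hdd2 := fun i => ((h2.2 i).2.2 i).2.memLp
  have hF : ∀ i ξ, 𝓕 (fun x => (weakDeriv i (weakDeriv i f) x : ℂ)) ξ =
      ((-(2 * Real.pi * ξ i) ^ 2 : ℝ) : ℂ) * 𝓕 (fun x => (f x : ℂ)) ξ := fun i ξ => by
    rw [((h1.2 i).2.2 i).1.fourier_eq (hd i) (hdd i), (h1.2 i).1.fourier_eq hf (hd i)]
    push_cast
    linear_combination (2 * Real.pi * (ξ i : ℂ)) ^ 2 * 𝓕 (fun x => (f x : ℂ)) ξ * Complex.I_sq
  have hm : ∀ i, AEStronglyMeasurable (𝓕 (fun x => (weakDeriv i (weakDeriv i f) x : ℂ))) :=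
    fun i => (continuous_fourier_ofReal (hdd i)).aestronglyMeasurable
  have hn : ∀ i, eLpNorm (𝓕 (fun x => (weakDeriv i (weakDeriv i f) x : ℂ))) 2 =
      eLpNorm (weakDeriv i (weakDeriv i f)) 2 := fun i => by
    rw [← fourierSeminorm_zero (hdd i) (hdd2 i), fourierSeminorm]
    simp only [pow_zero, one_smul]
  have hle : fourierSeminorm 2 f ≤ eLpNorm (𝓕 (fun x => (weakDeriv 0 (weakDeriv 0 f) x : ℂ)) +
      𝓕 (fun x => (weakDeriv 1 (weakDeriv 1 f) x : ℂ))) 2 := by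
    refine eLpNorm_mono fun ξ => ?_
    rw [Pi.add_apply, hF, hF, ← add_mul, norm_smul, norm_mul, ← Complex.ofReal_add,
      Complex.norm_real, norm_pow, norm_norm]
    gcongr
    have e : -(2 * Real.pi * ξ 0) ^ 2 + -(2 * Real.pi * ξ 1) ^ 2 =
        -((2 * Real.pi) ^ 2 * ‖ξ‖ ^ 2) := by
      rw [EuclideanSpace.norm_sq_eq, Fin.sum_univ_two, Real.norm_eq_abs, Real.norm_eq_abs, sq_abs,
        sq_abs]
      ring
    rw [e, norm_neg, Real.norm_of_nonneg (by positivity)]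
    refine le_mul_of_one_le_left (by positivity) (one_le_pow₀ ?_)
    linarith [Real.pi_gt_three]
  refine hle.trans ((eLpNorm_add_le (hm 0) (hm 1) one_le_two).trans ?_)
  rw [hn, hn]
  exact add_eLpNorm_weakDeriv_weakDeriv_le 2 f

theorem eLpNorm_advection_top_le {f : Plane → ℝ} (hf : IsRegular f) :
    eLpNorm (advection f) ⊤ ≤ (∫⁻ ξ, ‖𝓕 (fun x => (f x : ℂ)) ξ‖ₑ) *
      (eLpNorm (weakDeriv 0 f) ⊤ + eLpNorm (weakDeriv 1 f) ⊤) := by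
  have hR := fun j => eLpNorm_riesz_top_le j hf.integrable hf.memLp_two
  have hA : ∀ i j, ∀ᵐ x, ‖riesz j f x * weakDeriv i f x‖ₑ ≤
      (∫⁻ ξ, ‖𝓕 (fun x => (f x : ℂ)) ξ‖ₑ) * eLpNorm (weakDeriv i f) ⊤ := fun i j => by
    filter_upwards [ae_enorm_le_eLpNorm_top (riesz j f),
      ae_enorm_le_eLpNorm_top (weakDeriv i f)] with x h1 h2
    rw [enorm_mul]
    exact mul_le_mul' (h1.trans (hR j)) h2
  rw [eLpNorm_exponent_top]
  refine eLpNormEssSup_le_of_ae_enorm_bound ?_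
  filter_upwards [hA 0 1, hA 1 0] with x h1 h2
  rw [advection, mul_add]
  refine (enorm_add_le _ _).trans (add_le_add ?_ h2)
  rw [neg_mul, enorm_neg]
  exact h1

/-! ### Decay of the advection term for `α = 1` -/

/-- Order 0 is the `L²` decay of the solution, and the other orders are the decay of its derivatives
in `L²`. Orders up to 3 are needed: the supremum of `u` is controlled by orders 0 and 2, that of
`∇θ` by orders 1 and 3. -/
theorem HasDecay.exists_fourierSeminorm_le {θ₀ : Plane → ℝ} {θ : ℝ → Plane → ℝ}
    (h : IsMildSolution 1 θ₀ θ) (hd : HasDecay 1 θ) :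
    ∃ C : ℝ, 0 ≤ C ∧ ∀ n ≤ 3, ∀ s : ℝ, 1 ≤ s →
      fourierSeminorm n (θ s) ≤ ENNReal.ofReal (C * s⁻¹ ^ (n + 1)) := by
  have key : ∀ n : ℕ, ∃ C : ℝ, 0 < C ∧ ∀ s : ℝ, 1 ≤ s →
      fourierSeminorm n (θ s) ≤ ENNReal.ofReal (C * s⁻¹ ^ (n + 1)) := fun n => by
    have hhalf : (1 / 2 : ℝ≥0∞).toReal = 1 / 2 := by simp
    rcases Nat.eq_zero_or_pos n with rfl | hn
    · obtain ⟨C, hC, hb⟩ := hd.solution 2 one_le_two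
      refine ⟨C, hC, fun s hs => ?_⟩
      have hs0 : 0 < s := by linarith
      have hr := h.isRegular hs0
      rw [fourierSeminorm_zero hr.integrable hr.memLp_two]
      refine (hb s hs0).trans (ENNReal.ofReal_le_ofReal ?_)
      rw [hhalf, show -(2 / 1 : ℝ) * (1 - 1 / 2) = -1 by norm_num, Real.rpow_neg_one, zero_add,
        pow_one]
      gcongr
      linarith
    · obtain ⟨C, hC, hb⟩ := hd.derivative rfl 2 one_le_two n (by exact_mod_cast hn)
      refine ⟨C, hC, fun s hs => ?_⟩
      have hs0 : 0 < s := by linarith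
      obtain ⟨g, hg, hg2, hle⟩ := hb s hs
      refine (fourierSeminorm_le_of_isFracDeriv (h.isRegular hs0).integrable n hg hg2).trans
        (hle.trans_eq ?_)
      rw [hhalf, show (-2 * (1 - 1 / 2) - (n : ℝ)) = -((n + 1 : ℕ) : ℝ) by push_cast; ring,
        Real.rpow_neg hs0.le, Real.rpow_natCast, inv_pow]
  choose C hC hb using key
  refine ⟨∑ n ∈ Finset.range 4, C n, Finset.sum_nonneg fun n _ => (hC n).le, fun n hn s hs => ?_⟩
  have hs0 : 0 < s := by linarith
  refine (hb n s hs).trans (ENNReal.ofReal_le_ofReal ?_)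
  gcongr
  exact Finset.single_le_sum (fun n _ => (hC n).le) (Finset.mem_range.2 (by omega))

/-- In `L¹`, Cauchy–Schwarz multiplies the `L²` rates `s⁻¹` of `u` and `s⁻²` of `∇θ`; in `L^∞` the
supremum rates are `s⁻²` and `s⁻³`. -/
theorem exists_eLpNorm_advection_le_of_one_le {θ₀ : Plane → ℝ} {θ : ℝ → Plane → ℝ}
    (h : IsMildSolution 1 θ₀ θ) (hd : HasDecay 1 θ) :
    ∃ C : ℝ, 0 ≤ C ∧ ∀ s : ℝ, 1 ≤ s →
      eLpNorm (advection (θ s)) 1 ≤ ENNReal.ofReal (C * s⁻¹ ^ 3) ∧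
      eLpNorm (advection (θ s)) ⊤ ≤ ENNReal.ofReal (C * s⁻¹ ^ 5) := by
  obtain ⟨C, hC, hb⟩ := hd.exists_fourierSeminorm_le h
  set W := (eLpNorm sobolevWeight 2).toReal with hW
  have hW0 : 0 ≤ W := ENNReal.toReal_nonneg
  have hWe : eLpNorm sobolevWeight 2 = ENNReal.ofReal W :=
    (ENNReal.ofReal_toReal memLp_sobolevWeight.2.ne).symm
  have hπ : 0 ≤ 2 * Real.pi := by positivity
  -- The first summand is the constant of the `L¹` bound, the second that of the `L^∞` bound.
  refine ⟨4 * Real.pi * C ^ 2 + 16 * Real.pi * W ^ 2 * C ^ 2, by positivity, fun s hs => ?_⟩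
  have hs0 : 0 < s := by linarith
  have hr := h.isRegular hs0
  have hI : ∀ n ≤ 1, ∫⁻ ξ, ‖(‖ξ‖ ^ n) • 𝓕 (fun x => (θ s x : ℂ)) ξ‖ₑ ≤
      ENNReal.ofReal (2 * W * C * s⁻¹ ^ (n + 2)) := fun n hn => by
    -- The scale is `σ = s`, for which the seminorms of orders `n` and `n + 2` contribute equally.
    refine (lintegral_norm_pow_mul_fourier_le hs0 hr.integrable n).trans ?_
    rw [hWe]
    refine (mul_le_mul_right (add_le_add (hb n (by omega) s hs)
      (mul_le_mul_right (hb (n + 2) (by omega) s hs) _)) _).trans_eq ?_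
    rw [← ENNReal.ofReal_mul (p := s⁻¹) (by positivity),
      ← ENNReal.ofReal_mul (p := s ^ 2) (by positivity),
      ← ENNReal.ofReal_add (by positivity) (by positivity), ← ENNReal.ofReal_mul (by positivity)]
    congr 1
    have hsy := mul_inv_cancel₀ hs0.ne'
    generalize s⁻¹ = y at hsy ⊢
    linear_combination (W * C * y ^ (n + 2) * (s * y + 1)) * hsy
  have hD2 : ∀ i, eLpNorm (weakDeriv i (θ s)) 2 ≤
      ENNReal.ofReal (2 * Real.pi * (C * s⁻¹ ^ 2)) := fun i => by
    rw [ENNReal.ofReal_mul hπ]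
    exact (eLpNorm_weakDeriv_two_le hr i).trans (mul_le_mul_right (hb 1 (by norm_num) s hs) _)
  have hDi : ∀ i, eLpNorm (weakDeriv i (θ s)) ⊤ ≤
      ENNReal.ofReal (2 * Real.pi * (2 * W * C * s⁻¹ ^ 3)) := fun i => by
    rw [ENNReal.ofReal_mul hπ]
    exact (eLpNorm_weakDeriv_top_le hr i).trans (mul_le_mul_right (hI 1 le_rfl) _)
  have h0 : eLpNorm (θ s) 2 ≤ ENNReal.ofReal (C * s⁻¹ ^ 1) := by
    rw [← fourierSeminorm_zero hr.integrable hr.memLp_two]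
    exact hb 0 (by norm_num) s hs
  have hI0 := hI 0 zero_le_one
  simp only [pow_zero, one_smul] at hI0
  constructor
  · refine (eLpNorm_advection_le (h.continuous_W2p 2 one_le_two s hs0).1).trans
      ((mul_le_mul' h0 (add_le_add (hD2 0) (hD2 1))).trans ?_)
    rw [← ENNReal.ofReal_add (by positivity) (by positivity), ← ENNReal.ofReal_mul (by positivity)]
    refine ENNReal.ofReal_le_ofReal ?_
    have : 0 ≤ 16 * Real.pi * W ^ 2 * C ^ 2 * s⁻¹ ^ 3 := by positivity
    linear_combination this
  · refine (eLpNorm_advection_top_le hr).trans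
      ((mul_le_mul' hI0 (add_le_add (hDi 0) (hDi 1))).trans ?_)
    rw [← ENNReal.ofReal_add (by positivity) (by positivity), ← ENNReal.ofReal_mul (by positivity)]
    refine ENNReal.ofReal_le_ofReal ?_
    have : 0 ≤ 4 * Real.pi * C ^ 2 * s⁻¹ ^ 5 := by positivity
    linear_combination this

/-- Late times satisfy `s > t/2 ≥ 1/2`, whereas the decay of derivatives starts at time 1.
Compactness of `[1/2, 1]` and continuity in `W^{2,p}` fill the gap. -/
theorem exists_eLpNorm_advection_le_of_le_one {α : ℝ} {θ₀ : Plane → ℝ} {θ : ℝ → Plane → ℝ}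
    (h : IsMildSolution α θ₀ θ) :
    ∃ C : ℝ, 0 ≤ C ∧ ∀ s : ℝ, 1 / 2 ≤ s → s ≤ 1 →
      eLpNorm (advection (θ s)) 1 ≤ ENNReal.ofReal C ∧
      eLpNorm (advection (θ s)) ⊤ ≤ ENNReal.ofReal C := by
  have hK : Set.Icc (1 / 2 : ℝ) 1 ⊆ Set.Ioi 0 := fun s hs =>
    lt_of_lt_of_le (by norm_num) hs.1
  obtain ⟨A, hA, hA2⟩ := (h.continuous_W2p 2 one_le_two).exists_sobolevNorm_le one_le_two
    isCompact_Icc hK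
  obtain ⟨B, hB, hBi⟩ := (h.continuous_W2p ⊤ le_top).exists_sobolevNorm_le le_top
    isCompact_Icc hK
  let M := A * (A + A) + ENNReal.ofReal 1⁻¹ * eLpNorm sobolevWeight 2 *
    (A + ENNReal.ofReal (1 ^ 2) * A) * (B + B)
  have hM : M ≠ ⊤ := by
    have hAA : A + A < ⊤ := ENNReal.add_lt_top.2 ⟨hA, hA⟩
    refine (ENNReal.add_lt_top.2 ⟨ENNReal.mul_lt_top hA hAA, ENNReal.mul_lt_top (ENNReal.mul_lt_top
      (ENNReal.mul_lt_top ENNReal.ofReal_lt_top memLp_sobolevWeight.2) (ENNReal.add_lt_top.2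
      ⟨hA, ENNReal.mul_lt_top ENNReal.ofReal_lt_top hA⟩)) (ENNReal.add_lt_top.2 ⟨hB, hB⟩)⟩).ne
  refine ⟨M.toReal, ENNReal.toReal_nonneg, fun s h1 h2 => ?_⟩
  rw [ENNReal.ofReal_toReal hM]
  have hs0 : 0 < s := by linarith
  have hr := h.isRegular hs0
  have hs := h.continuous_W2p 2 one_le_two s hs0
  have hD : ∀ p i, eLpNorm (weakDeriv i (θ s)) p ≤ sobolevNorm 2 (θ s) p := fun p i =>
    (eLpNorm_le_sobolevNorm 1 p _).trans (sobolevNorm_weakDeriv_le 1 p _ i)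
  have hAs := hA2 s ⟨h1, h2⟩
  have hBs := hBi s ⟨h1, h2⟩
  have h0 := eLpNorm_le_sobolevNorm 2 2 (θ s)
  constructor
  · refine (eLpNorm_advection_le hs.1).trans (le_trans ?_ le_self_add)
    exact mul_le_mul' (h0.trans hAs) (add_le_add ((hD 2 0).trans hAs) ((hD 2 1).trans hAs))
  · have hI := lintegral_norm_pow_mul_fourier_le one_pos hr.integrable 0
    simp only [pow_zero, one_smul] at hI
    rw [fourierSeminorm_zero hr.integrable hr.memLp_two] at hI
    have h3 := fourierSeminorm_two_le (h.continuous_W2p 1 le_rfl s hs0).1 hs.1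
    refine (eLpNorm_advection_top_le hr).trans (le_trans (mul_le_mul' (hI.trans ?_)
      (add_le_add ((hD ⊤ 0).trans hBs) ((hD ⊤ 1).trans hBs))) (le_add_of_nonneg_left zero_le))
    exact mul_le_mul_right (add_le_add (h0.trans hAs) (mul_le_mul_right (h3.trans hAs) _)) _

/-- The decay of the advection term for `α = 1`. -/
theorem exists_eLpNorm_advection_le {θ₀ : Plane → ℝ} {θ : ℝ → Plane → ℝ}
    (h : IsMildSolution 1 θ₀ θ) (hd : HasDecay 1 θ) :
    ∃ C : ℝ, 0 ≤ C ∧ ∀ s : ℝ, 1 / 2 ≤ s →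
      eLpNorm (advection (θ s)) 1 ≤ ENNReal.ofReal (C * s⁻¹ ^ 3) ∧
      eLpNorm (advection (θ s)) ⊤ ≤ ENNReal.ofReal (C * s⁻¹ ^ 5) := by
  obtain ⟨A, hA, hA1⟩ := exists_eLpNorm_advection_le_of_one_le h hd
  obtain ⟨B, hB, hB1⟩ := exists_eLpNorm_advection_le_of_le_one h
  refine ⟨A + B, by positivity, fun s hs => ?_⟩
  have hs0 : 0 < s := by linarith
  rcases le_total 1 s with h1 | h1
  · have h2 := hA1 s h1
    have h3 : ∀ n : ℕ, ENNReal.ofReal (A * s⁻¹ ^ n) ≤ ENNReal.ofReal ((A + B) * s⁻¹ ^ n) :=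
      fun n => ENNReal.ofReal_le_ofReal (by gcongr; linarith)
    exact ⟨h2.1.trans (h3 3), h2.2.trans (h3 5)⟩
  · have h2 := hB1 s hs h1
    have h3 : ∀ n : ℕ, ENNReal.ofReal B ≤ ENNReal.ofReal ((A + B) * s⁻¹ ^ n) := fun n => by
      refine ENNReal.ofReal_le_ofReal ?_
      have : 1 ≤ s⁻¹ ^ n := one_le_pow₀ ((one_le_inv₀ hs0).2 h1)
      nlinarith
    exact ⟨h2.1.trans (h3 3), h2.2.trans (h3 5)⟩

/-! ### Bounds for the Duhamel integrand -/

theorem enorm_convolution_le (Q g : Plane → ℝ) (x : Plane) :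
    ‖(Q ⋆[ContinuousLinearMap.mul ℝ ℝ, volume] g) x‖ₑ ≤ ∫⁻ y, ‖Q (x - y)‖ₑ * ‖g y‖ₑ := by
  rw [convolution_eq_swap]
  refine (enorm_integral_le_lintegral_enorm _).trans_eq ?_
  simp only [ContinuousLinearMap.mul_apply', enorm_mul]

theorem enorm_convolution_le_mul_eLpNorm_top {Q : Plane → ℝ} (hQ : Continuous Q) (g : Plane → ℝ)
    (x : Plane) : ‖(Q ⋆[ContinuousLinearMap.mul ℝ ℝ, volume] g) x‖ₑ ≤
      eLpNorm Q 1 * eLpNorm g ⊤ := by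
  refine (enorm_convolution_le Q g x).trans ?_
  have hm : Measurable fun y => ‖Q (x - y)‖ₑ :=
    (hQ.comp (continuous_const.sub continuous_id)).measurable.enorm
  rw [eLpNorm_one_eq_lintegral_enorm, ← lintegral_sub_left_eq_self (fun y => ‖Q y‖ₑ) x,
    ← lintegral_mul_const _ hm]
  refine lintegral_mono_ae ?_
  filter_upwards [ae_enorm_le_eLpNorm_top g] with y hy
  gcongr

theorem lintegral_enorm_convolution_le {Q : Plane → ℝ} (hQ : Continuous Q) {g : Plane → ℝ}
    (hg : AEStronglyMeasurable g) :
    ∫⁻ x, ‖(Q ⋆[ContinuousLinearMap.mul ℝ ℝ, volume] g) x‖ₑ ≤ eLpNorm Q 1 * eLpNorm g 1 := by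
  refine (lintegral_mono (enorm_convolution_le Q g)).trans ?_
  have hm : Measurable fun p : Plane × Plane => ‖Q (p.1 - p.2)‖ₑ :=
    (hQ.comp (continuous_fst.sub continuous_snd)).measurable.enorm
  rw [lintegral_lintegral_swap (hm.aemeasurable.mul hg.comp_snd.enorm)]
  rw [eLpNorm_one_eq_lintegral_enorm (f := g), ← lintegral_const_mul'' _ hg.enorm]
  refine lintegral_mono fun y => ?_
  rw [lintegral_mul_const' _ _ enorm_ne_top, lintegral_sub_right_eq_self (fun x => ‖Q x‖ₑ) y,
    eLpNorm_one_eq_lintegral_enorm]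

/-- The decay of the solution in `L¹` and in `L^∞`. -/
theorem HasDecay.exists_eLpNorm_le {α : ℝ} {θ : ℝ → Plane → ℝ} (hd : HasDecay α θ) :
    ∃ A : ℝ, 0 < A ∧ ∀ s : ℝ, 0 < s → eLpNorm (θ s) 1 ≤ ENNReal.ofReal A ∧
      eLpNorm (θ s) ⊤ ≤ ENNReal.ofReal (A * ((1 + s) ^ (1 / α)) ^ (-2 : ℝ)) := by
  obtain ⟨A, hA, h1⟩ := hd.solution 1 le_rfl
  obtain ⟨B, hB, h2⟩ := hd.solution ⊤ le_top
  refine ⟨A + B, by positivity, fun s hs => ⟨(h1 s hs).trans (ENNReal.ofReal_le_ofReal ?_),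
    (h2 s hs).trans (ENNReal.ofReal_le_ofReal ?_)⟩⟩
  · simp
    exact hB.le
  · rw [← Real.rpow_mul (by positivity), add_comm s,
      show -(2 / α) * (1 - (1 / (⊤ : ℝ≥0∞)).toReal) = 1 / α * -2 by simp; ring]
    gcongr
    linarith

section Bounds

variable {α : ℝ} {θ₀ : Plane → ℝ} {θ : ℝ → Plane → ℝ}

/-- The splitting radius is `(1+s)^{1/α}`: there the two terms of the energy estimate have the same
size `(1+s)^{-(2-ε)/α}`. -/
theorem exists_lintegral_duhamelIntegrand_le (hα1 : 1 ≤ α) (hα2 : α ≤ 2)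
    (h : IsMildSolution α θ₀ θ) (hd : HasDecay α θ) {ε : ℝ} (hε : 0 < ε) (hε1 : ε ≤ 1) :
    ∃ C : ℝ, 0 ≤ C ∧ ∀ s t : ℝ, 0 < s → s < t → ∫⁻ x, ‖duhamelIntegrand α θ t s x‖ₑ ≤
      ENNReal.ofReal (C * ((t - s) ^ (-((1 + ε) / α)) * (1 + s) ^ (-((2 - ε) / α)))) := by
  obtain ⟨A, hA, hb⟩ := hd.exists_eLpNorm_le
  obtain ⟨K, hK, hk⟩ := exists_lintegral_pairModulus_heatKernel_le hα1 hα2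
  have hD := discIntegral_nonneg hε
  refine ⟨K * A ^ 2 * (discIntegral ε + 1), by positivity, fun s t hs hst => ?_⟩
  have hτ : 0 < t - s := sub_pos.2 hst
  have hs1 : 0 < 1 + s := by linarith
  have hr : 0 < (1 + s) ^ (1 / α) := by positivity
  obtain ⟨h1, h2⟩ := hb s hs
  refine ((h.isRegular hs).lintegral_convolution_advection_le
    (isBoundedSmooth_heatKernel (by linarith) hτ) (by positivity) hr hε (by linarith)
    (hk _ hτ ε hε hε1)).trans ?_
  refine (mul_le_mul_right (mul_le_mul' h1 (add_le_add (mul_le_mul_left h2 _)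
    (mul_le_mul_left h1 _))) _).trans_eq ?_
  have e1 : (1 + s) ^ (-((2 - ε) / α)) = ((1 + s) ^ (1 / α)) ^ (ε - 2) := by
    rw [← Real.rpow_mul hs1.le]
    congr 1
    ring
  have e2 : ((1 + s) ^ (1 / α)) ^ (ε - 2) =
      ((1 + s) ^ (1 / α)) ^ ε * ((1 + s) ^ (1 / α)) ^ (-2 : ℝ) := by
    rw [← Real.rpow_add hr]
    rfl
  rw [e1, e2, ← ENNReal.ofReal_mul (by positivity), ← ENNReal.ofReal_mul hA.le,
    ← ENNReal.ofReal_add (by positivity) (by positivity), ← ENNReal.ofReal_mul hA.le,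
    ← ENNReal.ofReal_mul (by positivity)]
  congr 1
  ring

/-- Here the gain comes from the Lipschitz constant of the gradient of the kernel. The power
`(t-s)^{-4/α}` is not integrable at `s = t`, so the bound serves `s ≤ t/2` only. -/
theorem exists_enorm_duhamelIntegrand_le_far (hα1 : 1 ≤ α)
    (h : IsMildSolution α θ₀ θ) (hd : HasDecay α θ) :
    ∃ C : ℝ, 0 ≤ C ∧ ∀ s t : ℝ, 0 < s → s < t → ∀ x, ‖duhamelIntegrand α θ t s x‖ₑ ≤
      ENNReal.ofReal (C * ((t - s) ^ (-(4 / α)) * (1 + s) ^ (-(1 / α)))) := by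
  obtain ⟨A, hA, hb⟩ := hd.exists_eLpNorm_le
  obtain ⟨K, hK, hk⟩ := exists_pairModulus_heatKernel_le (α := α) (by linarith)
  have hD := discIntegral_nonneg one_pos
  refine ⟨K * A ^ 2 * (discIntegral 1 + 1), by positivity, fun s t hs hst x => ?_⟩
  have hτ : 0 < t - s := sub_pos.2 hst
  have hs1 : 0 < 1 + s := by linarith
  have hr : 0 < (1 + s) ^ (1 / α) := by positivity
  obtain ⟨h1, h2⟩ := hb s hs
  refine ((h.isRegular hs).enorm_convolution_advection_le_of_lipschitz
    (isBoundedSmooth_heatKernel (by linarith) hτ) (by positivity) hr (hk _ hτ) x).trans ?_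
  refine (mul_le_mul_right (mul_le_mul' h1 (add_le_add (mul_le_mul_left h2 _)
    (mul_le_mul_left h1 _))) _).trans_eq ?_
  have e1 : (1 + s) ^ (-(1 / α)) = ((1 + s) ^ (1 / α)) ^ (1 - 2 : ℝ) := by
    rw [← Real.rpow_mul hs1.le]
    congr 1
    ring
  have e2 : ((1 + s) ^ (1 / α)) ^ (1 - 2 : ℝ) =
      ((1 + s) ^ (1 / α)) ^ (1 : ℝ) * ((1 + s) ^ (1 / α)) ^ (-2 : ℝ) := by
    rw [← Real.rpow_add hr]
    rfl
  rw [e1, e2, ← ENNReal.ofReal_mul (by positivity), ← ENNReal.ofReal_mul hA.le,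
    ← ENNReal.ofReal_add (by positivity) (by positivity), ← ENNReal.ofReal_mul hA.le,
    ← ENNReal.ofReal_mul (by positivity)]
  congr 1
  ring

/-- Putting the `L^∞` norm on the solution gives more decay in `s` and a milder singularity at `s =
t`, integrable as soon as `1 + ε < α`. -/
theorem exists_enorm_duhamelIntegrand_le_near (hα1 : 1 ≤ α) (hα2 : α ≤ 2)
    (h : IsMildSolution α θ₀ θ) (hd : HasDecay α θ) {ε : ℝ} (hε : 0 < ε) (hε1 : ε ≤ 1) :
    ∃ C : ℝ, 0 ≤ C ∧ ∀ s t : ℝ, 0 < s → s < t → ∀ x, ‖duhamelIntegrand α θ t s x‖ₑ ≤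
      ENNReal.ofReal (C * ((t - s) ^ (-((1 + ε) / α)) * (1 + s) ^ (-((4 - ε) / α)))) +
      ENNReal.ofReal (C * ((t - s) ^ (-(1 / α)) * (1 + s) ^ (-(4 / α)))) := by
  obtain ⟨A, hA, hb⟩ := hd.exists_eLpNorm_le
  obtain ⟨K, hK, hk⟩ := exists_lintegral_pairModulus_heatKernel_le hα1 hα2
  obtain ⟨B, hB, hB'⟩ := exists_lintegral_gradSum_heatKernel_le hα1 hα2
  have hD := discIntegral_nonneg hε
  refine ⟨K * A ^ 2 * discIntegral ε + 2 * A ^ 2 * B, by positivity, fun s t hs hst x => ?_⟩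
  have hτ : 0 < t - s := sub_pos.2 hst
  have hs1 : 0 < 1 + s := by linarith
  have hr : 0 < (1 + s) ^ (1 / α) := by positivity
  obtain ⟨h1, h2⟩ := hb s hs
  refine ((h.isRegular hs).enorm_convolution_advection_le_of_lintegral
    (isBoundedSmooth_heatKernel (by linarith) hτ) (by positivity) hr hε (by linarith)
    (hk _ hτ ε hε hε1) x).trans ?_
  have e1 : (1 + s) ^ (-((4 - ε) / α)) = ((1 + s) ^ (1 / α)) ^ ε *
      (((1 + s) ^ (1 / α)) ^ (-2 : ℝ) * ((1 + s) ^ (1 / α)) ^ (-2 : ℝ)) := by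
    rw [← Real.rpow_add hr, ← Real.rpow_add hr, ← Real.rpow_mul hs1.le]
    congr 1
    ring
  have e2 : (1 + s) ^ (-(4 / α)) =
      ((1 + s) ^ (1 / α)) ^ (-2 : ℝ) * ((1 + s) ^ (1 / α)) ^ (-2 : ℝ) := by
    rw [← Real.rpow_add hr, ← Real.rpow_mul hs1.le]
    congr 1
    ring
  rw [e1, e2]
  set q := ((1 + s) ^ (1 / α)) ^ (-2 : ℝ)
  set v := ((1 + s) ^ (1 / α)) ^ ε
  have hq : 0 ≤ q := by positivity
  have hv : 0 ≤ v := by positivity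
  refine add_le_add ((mul_le_mul_left (mul_le_mul' h2 h2) _).trans ?_)
    ((mul_le_mul_right (mul_le_mul' (mul_le_mul' h2 h1) (mul_le_mul_left (hB' _ hτ) _)) _).trans ?_)
  · rw [← ENNReal.ofReal_mul (by positivity), ← ENNReal.ofReal_mul (by positivity),
      ← ENNReal.ofReal_mul (by positivity)]
    refine ENNReal.ofReal_le_ofReal ?_
    have : 0 ≤ 2 * A ^ 2 * B * ((t - s) ^ (-((1 + ε) / α)) * (v * (q * q))) := by positivity
    linear_combination this
  · rw [← ENNReal.ofReal_mul (by positivity), ← ENNReal.ofReal_mul (by positivity),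
      ← ENNReal.ofReal_mul (by positivity), show (2 : ℝ≥0∞) = ENNReal.ofReal 2 by simp,
      ← ENNReal.ofReal_mul (by positivity)]
    refine ENNReal.ofReal_le_ofReal ?_
    have : 0 ≤ K * A ^ 2 * discIntegral ε * ((t - s) ^ (-(1 / α)) * (q * q)) := by positivity
    linear_combination this

/-- Young's inequality with the kernel in `L¹`, without any derivative on it. The trivial factor `(t
- s) ^ (-0)` gives the bound the form that `exists_lintegral_near_le` integrates. -/
theorem exists_duhamelIntegrand_one_le (h : IsMildSolution 1 θ₀ θ) (hd : HasDecay 1 θ) :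
    ∃ C : ℝ, 0 ≤ C ∧ ∀ s t : ℝ, 1 / 2 ≤ s → s < t →
      ∫⁻ x, ‖duhamelIntegrand 1 θ t s x‖ₑ ≤
        ENNReal.ofReal (C * ((t - s) ^ (-0 : ℝ) * (1 + s) ^ (-3 : ℝ))) ∧
      ∀ x, ‖duhamelIntegrand 1 θ t s x‖ₑ ≤
        ENNReal.ofReal (C * ((t - s) ^ (-0 : ℝ) * (1 + s) ^ (-5 : ℝ))) := by
  obtain ⟨A, hA, hb⟩ := exists_eLpNorm_advection_le h hd
  obtain ⟨B, hB, hk⟩ := exists_eLpNorm_heatKernel_one_le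
  -- For `s ≥ 1/2` one has `s⁻¹ ≤ 3 (1+s)⁻¹`, and powers up to the fifth are needed.
  refine ⟨B * (A * 3 ^ 5), by positivity, fun s t hs hst => ?_⟩
  have hτ : 0 < t - s := sub_pos.2 hst
  have hs0 : 0 < s := by linarith
  have hc := (contDiff_heatKernel (α := 1) one_pos hτ).continuous
  obtain ⟨h1, h2⟩ := hb s hs
  have hle : ∀ n : ℕ, n ≤ 5 → s⁻¹ ^ n ≤ 3 ^ 5 * (1 + s) ^ (-(n : ℝ)) := fun n hn => by
    rw [Real.rpow_neg (by positivity), Real.rpow_natCast, ← inv_pow]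
    have h3 : s⁻¹ ≤ 3 * (1 + s)⁻¹ := by
      rw [← div_eq_mul_inv, inv_le_comm₀ hs0 (by positivity), inv_div]
      linarith
    calc s⁻¹ ^ n ≤ (3 * (1 + s)⁻¹) ^ n := by gcongr
      _ = 3 ^ n * (1 + s)⁻¹ ^ n := mul_pow _ _ _
      _ ≤ _ := by
        gcongr
        norm_num
  have hle' : ∀ n : ℕ, n ≤ 5 → ENNReal.ofReal B * ENNReal.ofReal (A * s⁻¹ ^ n) ≤
      ENNReal.ofReal (B * (A * 3 ^ 5) * ((t - s) ^ (-0 : ℝ) * (1 + s) ^ (-(n : ℝ)))) :=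
    fun n hn => by
      rw [← ENNReal.ofReal_mul hB, neg_zero, Real.rpow_zero, one_mul, mul_assoc, mul_assoc]
      refine ENNReal.ofReal_le_ofReal ?_
      gcongr
      exact hle n hn
  constructor
  · refine (lintegral_enorm_convolution_le hc
      (aestronglyMeasurable_advection (h.continuous_W2p 2 one_le_two s hs0).1)).trans
      ((mul_le_mul' (hk _ hτ) h1).trans ?_)
    exact_mod_cast hle' 3 (by norm_num)
  · intro x
    refine (enorm_convolution_le_mul_eLpNorm_top hc _ x).trans
      ((mul_le_mul' (hk _ hτ) h2).trans ?_)
    exact_mod_cast hle' 5 le_rfl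

end Bounds

/-! ### Integrals in time -/

/-- On this interval `1 + s ≥ t/2`, and the singularity at `s = t` is integrable because `a < 1`. -/
theorem exists_lintegral_near_le {a b : ℝ} (ha : a < 1) (hb : 0 ≤ b) :
    ∃ C : ℝ, 0 ≤ C ∧ ∀ t : ℝ, 0 < t → ∫⁻ s in Set.Ioo (t / 2) t,
      ENNReal.ofReal ((t - s) ^ (-a) * (1 + s) ^ (-b)) ≤ ENNReal.ofReal (C * t ^ (1 - a - b)) := by
  have h1a : 0 < 1 - a := by linarith
  refine ⟨(1 / 2) ^ (1 - a - b) / (1 - a), by positivity, fun t ht => ?_⟩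
  have ht2 : 0 < t / 2 := by positivity
  have hi : IntervalIntegrable (fun s => (t - s) ^ (-a)) volume (t / 2) t := by
    have := (intervalIntegral.intervalIntegrable_rpow' (a := t - t / 2) (b := 0) (r := -a)
      (by linarith)).comp_sub_left t
    simpa using this
  have hv : ∫ s in (t / 2)..t, (t - s) ^ (-a) = (t / 2) ^ (1 - a) / (1 - a) := by
    rw [intervalIntegral.integral_comp_sub_left (fun u => u ^ (-a)) t, sub_self,
      integral_rpow (Or.inl (by linarith)), Real.zero_rpow (by linarith), sub_zero,
      show t - t / 2 = t / 2 by ring, show -a + 1 = 1 - a by ring]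
  calc ∫⁻ s in Set.Ioo (t / 2) t, ENNReal.ofReal ((t - s) ^ (-a) * (1 + s) ^ (-b))
      ≤ ∫⁻ s in Set.Ioo (t / 2) t, ENNReal.ofReal ((t / 2) ^ (-b)) *
          ENNReal.ofReal ((t - s) ^ (-a)) := by
        refine setLIntegral_mono' measurableSet_Ioo fun s hs => ?_
        have h0 : 0 < t - s := sub_pos.2 hs.2
        rw [← ENNReal.ofReal_mul (by positivity), mul_comm]
        refine ENNReal.ofReal_le_ofReal ?_
        gcongr ?_ * _
        exact Real.rpow_le_rpow_of_nonpos ht2 (by linarith [hs.1]) (by linarith)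
    _ = ENNReal.ofReal ((t / 2) ^ (-b)) * ENNReal.ofReal ((t / 2) ^ (1 - a) / (1 - a)) := by
        rw [lintegral_const_mul' _ _ ENNReal.ofReal_ne_top, ← hv,
          intervalIntegral.integral_of_le (by linarith), integral_Ioc_eq_integral_Ioo,
          ofReal_integral_eq_lintegral_ofReal]
        · exact (intervalIntegrable_iff_integrableOn_Ioo_of_le (by linarith)).1 hi
        · filter_upwards [ae_restrict_mem measurableSet_Ioo] with s hs
          have h0 : 0 < t - s := sub_pos.2 hs.2
          change (0 : ℝ) ≤ _
          positivity
    _ = _ := by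
        rw [← ENNReal.ofReal_mul (by positivity)]
        congr 1
        rw [mul_div_assoc', ← Real.rpow_add ht2, show -b + (1 - a) = 1 - a - b by ring,
          div_eq_mul_one_div t 2, Real.mul_rpow ht.le (by norm_num)]
        ring

/-- The logarithmic correction of the decay rate. -/
def logFactor (α t : ℝ) : ℝ := if α = 1 then 1 + Real.log t else 1

theorem one_le_logFactor (α : ℝ) {t : ℝ} (ht : 1 ≤ t) : 1 ≤ logFactor α t := by
  unfold logFactor
  split_ifs
  · linarith [Real.log_nonneg ht]
  · exact le_rfl

/-- The only source of the logarithm: the exponent is `-1` exactly when `α = 1`, and greater than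
`-1` otherwise. -/
theorem exists_integral_one_add_rpow_le {α : ℝ} (hα : 1 ≤ α) :
    ∃ C : ℝ, 0 ≤ C ∧ ∀ t : ℝ, 1 ≤ t → ∫ s in (0 : ℝ)..(t / 2), (1 + s) ^ (-(1 / α)) ≤
      C * (t ^ (1 - 1 / α) * logFactor α t) := by
  rcases hα.eq_or_lt with rfl | hα
  · refine ⟨1, zero_le_one, fun t ht => ?_⟩
    have ht0 : 0 < t := by linarith
    simp only [logFactor, if_true, div_one, sub_self, Real.rpow_zero, one_mul, Real.rpow_neg_one]
    rw [intervalIntegral.integral_comp_add_left (fun s => s⁻¹), add_zero,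
      integral_inv_of_pos one_pos (by linarith), div_one]
    calc Real.log (1 + t / 2) ≤ Real.log (Real.exp 1 * t) :=
          Real.log_le_log (by linarith) (by nlinarith [Real.exp_one_gt_d9])
      _ = 1 + Real.log t := by
          rw [Real.log_mul (Real.exp_pos 1).ne' ht0.ne', Real.log_exp]
  · have hb : 1 / α < 1 := (div_lt_one (by linarith)).2 hα
    have h1b : 0 < 1 - 1 / α := by linarith
    refine ⟨2 ^ (1 - 1 / α) / (1 - 1 / α), by positivity, fun t ht => ?_⟩
    have ht0 : 0 < t := by linarith
    rw [logFactor, if_neg hα.ne', mul_one,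
      intervalIntegral.integral_comp_add_left (fun s => s ^ (-(1 / α))), add_zero,
      integral_rpow (Or.inl (by linarith)), Real.one_rpow, show -(1 / α) + 1 = 1 - 1 / α by ring,
      div_mul_eq_mul_div, ← Real.mul_rpow (by norm_num) ht0.le]
    gcongr
    have h2 : (1 + t / 2) ^ (1 - 1 / α) ≤ (2 * t) ^ (1 - 1 / α) :=
      Real.rpow_le_rpow (by positivity) (by linarith) h1b.le
    linarith

theorem exists_lintegral_far_le {α a : ℝ} (hα : 1 ≤ α) (ha : 0 ≤ a) :
    ∃ C : ℝ, 0 ≤ C ∧ ∀ t : ℝ, 1 ≤ t → ∫⁻ s in Set.Ioc 0 (t / 2),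
      ENNReal.ofReal ((t - s) ^ (-a) * (1 + s) ^ (-(1 / α))) ≤
        ENNReal.ofReal (C * (t ^ (1 - 1 / α - a) * logFactor α t)) := by
  obtain ⟨C, hC, hb⟩ := exists_integral_one_add_rpow_le hα
  refine ⟨(1 / 2) ^ (-a) * C, by positivity, fun t ht => ?_⟩
  have ht0 : 0 < t := by linarith
  have ht2 : 0 < t / 2 := by positivity
  have hi : IntervalIntegrable (fun s : ℝ => (1 + s) ^ (-(1 / α))) volume 0 (t / 2) := by
    refine ContinuousOn.intervalIntegrable fun s hs => ?_
    rw [Set.uIcc_of_le ht2.le] at hs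
    exact ((continuousAt_const.add continuousAt_id).rpow_const
      (Or.inl (by linarith [hs.1] : (1 : ℝ) + s ≠ 0))).continuousWithinAt
  calc ∫⁻ s in Set.Ioc 0 (t / 2), ENNReal.ofReal ((t - s) ^ (-a) * (1 + s) ^ (-(1 / α)))
      ≤ ∫⁻ s in Set.Ioc 0 (t / 2), ENNReal.ofReal ((t / 2) ^ (-a)) *
          ENNReal.ofReal ((1 + s) ^ (-(1 / α))) := by
        refine setLIntegral_mono' measurableSet_Ioc fun s hs => ?_
        have h0 : 0 < 1 + s := by linarith [hs.1]
        rw [← ENNReal.ofReal_mul (by positivity)]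
        refine ENNReal.ofReal_le_ofReal ?_
        gcongr ?_ * _
        exact Real.rpow_le_rpow_of_nonpos ht2 (by linarith [hs.2]) (by linarith)
    _ = ENNReal.ofReal ((t / 2) ^ (-a)) *
          ENNReal.ofReal (∫ s in (0 : ℝ)..(t / 2), (1 + s) ^ (-(1 / α))) := by
        rw [lintegral_const_mul' _ _ ENNReal.ofReal_ne_top,
          intervalIntegral.integral_of_le ht2.le, ofReal_integral_eq_lintegral_ofReal hi.1]
        filter_upwards [ae_restrict_mem measurableSet_Ioc] with s hs
        have h0 : 0 < 1 + s := by linarith [hs.1]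
        change (0 : ℝ) ≤ _
        positivity
    _ ≤ ENNReal.ofReal ((t / 2) ^ (-a)) *
          ENNReal.ofReal (C * (t ^ (1 - 1 / α) * logFactor α t)) := by
        gcongr
        exact hb t ht
    _ = _ := by
        rw [← ENNReal.ofReal_mul (by positivity)]
        congr 1
        rw [show 1 - 1 / α - a = -a + (1 - 1 / α) by ring, Real.rpow_add ht0,
          div_eq_mul_one_div t 2, Real.mul_rpow ht0.le (by norm_num)]
        ring

/-! ### Bounds for the Duhamel term -/

theorem setLIntegral_Ioo_le (g : ℝ → ℝ≥0∞) {t : ℝ} :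
    ∫⁻ s in Set.Ioo 0 t, g s ≤
      (∫⁻ s in Set.Ioc 0 (t / 2), g s) + ∫⁻ s in Set.Ioo (t / 2) t, g s := by
  refine (lintegral_mono_set fun s hs => ?_).trans (lintegral_union_le g _ _)
  rcases le_or_gt s (t / 2) with h | h
  · exact Or.inl ⟨hs.1, h⟩
  · exact Or.inr ⟨h, hs.2⟩

theorem setLIntegral_le_of_forall_le {S : Set ℝ} (hS : MeasurableSet S) {g : ℝ → ℝ≥0∞}
    {h : ℝ → ℝ} {C B : ℝ} (hC : 0 ≤ C) (hg : ∀ s ∈ S, g s ≤ ENNReal.ofReal (C * h s))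
    (hh : ∫⁻ s in S, ENNReal.ofReal (h s) ≤ ENNReal.ofReal B) :
    ∫⁻ s in S, g s ≤ ENNReal.ofReal (C * B) := by
  rw [ENNReal.ofReal_mul hC]
  refine (setLIntegral_mono' hS hg).trans (le_trans (le_of_eq ?_) (mul_le_mul_right hh _))
  simp only [ENNReal.ofReal_mul hC]
  exact lintegral_const_mul' _ _ ENNReal.ofReal_ne_top

section Bounds

variable {α : ℝ} {θ₀ : Plane → ℝ} {θ : ℝ → Plane → ℝ}

theorem exists_lintegral_lintegral_near_le (hα1 : 1 ≤ α) (hα2 : α ≤ 2)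
    (h : IsMildSolution α θ₀ θ) (hd : HasDecay α θ) :
    ∃ C : ℝ, 0 ≤ C ∧ ∀ t : ℝ, 1 ≤ t →
      ∫⁻ s in Set.Ioo (t / 2) t, ∫⁻ x, ‖duhamelIntegrand α θ t s x‖ₑ ≤
        ENNReal.ofReal (C * t ^ (1 - 3 / α)) := by
  rcases hα1.eq_or_lt with rfl | hα
  · obtain ⟨C, hC, hb⟩ := exists_duhamelIntegrand_one_le h hd
    obtain ⟨B, hB, hB'⟩ := exists_lintegral_near_le (a := 0) (b := 3) one_pos (by norm_num)
    refine ⟨C * B, by positivity, fun t ht => ?_⟩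
    refine (setLIntegral_le_of_forall_le measurableSet_Ioo hC
      (fun s hs => (hb s t (by linarith [hs.1]) hs.2).1) (hB' t (by linarith))).trans_eq ?_
    rw [mul_assoc, show (1 : ℝ) - 0 - 3 = 1 - 3 / 1 by norm_num]
  · have hα0 : 0 < α := by linarith
    -- Any positive `ε < α - 1` with `ε ≤ 1` makes `(1+ε)/α < 1`; half of `α - 1` is such a choice.
    -- The final power does not see `ε`, since `(1+ε) + (2-ε) = 3`.
    obtain ⟨C, hC, hb⟩ := exists_lintegral_duhamelIntegrand_le hα1 hα2 h hd
      (ε := (α - 1) / 2) (by linarith) (by linarith)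
    obtain ⟨B, hB, hB'⟩ := exists_lintegral_near_le (a := (1 + (α - 1) / 2) / α)
      (b := (2 - (α - 1) / 2) / α) ((div_lt_one hα0).2 (by linarith))
      (div_nonneg (by linarith) hα0.le)
    refine ⟨C * B, by positivity, fun t ht => ?_⟩
    refine (setLIntegral_le_of_forall_le measurableSet_Ioo hC
      (fun s hs => hb s t (by linarith [hs.1]) hs.2) (hB' t (by linarith))).trans_eq ?_
    have e : 1 - (1 + (α - 1) / 2) / α - (2 - (α - 1) / 2) / α = 1 - 3 / α := by
      field_simp
      ring
    rw [mul_assoc, e]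

theorem exists_lintegral_enorm_near_le (hα1 : 1 ≤ α) (hα2 : α ≤ 2)
    (h : IsMildSolution α θ₀ θ) (hd : HasDecay α θ) :
    ∃ C : ℝ, 0 ≤ C ∧ ∀ t : ℝ, 1 ≤ t → ∀ x,
      ∫⁻ s in Set.Ioo (t / 2) t, ‖duhamelIntegrand α θ t s x‖ₑ ≤
        ENNReal.ofReal (C * t ^ (1 - 5 / α)) := by
  rcases hα1.eq_or_lt with rfl | hα
  · obtain ⟨C, hC, hb⟩ := exists_duhamelIntegrand_one_le h hd
    obtain ⟨B, hB, hB'⟩ := exists_lintegral_near_le (a := 0) (b := 5) one_pos (by norm_num)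
    refine ⟨C * B, by positivity, fun t ht x => ?_⟩
    refine (setLIntegral_le_of_forall_le measurableSet_Ioo hC
      (fun s hs => (hb s t (by linarith [hs.1]) hs.2).2 x) (hB' t (by linarith))).trans_eq ?_
    rw [mul_assoc, show (1 : ℝ) - 0 - 5 = 1 - 5 / 1 by norm_num]
  · have hα0 : 0 < α := by linarith
    -- The same `ε`; both terms lead to the power `1 - 5/α`, since `(1+ε) + (4-ε) = 1 + 4 = 5`.
    obtain ⟨C, hC, hb⟩ := exists_enorm_duhamelIntegrand_le_near hα1 hα2 h hd
      (ε := (α - 1) / 2) (by linarith) (by linarith)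
    obtain ⟨B, hB, hB'⟩ := exists_lintegral_near_le (a := (1 + (α - 1) / 2) / α)
      (b := (4 - (α - 1) / 2) / α) ((div_lt_one hα0).2 (by linarith))
      (div_nonneg (by linarith) hα0.le)
    obtain ⟨D, hD, hD'⟩ := exists_lintegral_near_le (a := 1 / α) (b := 4 / α)
      ((div_lt_one hα0).2 hα) (by positivity)
    refine ⟨C * B + C * D, by positivity, fun t ht x => ?_⟩
    have ht0 : 0 < t := by linarith
    have e1 : 1 - (1 + (α - 1) / 2) / α - (4 - (α - 1) / 2) / α = 1 - 5 / α := by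
      field_simp
      ring
    have e2 : 1 - 1 / α - 4 / α = 1 - 5 / α := by ring
    have hB1 := hB' t ht0
    have hD1 := hD' t ht0
    rw [e1] at hB1
    rw [e2] at hD1
    have hm : Measurable fun s : ℝ => ENNReal.ofReal
        (C * ((t - s) ^ (-((1 + (α - 1) / 2) / α)) * (1 + s) ^ (-((4 - (α - 1) / 2) / α)))) := by
      fun_prop
    calc _ ≤ ∫⁻ s in Set.Ioo (t / 2) t, (ENNReal.ofReal
          (C * ((t - s) ^ (-((1 + (α - 1) / 2) / α)) * (1 + s) ^ (-((4 - (α - 1) / 2) / α)))) +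
          ENNReal.ofReal (C * ((t - s) ^ (-(1 / α)) * (1 + s) ^ (-(4 / α))))) :=
          setLIntegral_mono' measurableSet_Ioo fun s hs => hb s t (by linarith [hs.1]) hs.2 x
      _ ≤ ENNReal.ofReal (C * (B * t ^ (1 - 5 / α))) +
          ENNReal.ofReal (C * (D * t ^ (1 - 5 / α))) := by
          rw [lintegral_add_left hm]
          exact add_le_add (setLIntegral_le_of_forall_le measurableSet_Ioo hC
            (fun s _ => le_rfl) hB1)
            (setLIntegral_le_of_forall_le measurableSet_Ioo hC (fun s _ => le_rfl) hD1)
      _ = _ := by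
          rw [← ENNReal.ofReal_add (by positivity) (by positivity)]
          congr 1
          ring

theorem ofReal_mul_rpow_add_le {C B e t : ℝ} (hC : 0 ≤ C) (hB : 0 ≤ B) (ht : 1 ≤ t) :
    ENNReal.ofReal (B * (t ^ e * logFactor α t)) + ENNReal.ofReal (C * t ^ e) ≤
      ENNReal.ofReal ((B + C) * logFactor α t * t ^ e) := by
  have h1 := one_le_logFactor α ht
  have ht0 : 0 < t := by linarith
  have h2 : 0 ≤ t ^ e := by positivity
  have h3 : 0 ≤ logFactor α t := by linarith
  rw [← ENNReal.ofReal_add (by positivity) (by positivity)]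
  refine ENNReal.ofReal_le_ofReal ?_
  have h4 : 0 ≤ C * t ^ e * (logFactor α t - 1) := mul_nonneg (by positivity) (by linarith)
  linear_combination h4

/-- The bound for the Duhamel term in `L¹`. -/
theorem exists_lintegral_lintegral_duhamelIntegrand_le (hα1 : 1 ≤ α) (hα2 : α ≤ 2)
    (h : IsMildSolution α θ₀ θ) (hd : HasDecay α θ) :
    ∃ C : ℝ, 0 ≤ C ∧ ∀ t : ℝ, 1 ≤ t →
      ∫⁻ s in Set.Ioo 0 t, ∫⁻ x, ‖duhamelIntegrand α θ t s x‖ₑ ≤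
        ENNReal.ofReal (C * logFactor α t * t ^ (1 - 3 / α)) := by
  have hα0 : 0 < α := by linarith
  obtain ⟨C, hC, hnear⟩ := exists_lintegral_lintegral_near_le hα1 hα2 h hd
  -- At early times `ε = 1` uses the full second derivative of the kernel, which yields
  -- `(t-s)^{-2/α} (1+s)^{-1/α}`.
  obtain ⟨D, hD, hb⟩ := exists_lintegral_duhamelIntegrand_le hα1 hα2 h hd one_pos le_rfl
  obtain ⟨B, hB, hB'⟩ := exists_lintegral_far_le (α := α) (a := (1 + 1) / α) hα1 (by positivity)
  refine ⟨D * B + C, by positivity, fun t ht => (setLIntegral_Ioo_le _).trans ?_⟩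
  refine le_trans (add_le_add (setLIntegral_le_of_forall_le measurableSet_Ioc hD
    (fun s hs => ?_) (hB' t ht)) (hnear t ht)) ?_
  · have := hb s t hs.1 (by linarith [hs.2])
    rwa [show (2 - 1 : ℝ) / α = 1 / α by norm_num] at this
  · rw [← mul_assoc, show 1 - 1 / α - (1 + 1) / α = 1 - 3 / α by ring]
    exact ofReal_mul_rpow_add_le hC (by positivity) ht

/-- The bound for the Duhamel term in `L^∞`. -/
theorem exists_lintegral_enorm_duhamelIntegrand_le (hα1 : 1 ≤ α) (hα2 : α ≤ 2)
    (h : IsMildSolution α θ₀ θ) (hd : HasDecay α θ) :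
    ∃ C : ℝ, 0 ≤ C ∧ ∀ t : ℝ, 1 ≤ t → ∀ x,
      ∫⁻ s in Set.Ioo 0 t, ‖duhamelIntegrand α θ t s x‖ₑ ≤
        ENNReal.ofReal (C * logFactor α t * t ^ (1 - 5 / α)) := by
  have hα0 : 0 < α := by linarith
  obtain ⟨C, hC, hnear⟩ := exists_lintegral_enorm_near_le hα1 hα2 h hd
  obtain ⟨D, hD, hb⟩ := exists_enorm_duhamelIntegrand_le_far hα1 h hd
  obtain ⟨B, hB, hB'⟩ := exists_lintegral_far_le (α := α) (a := 4 / α) hα1 (by positivity)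
  refine ⟨D * B + C, by positivity, fun t ht x => (setLIntegral_Ioo_le _).trans ?_⟩
  refine le_trans (add_le_add (setLIntegral_le_of_forall_le measurableSet_Ioc hD
    (fun s hs => hb s t hs.1 (by linarith [hs.2]) x) (hB' t ht)) (hnear t ht x)) ?_
  rw [← mul_assoc, show 1 - 1 / α - 4 / α = 1 - 5 / α by ring]
  exact ofReal_mul_rpow_add_le hC (by positivity) ht

theorem IsMildSolution.continuousOn_duhamelIntegrand (hα : 0 < α) (h : IsMildSolution α θ₀ θ)
    (t : ℝ) : ContinuousOn (fun p : Plane × ℝ => duhamelIntegrand α θ t p.2 p.1)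
      (Set.univ ×ˢ Set.Ioo 0 t) := fun p hp => by
  have h1 := (h.continuousAt_duhamelIntegrand hα hp.2.1 hp.2.2 p.1).tendsto
  have h2 : Tendsto (fun p : Plane × ℝ => (p.2, p.1)) (𝓝 p) (𝓝 (p.2, p.1)) :=
    continuous_swap.tendsto p
  refine tendsto_nhdsWithin_of_tendsto_nhds ?_
  generalize duhamelIntegrand α θ t = F at h1 ⊢
  exact Tendsto.comp (g := fun p : ℝ × Plane => F p.1 p.2) h1 h2

theorem IsMildSolution.aestronglyMeasurable_duhamelIntegrand (hα : 0 < α)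
    (h : IsMildSolution α θ₀ θ) (t : ℝ) :
    AEStronglyMeasurable (fun p : Plane × ℝ => duhamelIntegrand α θ t p.2 p.1)
      (volume.prod (volume.restrict (Set.Ioo 0 t))) := by
  have h1 := (h.continuousOn_duhamelIntegrand hα t).aestronglyMeasurable
    (μ := (volume : Measure Plane).prod volume) (MeasurableSet.univ.prod measurableSet_Ioo)
  rwa [← Measure.prod_restrict, Measure.restrict_univ] at h1

theorem IsMildSolution.intervalIntegrable_duhamelIntegrand (hα : 0 < α)
    (h : IsMildSolution α θ₀ θ) {t : ℝ} (ht : 0 ≤ t) (x : Plane)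
    (hfin : ∫⁻ s in Set.Ioo 0 t, ‖duhamelIntegrand α θ t s x‖ₑ < ⊤) :
    IntervalIntegrable (fun s => duhamelIntegrand α θ t s x) volume 0 t := by
  rw [intervalIntegrable_iff_integrableOn_Ioo_of_le ht]
  refine ⟨ContinuousOn.aestronglyMeasurable (fun s hs => ?_) measurableSet_Ioo, hfin⟩
  have h1 := (h.continuousAt_duhamelIntegrand hα hs.1 hs.2 x).tendsto
  have h2 : Tendsto (fun s : ℝ => (s, x)) (𝓝 s) (𝓝 (s, x)) :=
    (by fun_prop : Continuous fun s : ℝ => (s, x)).tendsto s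
  refine tendsto_nhdsWithin_of_tendsto_nhds ?_
  generalize duhamelIntegrand α θ t = F at h1 ⊢
  exact Tendsto.comp (g := fun p : ℝ × Plane => F p.1 p.2) h1 h2

theorem duhamel_eq {t : ℝ} (ht : 0 ≤ t) (x : Plane) :
    duhamel α θ t x = ∫ s in Set.Ioo 0 t, duhamelIntegrand α θ t s x := by
  rw [duhamel, intervalIntegral.integral_of_le ht, integral_Ioc_eq_integral_Ioo]

end Bounds

/-! ### Interpolation -/

/-- Interpolation between `L¹` and `L^∞`. -/
theorem eLpNorm_le_of_one_of_top {f : Plane → ℝ} {A B : ℝ}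
    (hA : 0 < A) (hB : 0 < B) (h1 : eLpNorm f 1 ≤ ENNReal.ofReal A)
    (hi : eLpNorm f ⊤ ≤ ENNReal.ofReal B) {p : ℝ≥0∞} (hp : 1 ≤ p) :
    eLpNorm f p ≤ ENNReal.ofReal (A ^ (1 / p).toReal * B ^ (1 - (1 / p).toReal)) := by
  rcases eq_or_ne p ⊤ with rfl | hpt
  · simpa using hi
  have hp0 : p ≠ 0 := (one_pos.trans_le hp).ne'
  have hq1 : 1 ≤ p.toReal := by
    rw [← ENNReal.toReal_one]
    exact (ENNReal.toReal_le_toReal (by simp) hpt).2 hp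
  have hq : 0 < p.toReal := by linarith
  rw [eLpNorm_eq_lintegral_rpow_enorm_toReal hp0 hpt, one_div p, ENNReal.toReal_inv]
  set q := p.toReal
  have h2 : ∫⁻ x, ‖f x‖ₑ ^ q ≤ ENNReal.ofReal (A * B ^ (q - 1)) := by
    calc ∫⁻ x, ‖f x‖ₑ ^ q ≤ ∫⁻ x, ‖f x‖ₑ * ENNReal.ofReal (B ^ (q - 1)) := by
          refine lintegral_mono_ae ?_
          filter_upwards [ae_enorm_le_eLpNorm_top f] with x hx
          calc ‖f x‖ₑ ^ q = ‖f x‖ₑ ^ (1 + (q - 1)) := by rw [add_sub_cancel]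
            _ = ‖f x‖ₑ * ‖f x‖ₑ ^ (q - 1) := by
                rw [ENNReal.rpow_add_of_nonneg _ _ zero_le_one (by linarith), ENNReal.rpow_one]
            _ ≤ ‖f x‖ₑ * ENNReal.ofReal B ^ (q - 1) := by
                have : 0 ≤ q - 1 := by linarith
                gcongr
                exact hx.trans hi
            _ = _ := by rw [ENNReal.ofReal_rpow_of_nonneg hB.le (by linarith)]
      _ ≤ _ := by
          rw [lintegral_mul_const' _ _ ENNReal.ofReal_ne_top, ← eLpNorm_one_eq_lintegral_enorm,
            ENNReal.ofReal_mul hA.le]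
          gcongr
  refine (ENNReal.rpow_le_rpow h2 (by positivity)).trans_eq ?_
  rw [ENNReal.ofReal_rpow_of_nonneg (by positivity) (by positivity),
    Real.mul_rpow hA.le (by positivity), ← Real.rpow_mul hB.le, one_div]
  congr 3
  field_simp

theorem one_div_rate (α : ℝ) (p : ℝ≥0∞) {t : ℝ} (ht : 1 ≤ t) :
    1 / rate α p t =
      logFactor α t * t ^ (-(2 / α * (1 - (1 / p).toReal) + 3 / α - 1)) := by
  rw [Real.rpow_neg (by linarith), rate, logFactor]
  split_ifs with h
  · rw [h, one_div_div, div_eq_mul_inv]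
    congr 3
    ring
  · rw [one_mul, one_div]

end SQG

end

/-! ### The decay estimate for every `p` -/

theorem mainTheorem3 (α : ℝ) (hα : α ∈ Set.Icc (1 : ℝ) 2) (p : ℝ≥0∞) (hp : 1 ≤ p)
    (θ₀ : SQG.Plane → ℝ) (hθ₀ : SQG.MemSobolev 1 θ₀ 1 ∧ SQG.MemSobolev 1 θ₀ ∞)
    (θ : ℝ → SQG.Plane → ℝ) (hθ : SQG.IsMildSolution α θ₀ θ) (hdecay : SQG.HasDecay α θ) :
    ∃ C : ℝ, 0 < C ∧ ∀ t : ℝ, 1 ≤ t →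
      (∀ᵐ x : SQG.Plane,
        IntervalIntegrable (fun s => SQG.duhamelIntegrand α θ t s x) volume 0 t) ∧
      MemLp (SQG.duhamel α θ t) p volume ∧
      eLpNorm (SQG.duhamel α θ t) p volume ≤ ENNReal.ofReal (C / SQG.rate α p t) := by
  obtain ⟨A, hA, hA1⟩ := SQG.exists_lintegral_lintegral_duhamelIntegrand_le hα.1 hα.2 hθ hdecay
  obtain ⟨B, hB, hB1⟩ := SQG.exists_lintegral_enorm_duhamelIntegrand_le hα.1 hα.2 hθ hdecay
  have hα0 : 0 < α := by linarith [hα.1]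
  -- A common constant for both endpoints is reproduced by interpolation; the summand 1 makes it
  -- positive.
  refine ⟨A + B + 1, by positivity, fun t ht => ?_⟩
  have ht0 : 0 < t := by linarith
  have hL : 0 < SQG.logFactor α t := one_pos.trans_le (SQG.one_le_logFactor α ht)
  have hm := hθ.aestronglyMeasurable_duhamelIntegrand hα0 t
  have hM : AEStronglyMeasurable (SQG.duhamel α θ t) := by
    rw [show SQG.duhamel α θ t = _ from funext (SQG.duhamel_eq ht0.le)]
    exact hm.integral_prod_right'
  have hle : ∀ x, ‖SQG.duhamel α θ t x‖ₑ ≤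
      ∫⁻ s in Set.Ioo 0 t, ‖SQG.duhamelIntegrand α θ t s x‖ₑ := fun x => by
    rw [SQG.duhamel_eq ht0.le]
    exact enorm_integral_le_lintegral_enorm _
  have hmono : ∀ {K e : ℝ}, K ≤ A + B + 1 →
      ENNReal.ofReal (K * SQG.logFactor α t * t ^ e) ≤
        ENNReal.ofReal ((A + B + 1) * SQG.logFactor α t * t ^ e) := fun {K e} hK =>
    ENNReal.ofReal_le_ofReal (by gcongr)
  have h1 : eLpNorm (SQG.duhamel α θ t) 1 ≤
      ENNReal.ofReal ((A + B + 1) * SQG.logFactor α t * t ^ (1 - 3 / α)) := by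
    rw [eLpNorm_one_eq_lintegral_enorm]
    refine (lintegral_mono hle).trans ?_
    rw [lintegral_lintegral_swap hm.enorm]
    exact (hA1 t ht).trans (hmono (by linarith))
  have hi : eLpNorm (SQG.duhamel α θ t) ⊤ ≤
      ENNReal.ofReal ((A + B + 1) * SQG.logFactor α t * t ^ (1 - 5 / α)) := by
    rw [eLpNorm_exponent_top]
    refine eLpNormEssSup_le_of_ae_enorm_bound (Eventually.of_forall fun x => ?_)
    exact (hle x).trans ((hB1 t ht x).trans (hmono (by linarith)))
  have hp1 := SQG.eLpNorm_le_of_one_of_top (by positivity) (by positivity) h1 hi hp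
  refine ⟨Eventually.of_forall fun x => hθ.intervalIntegrable_duhamelIntegrand hα0 ht0.le x
    ((hB1 t ht x).trans_lt ENNReal.ofReal_lt_top), ⟨hM, hp1.trans_lt ENNReal.ofReal_lt_top⟩,
    hp1.trans_eq ?_⟩
  rw [div_eq_mul_one_div (A + B + 1), SQG.one_div_rate α p ht, ← mul_assoc]
  have hD : 0 < (A + B + 1) * SQG.logFactor α t := by positivity
  generalize (A + B + 1) * SQG.logFactor α t = D at hD
  -- The powers of `D` add up to `D`, and `(1/p)(1 - 3/α) + (1 - 1/p)(1 - 5/α)` is the negative of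
  -- `(2/α)(1 - 1/p) + 3/α - 1`.
  rw [Real.mul_rpow hD.le (by positivity), Real.mul_rpow hD.le (by positivity),
    mul_mul_mul_comm, ← Real.rpow_add hD, add_sub_cancel, Real.rpow_one, ← Real.rpow_mul ht0.le,
    ← Real.rpow_mul ht0.le, ← Real.rpow_add ht0]
  congr 3
  ring
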